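/- **Conventions.** Let $I$ denote a finite set. A *submodular function* on $I$ is a function $z:\mathcal P(I)\to\mathbb R\cup\{\infty\}$ with $z(\emptyset)=0$, $z(I)<\infty$ and $z(A\cup B)+z(A\cap B)\le z(A)+z(B)$ for all $A,B\subseteq I$. It is *modular* if $z(A)+z(B)=z(A\cap B)+z(A\cup B)$ whenever $z(A),z(B)<\infty$. Let $\mathrm{SM}[I]$ (resp. $\mathrm{MOD}[I]$) be the real vector space with basis the submodular (resp. modular) functions on $I$; these are species (functors from finite sets with bijections to real vector spaces), and $\mathrm{MOD}\subseteq\mathrm{SM}$. For $I=S\sqcup T$ put $$\mu_{S,T}(u\otimes v)=u\cdot v,\quad (u\cdot v)(E)=u(E\cap S)+v(E\cap T);\qquad \Delta_{S,T}(z)=\begin{cases} z|_S\otimes z_{/S}, & z(S)<\infty\\ 0,&\text{otherwise,}\end{cases}$$ where $z|_S(U)=z(U)$ for $U\subseteq S$ and $z_{/S}(U)=z(S\cup U)-z(S)$ for $U\subseteq T$. The unit is the unique submodular function on $\emptyset$, and the counit is $1$ on it and $0$ on $\mathrm{SM}[I]$, $I\ne\emptyset$. For down-sets $A\subseteq B$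 of a preorder $P$ on $I$ with $z(A),z(B)<\infty$, let $z_{B/A}(U)=z(A\cup U)-z(A)$ for $U\subseteq B\setminus A$. The preorder $P$ *conforms* to $z$ if $z(A)<\infty$ for every down-set $A$ of $P$ and, for all down-sets $A\subseteq B$ and all disjoint $C_1,C_2$ with $C_1\cup C_2=B\setminus A$, one has $z_{B/A}=z_{B/A}|_{C_1}\cdot z_{B/A}|_{C_2}$ if and only if no element of $C_1$ is comparable in $P$ to an element of $C_2$. Let $\mathrm{Pre}(z)$ be the set of preorders conforming to $z$, ordered by inclusion of relations, and $\mathrm{minPre}(z)$ its set of minimal elements. For $P\in\mathrm{Pre}(z)$ let $z^P(A)=z(A)$ if $A$ is a down-set of $P$ and $z^P(A)=\infty$ otherwise; and let $z_P=\prod_C z_C$ over the bubbles $C$ of $P$ (classes of $x\le_P y\le_P x$), where $z_C=z_{B/A}$ with $B$ the down-set generated by $C$ and $A=B\setminus C$. The function $z^P$ is modular, and $z_P$ is modular if $z$ is. Define $$\delta_{\mathrm{SM}}:\mathrm{SM}[I]\to \mathrm{SM}[I]\otimes\mathrm{MOD}[I],\ z\mapsto\sum_{P\in\mathrm{Pre}(z)}z_P\otimes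 z^P,\qquad \phi:\mathrm{SM}[I]\to\mathrm{MOD}[I],\ z\mapsto\sum_{P\in\mathrm{minPre}(z)}z^P ,$$ let $\delta_{\mathrm{MOD}}:\mathrm{MOD}[I]\to\mathrm{MOD}[I]\otimes\mathrm{MOD}[I]$ be given by the same formula as $\delta_{\mathrm{SM}}$, and let $\varepsilon_{\mathrm{MOD}}(z)=1$ if $\{(x,y): y\in A\Rightarrow x\in A \text{ for all } A \text{ with } z(A)<\infty\}$ is an equivalence relation, and $\varepsilon_{\mathrm{MOD}}(z)=0$ otherwise. Let $\eta_{\mathrm{MOD}}[I]\in\mathrm{MOD}[I]$ be the function equal to $0$ on $\emptyset$ and $I$ and to $\infty$ elsewhere. **Theorem.** 1. $(\mathrm{SM},\mu,\Delta)$ and $(\mathrm{MOD},\mu,\Delta)$ are Hopf monoids in species (for the Cauchy product), and the inclusion $\mathrm{MOD}\subseteq\mathrm{SM}$ is compatible with $\mu,\Delta$, the units, the counits and $\delta$. 2. $\delta_{\mathrm{MOD}}$ is natural in bijections, coassociative, and counital on both sides with counit $\varepsilon_{\mathrm{MOD}}$; and $\delta_{\mathrm{MOD}}$, $\varepsilon_{\mathrm{MOD}}$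 are multiplicative and unital for $\mu$. So $(\mathrm{MOD},\mu,\delta_{\mathrm{MOD}},\varepsilon_{\mathrm{MOD}})$ is an internal bimonoid. The elements $\eta_{\mathrm{MOD}}[I]$ are natural in $I$, satisfy $\delta_{\mathrm{MOD}}(\eta)=\eta\otimes\eta$ and $\varepsilon_{\mathrm{MOD}}(\eta)=1$, and $\eta_{\mathrm{MOD}}[\emptyset]$ is the unit of $\mu$. 3. $\mathrm{SM}$ is a comodule bimonoid over $\mathrm{MOD}$ (the two are in cointeraction), in the following sense. The map $\delta_{\mathrm{SM}}$ is natural, $(\mathrm{id}\otimes\delta_{\mathrm{MOD}})\delta_{\mathrm{SM}}=(\delta_{\mathrm{SM}}\otimes\mathrm{id})\delta_{\mathrm{SM}}$ and $(\mathrm{id}\otimes\varepsilon_{\mathrm{MOD}})\delta_{\mathrm{SM}}=\mathrm{id}$; it is a morphism of monoids, i.e. $\delta_{\mathrm{SM}}(u\cdot v)=\delta_{\mathrm{SM}}(u)\,\delta_{\mathrm{SM}}(v)$ with factorwise products, and it sends unit to unit; and for $I=S\sqcup T$ $$(\mathrm{id}\otimes\Delta_{S,T})\circ\delta_{\mathrm{SM}}=(\mu_{S,T}\otimes\mathrm{id}\otimes\mathrm{id})\circ(\mathrm{id}\otimes\tau\otimes\mathrm{id})\circ(\delta_{\mathrm{SM}}\otimes\delta_{\mathrm{SM}})\circ\Delta_{S,T}$$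 as maps $\mathrm{SM}[I]\to\mathrm{SM}[I]\otimes\mathrm{MOD}[S]\otimes\mathrm{MOD}[T]$, where $\tau:\mathrm{MOD}[S]\otimes\mathrm{SM}[T]\to\mathrm{SM}[T]\otimes\mathrm{MOD}[S]$ is the flip; and on $\mathrm{SM}[\emptyset]$ the counit $\epsilon$ and unit $\eta$ for $\Delta$ and $\mu$ satisfy $(\mathrm{id}\otimes\epsilon)\delta_{\mathrm{SM}}=\eta\,\epsilon$. In the same sense $\mathrm{MOD}$ is, through $\delta_{\mathrm{MOD}}$, a comodule bimonoid over itself. 4. $\phi$ is a morphism of Hopf monoids in species (natural, compatible with products, coproducts, units, counits and antipodes) and of comodules: $\delta_{\mathrm{MOD}}\circ\phi=(\phi\otimes\mathrm{id})\circ\delta_{\mathrm{SM}}=(\phi\otimes\phi|_{\mathrm{MOD}})\circ\delta_{\mathrm{SM}}$. -/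

import Mathlib

open scoped TensorProduct

universe u

namespace Cointeraction

noncomputable section

/-! ### Vector species and bimonoids in species -/

/-- A species in real vector spaces: a functor from finite sets with bijections to
vector spaces over `ℝ`. -/
structure Species where
  obj : ∀ (I : Type u) [Finite I], Type u
  [addCommGroup : ∀ (I : Type u) [Finite I], AddCommGroup (obj I)]
  [module : ∀ (I : Type u) [Finite I], Module ℝ (obj I)]
  map : ∀ {I J : Type u} [Finite I] [Finite J], (I ≃ J) → (obj I →ₗ[ℝ] obj J)
  map_refl : ∀ (I : Type u) [Finite I], map (Equiv.refl I) = LinearMap.id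
  map_trans : ∀ {I J K : Type u} [Finite I] [Finite J] [Finite K] (e : I ≃ J) (f : J ≃ K),
    map (e.trans f) = map f ∘ₗ map e

attribute [instance] Species.addCommGroup Species.module

/-- A family of linear maps between the values of two species. -/
abbrev Family (F G : Species.{u}) : Type (u + 1) :=
  ∀ (I : Type u) [Finite I], F.obj I →ₗ[ℝ] G.obj I

/-- A family of linear maps is a morphism of species when it is natural in bijections. -/
def IsSpeciesMorphism {F G : Species.{u}} (φ : Family F G) : Prop :=
  ∀ (I J : Type u) [Finite I] [Finite J] (e : I ≃ J), φ J ∘ₗ F.map e = G.map e ∘ₗ φ I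

/-- The structure maps of a bimonoid for the Cauchy product. A decomposition `I = S ⊔ T` is
presented as the disjoint sum `S ⊕ T`; all the maps below are required to be natural in bijections,
so this covers every decomposition of every finite set. The unit species is `ℝ` on the empty
set and zero elsewhere, so that the unit is an element, and the counit a linear form,
at the empty set. -/
structure CauchyOps (F : Species.{u}) where
  mul : ∀ (S T : Type u) [Finite S] [Finite T], F.obj S ⊗[ℝ] F.obj T →ₗ[ℝ] F.obj (S ⊕ T)
  one : F.obj PEmpty.{u + 1}
  comul : ∀ (S T : Type u) [Finite S] [Finite T], F.obj (S ⊕ T) →ₗ[ℝ] F.obj S ⊗[ℝ] F.obj T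
  counit : F.obj PEmpty.{u + 1} →ₗ[ℝ] ℝ

/-- Monoid in species, for the Cauchy product. -/
structure IsMonoid {F : Species.{u}} (H : CauchyOps F) : Prop where
  mul_natural : ∀ (S S' T T' : Type u) [Finite S] [Finite S'] [Finite T] [Finite T']
    (e : S ≃ S') (f : T ≃ T'),
    F.map (Equiv.sumCongr e f) ∘ₗ H.mul S T = H.mul S' T' ∘ₗ TensorProduct.map (F.map e) (F.map f)
  mul_assoc : ∀ (R S T : Type u) [Finite R] [Finite S] [Finite T],
    F.map (Equiv.sumAssoc R S T) ∘ₗ H.mul (R ⊕ S) T ∘ₗ (H.mul R S).rTensor (F.obj T) =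
      H.mul R (S ⊕ T) ∘ₗ (H.mul S T).lTensor (F.obj R) ∘ₗ
        (TensorProduct.assoc ℝ (F.obj R) (F.obj S) (F.obj T)).toLinearMap
  one_mul : ∀ (T : Type u) [Finite T] (x : F.obj T),
    F.map (Equiv.emptySum PEmpty.{u + 1} T) (H.mul PEmpty T (H.one ⊗ₜ x)) = x
  mul_one : ∀ (S : Type u) [Finite S] (x : F.obj S),
    F.map (Equiv.sumEmpty S PEmpty.{u + 1}) (H.mul S PEmpty (x ⊗ₜ H.one)) = x

/-- Comonoid in species, for the Cauchy product. -/
structure IsComonoid {F : Species.{u}} (H : CauchyOps F) : Prop where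
  comul_natural : ∀ (S S' T T' : Type u) [Finite S] [Finite S'] [Finite T] [Finite T']
    (e : S ≃ S') (f : T ≃ T'),
    H.comul S' T' ∘ₗ F.map (Equiv.sumCongr e f) =
      TensorProduct.map (F.map e) (F.map f) ∘ₗ H.comul S T
  comul_coassoc : ∀ (R S T : Type u) [Finite R] [Finite S] [Finite T],
    (TensorProduct.assoc ℝ (F.obj R) (F.obj S) (F.obj T)).toLinearMap ∘ₗ
        (H.comul R S).rTensor (F.obj T) ∘ₗ H.comul (R ⊕ S) T =
      (H.comul S T).lTensor (F.obj R) ∘ₗ H.comul R (S ⊕ T) ∘ₗ F.map (Equiv.sumAssoc R S T)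
  counit_comul : ∀ (T : Type u) [Finite T] (x : F.obj T),
    TensorProduct.lid ℝ (F.obj T) (H.counit.rTensor (F.obj T)
      (H.comul PEmpty T (F.map (Equiv.emptySum PEmpty.{u + 1} T).symm x))) = x
  comul_counit : ∀ (S : Type u) [Finite S] (x : F.obj S),
    TensorProduct.rid ℝ (F.obj S) (H.counit.lTensor (F.obj S)
      (H.comul S PEmpty (F.map (Equiv.sumEmpty S PEmpty.{u + 1}).symm x))) = x

/-- Bimonoid in species, for the Cauchy product and its symmetry. -/
structure IsBimonoid {F : Species.{u}} (H : CauchyOps F) : Prop where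
  isMonoid : IsMonoid H
  isComonoid : IsComonoid H
  comul_mul : ∀ (A B C D : Type u) [Finite A] [Finite B] [Finite C] [Finite D],
    H.comul (A ⊕ C) (B ⊕ D) ∘ₗ F.map (Equiv.sumSumSumComm A B C D) ∘ₗ H.mul (A ⊕ B) (C ⊕ D) =
      TensorProduct.map (H.mul A C) (H.mul B D) ∘ₗ
        (TensorProduct.tensorTensorTensorComm ℝ
          (F.obj A) (F.obj B) (F.obj C) (F.obj D)).toLinearMap ∘ₗ
        TensorProduct.map (H.comul A B) (H.comul C D)
  comul_one : H.comul PEmpty PEmpty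
      (F.map (Equiv.emptySum PEmpty.{u + 1} PEmpty.{u + 1}).symm H.one) = H.one ⊗ₜ H.one
  counit_mul : ∀ x y : F.obj PEmpty.{u + 1},
    H.counit (F.map (Equiv.emptySum PEmpty.{u + 1} PEmpty.{u + 1})
      (H.mul PEmpty PEmpty (x ⊗ₜ y))) = H.counit x * H.counit y
  counit_one : H.counit H.one = 1

open Classical in
/-- The composite of the counit `F ⟶ U` and the unit `U ⟶ F`, at an arbitrary finite set. -/
def unitCounit {F : Species.{u}} (H : CauchyOps F) : Family F F := fun I _ =>
  if _h : IsEmpty I then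
    F.map (Equiv.equivPEmpty.{u + 1, u + 1} I).symm ∘ₗ
      H.counit.smulRight H.one ∘ₗ F.map (Equiv.equivPEmpty.{u + 1, u + 1} I)
  else 0

open Classical in
/-- The convolution product of two families, at an arbitrary finite set: the sum over all
decompositions `I = S ⊔ (I \ S)` of `mul ∘ (f ⊗ g) ∘ comul`. -/
def convolution {F : Species.{u}} (H : CauchyOps F) (f g : Family F F) : Family F F := fun I _ =>
  letI : Fintype (Set I) := Fintype.ofFinite _
  ∑ S : Set I, F.map (Equiv.Set.sumCompl S) ∘ₗ H.mul ↥S ↥Sᶜ ∘ₗ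
    TensorProduct.map (f ↥S) (g ↥Sᶜ) ∘ₗ H.comul ↥S ↥Sᶜ ∘ₗ F.map (Equiv.Set.sumCompl S).symm

/-- `s` is an antipode: a convolution inverse of the identity. -/
structure IsAntipode {F : Species.{u}} (H : CauchyOps F) (s : Family F F) : Prop where
  isMorphism : IsSpeciesMorphism s
  id_conv : ∀ (I : Type u) [Finite I],
    convolution H (fun _ _ => LinearMap.id) s I = unitCounit H I
  conv_id : ∀ (I : Type u) [Finite I],
    convolution H s (fun _ _ => LinearMap.id) I = unitCounit H I

/-- Hopf monoid in species: a bimonoid which has an antipode. -/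
structure IsHopfMonoid {F : Species.{u}} (H : CauchyOps F) : Prop where
  isBimonoid : IsBimonoid H
  exists_antipode : ∃ s : Family F F, IsAntipode H s

/-- Morphism of bimonoids in species. -/
structure IsBimonoidMorphism {F G : Species.{u}} (H : CauchyOps F) (K : CauchyOps G)
    (φ : Family F G) : Prop where
  isMorphism : IsSpeciesMorphism φ
  map_mul : ∀ (S T : Type u) [Finite S] [Finite T],
    φ (S ⊕ T) ∘ₗ H.mul S T = K.mul S T ∘ₗ TensorProduct.map (φ S) (φ T)
  map_one : φ PEmpty H.one = K.one
  map_comul : ∀ (S T : Type u) [Finite S] [Finite T],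
    K.comul S T ∘ₗ φ (S ⊕ T) = TensorProduct.map (φ S) (φ T) ∘ₗ H.comul S T
  map_counit : K.counit ∘ₗ φ PEmpty = H.counit

/-- Morphism of Hopf monoids in species: a morphism of bimonoids that commutes with antipodes. -/
structure IsHopfMorphism {F G : Species.{u}} (H : CauchyOps F) (K : CauchyOps G)
    (φ : Family F G) : Prop where
  isBimonoidMorphism : IsBimonoidMorphism H K φ
  map_antipode : ∀ (s : Family F F) (t : Family G G), IsAntipode H s → IsAntipode K t →
    ∀ (I : Type u) [Finite I], φ I ∘ₗ s I = t I ∘ₗ φ I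

/-! ### Internal coproducts and comodules, for the Hadamard product -/

/-- A family of linear maps `F ⟶ F ⊙ C`, where `⊙` is the Hadamard product. -/
abbrev Coaction (F C : Species.{u}) : Type (u + 1) :=
  ∀ (I : Type u) [Finite I], F.obj I →ₗ[ℝ] F.obj I ⊗[ℝ] C.obj I

/-- A family of linear forms; that is, a family of maps to the species with constant value `ℝ`,
the unit for the Hadamard product. -/
abbrev Forms (C : Species.{u}) : Type (u + 1) :=
  ∀ (I : Type u) [Finite I], C.obj I →ₗ[ℝ] ℝ

/-- `ρ : F ⟶ F ⊙ C` is natural. -/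
def Coaction.IsNatural {F C : Species.{u}} (ρ : Coaction F C) : Prop :=
  ∀ (I J : Type u) [Finite I] [Finite J] (e : I ≃ J),
    ρ J ∘ₗ F.map e = TensorProduct.map (F.map e) (C.map e) ∘ₗ ρ I

/-- `(id ⊗ δ) ∘ ρ = (ρ ⊗ id) ∘ ρ`. -/
def Coaction.IsCoassociative {F C : Species.{u}} (ρ : Coaction F C) (δ : Coaction C C) : Prop :=
  ∀ (I : Type u) [Finite I],
    (δ I).lTensor (F.obj I) ∘ₗ ρ I =
      (TensorProduct.assoc ℝ (F.obj I) (C.obj I) (C.obj I)).toLinearMap ∘ₗ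
        (ρ I).rTensor (C.obj I) ∘ₗ ρ I

/-- `(id ⊗ ε) ∘ ρ = id`. -/
def Coaction.IsCounital {F C : Species.{u}} (ρ : Coaction F C) (ε : Forms C) : Prop :=
  ∀ (I : Type u) [Finite I],
    (TensorProduct.rid ℝ (F.obj I)).toLinearMap ∘ₗ (ε I).lTensor (F.obj I) ∘ₗ ρ I = LinearMap.id

/-- `(C, δ, ε)` is a comonoid for the Hadamard product. -/
structure IsInternalComonoid {C : Species.{u}} (δ : Coaction C C) (ε : Forms C) : Prop where
  natural : δ.IsNatural
  counit_natural : ∀ (I J : Type u) [Finite I] [Finite J] (e : I ≃ J), ε J ∘ₗ C.map e = ε I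
  coassoc : δ.IsCoassociative δ
  rid : δ.IsCounital ε
  lid : ∀ (I : Type u) [Finite I],
    (TensorProduct.lid ℝ (C.obj I)).toLinearMap ∘ₗ (ε I).rTensor (C.obj I) ∘ₗ δ I = LinearMap.id

/-- `ρ` makes `F` a (right) comodule over the internal comonoid `(C, δ, ε)`. -/
structure IsComodule {F C : Species.{u}} (ρ : Coaction F C) (δ : Coaction C C) (ε : Forms C) :
    Prop where
  natural : ρ.IsNatural
  coassoc : ρ.IsCoassociative δ
  counital : ρ.IsCounital ε

/-- `ρ : F ⟶ F ⊙ C` is a morphism of monoids for the Cauchy product. -/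
structure Coaction.IsMultiplicative {F C : Species.{u}} (H : CauchyOps F) (K : CauchyOps C)
    (ρ : Coaction F C) : Prop where
  map_mul : ∀ (S T : Type u) [Finite S] [Finite T],
    ρ (S ⊕ T) ∘ₗ H.mul S T =
      TensorProduct.map (H.mul S T) (K.mul S T) ∘ₗ
        (TensorProduct.tensorTensorTensorComm ℝ
          (F.obj S) (C.obj S) (F.obj T) (C.obj T)).toLinearMap ∘ₗ
        TensorProduct.map (ρ S) (ρ T)
  map_one : ρ PEmpty H.one = H.one ⊗ₜ K.one

/-- `(C, mul, δ)` is an internal bimonoid: a monoid for the Cauchy product and a comonoid for the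
Hadamard product, whose coproduct and counit are morphisms of monoids. -/
structure IsInternalBimonoid {C : Species.{u}} (K : CauchyOps C) (δ : Coaction C C)
    (ε : Forms C) : Prop where
  isMonoid : IsMonoid K
  isInternalComonoid : IsInternalComonoid δ ε
  multiplicative : δ.IsMultiplicative K K
  counit_mul : ∀ (S T : Type u) [Finite S] [Finite T] (x : C.obj S) (y : C.obj T),
    ε (S ⊕ T) (K.mul S T (x ⊗ₜ y)) = ε S x * ε T y
  counit_one : ε PEmpty K.one = 1

/-- `(F, H)` is a comodule bimonoid, through `ρ`, over `(C, K, δ, ε)`, which carries an internal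
bimonoid and an external coproduct: the two are in cointeraction. The field `cointeraction` is

`(id ⊗ Δ_C) ∘ ρ = (mul_F ⊗ id ⊗ id) ∘ (id ⊗ τ ⊗ id) ∘ (ρ ⊗ ρ) ∘ Δ_F`

as maps `F[S ⊔ T] ⟶ F[S ⊔ T] ⊗ C[S] ⊗ C[T]`, and `cointeraction_counit` is its counterpart
`(id ⊗ ε_C) ∘ ρ = η_F ∘ ε_F` for the counits of the external coproducts. -/
structure IsComoduleBimonoid {F C : Species.{u}} (H : CauchyOps F) (K : CauchyOps C)
    (ρ : Coaction F C) (δ : Coaction C C) (ε : Forms C) : Prop where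
  isBimonoid : IsBimonoid H
  isBimonoid_base : IsBimonoid K
  isInternalBimonoid_base : IsInternalBimonoid K δ ε
  isComodule : IsComodule ρ δ ε
  multiplicative : ρ.IsMultiplicative H K
  cointeraction : ∀ (S T : Type u) [Finite S] [Finite T],
    (K.comul S T).lTensor (F.obj (S ⊕ T)) ∘ₗ ρ (S ⊕ T) =
      (H.mul S T).rTensor (C.obj S ⊗[ℝ] C.obj T) ∘ₗ
        (TensorProduct.tensorTensorTensorComm ℝ
          (F.obj S) (C.obj S) (F.obj T) (C.obj T)).toLinearMap ∘ₗ
        TensorProduct.map (ρ S) (ρ T) ∘ₗ H.comul S T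
  cointeraction_counit : ∀ x : F.obj PEmpty.{u + 1},
    TensorProduct.rid ℝ (F.obj PEmpty.{u + 1}) (K.counit.lTensor (F.obj PEmpty.{u + 1})
      (ρ PEmpty x)) = H.counit x • H.one

/-- `φ : F ⟶ G` is a morphism of comodules over `C`: `(φ ⊗ id) ∘ ρ = σ ∘ φ`. -/
structure IsComoduleMorphism {F G C : Species.{u}} (ρ : Coaction F C) (σ : Coaction G C)
    (φ : Family F G) : Prop where
  isMorphism : IsSpeciesMorphism φ
  map_coaction : ∀ (I : Type u) [Finite I],
    σ I ∘ₗ φ I = (φ I).rTensor (C.obj I) ∘ₗ ρ I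

/-! ### Submodular and modular functions -/

/-- Submodular functions on the subsets of `I`, with values in `ℝ ∪ {∞}`. -/
@[ext]
structure SubmodFun (I : Type u) where
  toFun : Set I → WithTop ℝ
  empty' : toFun ∅ = 0
  univ_ne_top' : toFun Set.univ ≠ ⊤
  submodular' : ∀ A B, toFun (A ∪ B) + toFun (A ∩ B) ≤ toFun A + toFun B

namespace SubmodFun

variable {I J S T : Type u}

instance : CoeFun (SubmodFun I) (fun _ => Set I → WithTop ℝ) := ⟨SubmodFun.toFun⟩

/-- A submodular function is modular when equality holds for all `A`, `B` with finite values. -/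
def IsModular (z : SubmodFun I) : Prop :=
  ∀ A B, z A ≠ ⊤ → z B ≠ ⊤ → z A + z B = z (A ∩ B) + z (A ∪ B)

/-- Transport along a bijection. -/
def map (e : I ≃ J) (z : SubmodFun I) : SubmodFun J where
  toFun E := z (e ⁻¹' E)
  empty' := by simpa using z.empty'
  univ_ne_top' := by simpa using z.univ_ne_top'
  submodular' A B := by simpa using z.submodular' (e ⁻¹' A) (e ⁻¹' B)

/-- The product `u · v`, with `(u · v)(E) = u(E ∩ S) + v(E ∩ T)`. -/
def prod (u : SubmodFun S) (v : SubmodFun T) : SubmodFun (S ⊕ T) where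
  toFun E := u (Sum.inl ⁻¹' E) + v (Sum.inr ⁻¹' E)
  empty' := by simp [u.empty', v.empty']
  univ_ne_top' := by simp [u.univ_ne_top', v.univ_ne_top']
  submodular' A B := by
    have h1 := u.submodular' (Sum.inl ⁻¹' A) (Sum.inl ⁻¹' B)
    have h2 := v.submodular' (Sum.inr ⁻¹' A) (Sum.inr ⁻¹' B)
    have h := add_le_add h1 h2
    simp only [Set.preimage_union, Set.preimage_inter]
    rw [add_add_add_comm, add_add_add_comm (u _) (v _)]
    exact h

/-- The subset `S` of the disjoint union of `S` and `T`. -/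
abbrev left (S T : Type u) : Set (S ⊕ T) := Set.range Sum.inl

/-- The restriction `z|_S`, when `z(S)` is finite. -/
def restrict (z : SubmodFun (S ⊕ T)) (h : z (left S T) ≠ ⊤) : SubmodFun S where
  toFun U := z (Sum.inl '' U)
  empty' := by simpa using z.empty'
  univ_ne_top' := by simpa using h
  submodular' A B := by
    simpa [Set.image_union, Set.image_inter Sum.inl_injective] using
      z.submodular' (Sum.inl '' A) (Sum.inl '' B)

theorem submodular_minor (z : SubmodFun I) (X A B : Set I) :
    (z (X ∪ (A ∪ B)) - z X) + (z (X ∪ (A ∩ B)) - z X) ≤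
      (z (X ∪ A) - z X) + (z (X ∪ B) - z X) := by
  have h := z.submodular' (X ∪ A) (X ∪ B)
  rw [← Set.union_union_distrib_left, ← Set.union_inter_distrib_left] at h
  simp only [sub_eq_add_neg]
  rw [add_add_add_comm, add_add_add_comm (z (X ∪ A))]
  gcongr

theorem modular_minor {z : SubmodFun I} (hz : z.IsModular) (X A B : Set I)
    (hA : z (X ∪ A) - z X ≠ ⊤) (hB : z (X ∪ B) - z X ≠ ⊤) :
    (z (X ∪ A) - z X) + (z (X ∪ B) - z X) =
      (z (X ∪ (A ∩ B)) - z X) + (z (X ∪ (A ∪ B)) - z X) := by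
  simp only [sub_eq_add_neg, ne_eq, WithTop.add_eq_top, not_or] at hA hB ⊢
  have h := hz (X ∪ A) (X ∪ B) hA.1 hB.1
  rw [← Set.union_union_distrib_left, ← Set.union_inter_distrib_left] at h
  rw [add_add_add_comm, add_add_add_comm (z (X ∪ (A ∩ B))), h]

theorem sub_self_of_ne_top {a : WithTop ℝ} (h : a ≠ ⊤) : a - a = 0 := by
  lift a to ℝ using h
  rw [← WithTop.LinearOrderedAddCommGroup.coe_sub]; simp

theorem sub_ne_top {a b : WithTop ℝ} (ha : a ≠ ⊤) (hb : b ≠ ⊤) : a - b ≠ ⊤ := by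
  lift a to ℝ using ha
  lift b to ℝ using hb
  rw [← WithTop.LinearOrderedAddCommGroup.coe_sub]; exact WithTop.coe_ne_top

/-- The corestriction `z_{/S}`, with `z_{/S}(U) = z(S ∪ U) - z(S)`, when `z(S)` is finite. -/
def corestrict (z : SubmodFun (S ⊕ T)) (h : z (left S T) ≠ ⊤) : SubmodFun T where
  toFun U := z (left S T ∪ Sum.inr '' U) - z (left S T)
  empty' := by simpa using sub_self_of_ne_top h
  univ_ne_top' := by
    simpa using sub_ne_top z.univ_ne_top' h
  submodular' A B := by
    rw [Set.image_union, Set.image_inter Sum.inr_injective]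
    exact z.submodular_minor _ _ _

theorem IsModular.map {z : SubmodFun I} (hz : z.IsModular) (e : I ≃ J) : (z.map e).IsModular :=
  fun A B hA hB => by simpa [SubmodFun.map] using hz (e ⁻¹' A) (e ⁻¹' B) hA hB

theorem IsModular.prod {u : SubmodFun S} {v : SubmodFun T} (hu : u.IsModular)
    (hv : v.IsModular) : (u.prod v).IsModular := by
  intro A B hA hB
  simp only [SubmodFun.prod, ne_eq, WithTop.add_eq_top, not_or, Set.preimage_union,
    Set.preimage_inter] at hA hB ⊢
  rw [add_add_add_comm, hu _ _ hA.1 hB.1, hv _ _ hA.2 hB.2, add_add_add_comm]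

theorem IsModular.restrict {z : SubmodFun (S ⊕ T)} (hz : z.IsModular)
    (h : z (left S T) ≠ ⊤) : (z.restrict h).IsModular := by
  intro A B hA hB
  simpa [SubmodFun.restrict, Set.image_union, Set.image_inter Sum.inl_injective] using
    hz (Sum.inl '' A) (Sum.inl '' B) hA hB

theorem IsModular.corestrict {z : SubmodFun (S ⊕ T)} (hz : z.IsModular)
    (h : z (left S T) ≠ ⊤) : (z.corestrict h).IsModular := by
  intro A B hA hB
  simp only [SubmodFun.corestrict] at hA hB ⊢
  rw [Set.image_union, Set.image_inter Sum.inr_injective]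
  exact modular_minor hz _ _ _ hA hB

/-- The unique submodular function on the empty set. -/
def zero : SubmodFun PEmpty.{u + 1} where
  toFun _ := 0
  empty' := rfl
  univ_ne_top' := WithTop.zero_ne_top
  submodular' _ _ := le_rfl

theorem isModular_zero : zero.{u}.IsModular := fun _ _ _ _ => rfl

/-- The function with value `0` on the open sets `∅` and `I` of the coarse topology on `I`, and
value `∞` on all other subsets. -/
def lowCoarse (I : Type u) : SubmodFun I where
  toFun A := open Classical in if A = ∅ ∨ A = Set.univ then 0 else ⊤
  empty' := by simp
  univ_ne_top' := by simp
  submodular' A B := by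
    by_cases hA : A = ∅ ∨ A = Set.univ
    · by_cases hB : B = ∅ ∨ B = Set.univ
      · rcases hA with rfl | rfl <;> rcases hB with rfl | rfl <;> simp
      · simp [hB]
    · simp [hA]

theorem isModular_lowCoarse : (lowCoarse I).IsModular := by
  intro A B hA hB
  simp only [lowCoarse, ne_eq, ite_eq_right_iff, WithTop.zero_ne_top, imp_false,
    not_not] at hA hB ⊢
  rcases hA with rfl | rfl <;> rcases hB with rfl | rfl <;> simp

end SubmodFun

/-! ### Preorders, compatible and conforming preorders -/

section Preorders

variable {I : Type u}

/-- Down-sets of a preorder. -/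
def IsDownSet (P : Preorder I) (A : Set I) : Prop := ∀ ⦃x y⦄, P.le x y → y ∈ A → x ∈ A

/-- The order on preorders: `P ≼ Q` when `x ≤_P y` implies `x ≤_Q y`. -/
def Refines (P Q : Preorder I) : Prop := ∀ ⦃x y⦄, P.le x y → Q.le x y

/-- A preorder is totally disconnected when it is an equivalence relation, that is, when its
bubbles are its connected components. -/
def IsTotallyDisconnected (P : Preorder I) : Prop := ∀ ⦃x y⦄, P.le x y → P.le y x

/-- No element of `C₁` is comparable to an element of `C₂`; for disjoint `C₁` and `C₂` this says
that the preorder induced on `C₁ ∪ C₂` is the disjoint union of those on `C₁` and `C₂`. -/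
def Separated (P : Preorder I) (C₁ C₂ : Set I) : Prop :=
  ∀ x ∈ C₁, ∀ y ∈ C₂, ¬ P.le x y ∧ ¬ P.le y x

/-- The bubbles of a preorder: the classes of `x ≤ y ∧ y ≤ x`. -/
def bubbles (P : Preorder I) : Set (Set I) :=
  Set.range fun x => {y | P.le x y ∧ P.le y x}

/-- The complement of `C` in the down-set generated by `C`; for a convex `C` this is a down-set `A`,
and `C = B \ A` where `B` is the down-set generated by `C`. -/
def below (P : Preorder I) (C : Set I) : Set I := {y | ∃ x ∈ C, P.le y x} \ C

theorem isDownSet_below (P : Preorder I) {C : Set I} (hC : C ∈ bubbles P) :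
    IsDownSet P (below P C) := by
  obtain ⟨c, rfl⟩ := hC
  rintro x y hxy ⟨⟨w, hw, hyw⟩, hy⟩
  refine ⟨⟨w, hw, P.le_trans _ _ _ hxy hyw⟩, fun hx => hy ⟨?_, ?_⟩⟩
  · exact P.le_trans _ _ _ hx.1 hxy
  · exact P.le_trans _ _ _ hyw hw.2

theorem isDownSet_below_union (P : Preorder I) (C : Set I) :
    IsDownSet P (below P C ∪ C) := by
  have h : below P C ∪ C = {y | ∃ x ∈ C, P.le y x} := by
    ext y
    simp only [below, Set.mem_union, Set.mem_sdiff, Set.mem_ofPred_eq]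
    constructor
    · rintro (h | h)
      · exact h.1
      · exact ⟨y, h, P.le_refl y⟩
    · intro h
      by_cases hy : y ∈ C
      · exact Or.inr hy
      · exact Or.inl ⟨h, hy⟩
  rw [h]
  rintro x y hxy ⟨w, hw, hyw⟩
  exact ⟨w, hw, P.le_trans _ _ _ hxy hyw⟩

instance [Finite I] : Finite (Preorder I) :=
  Finite.of_injective (fun P : Preorder I => (P.le : I → I → Prop)) fun P Q h => by
    apply Preorder.toLE_injective
    exact LE.ext h

instance [Finite I] (P : Preorder I) : Fintype (bubbles P) := Fintype.ofFinite _

/-- The values of the minor `z_{B/A}`, for `U ⊆ B \ A`. -/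
def minor (z : SubmodFun I) (A U : Set I) : WithTop ℝ := z (A ∪ U) - z A

/-- For `C₁ ⊔ C₂ = B \ A`, the minor `z' = z_{B/A}` is the product of its restrictions to `C₁`
and `C₂`. -/
def Splits (z : SubmodFun I) (A C₁ C₂ : Set I) : Prop :=
  ∀ U ⊆ C₁ ∪ C₂, minor z A U = minor z A (U ∩ C₁) + minor z A (U ∩ C₂)

/-- `P` is compatible with `z`. -/
structure Compatible (z : SubmodFun I) (P : Preorder I) : Prop where
  finite : ∀ A, IsDownSet P A → z A ≠ ⊤
  splits : ∀ A B, IsDownSet P A → IsDownSet P B → A ⊆ B →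
    ∀ C₁ C₂, Disjoint C₁ C₂ → C₁ ∪ C₂ = B \ A → Separated P C₁ C₂ → Splits z A C₁ C₂

/-- `P` conforms to `z`. The convex subsets `C` of `P` are the differences `B \ A` of down-sets
`A ⊆ B`, and `z_C = z_{B/A}`. -/
structure Conforms (z : SubmodFun I) (P : Preorder I) : Prop extends Compatible z P where
  separated : ∀ A B, IsDownSet P A → IsDownSet P B → A ⊆ B →
    ∀ C₁ C₂, Disjoint C₁ C₂ → C₁ ∪ C₂ = B \ A → Splits z A C₁ C₂ → Separated P C₁ C₂

/-- The set of preorders conforming to `z`. -/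
def ConformingPre (z : SubmodFun I) : Type u := {P : Preorder I // Conforms z P}

/-- The set of minimal preorders conforming to `z`. -/
def MinConformingPre (z : SubmodFun I) : Type u :=
  {P : Preorder I // Conforms z P ∧ ∀ Q, Conforms z Q → Refines Q P → Refines P Q}

instance [Finite I] (z : SubmodFun I) : Fintype (ConformingPre z) :=
  letI : Finite (ConformingPre z) := inferInstanceAs (Finite (Subtype _))
  Fintype.ofFinite _

instance [Finite I] (z : SubmodFun I) : Fintype (MinConformingPre z) :=
  letI : Finite (MinConformingPre z) := inferInstanceAs (Finite (Subtype _))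
  Fintype.ofFinite _

/-- The function `z^P`, equal to `z` on the down-sets of `P` and to `∞` elsewhere. -/
def cone (z : SubmodFun I) (P : Preorder I) : SubmodFun I where
  toFun A := open Classical in if IsDownSet P A then z A else ⊤
  empty' := by
    have h : IsDownSet P ∅ := fun x y _ h => h.elim
    simpa [h] using z.empty'
  univ_ne_top' := by
    have h : IsDownSet P Set.univ := fun x y _ _ => Set.mem_univ x
    simpa [h] using z.univ_ne_top'
  submodular' A B := by
    by_cases hA : IsDownSet P A
    · by_cases hB : IsDownSet P B
      · have h1 : IsDownSet P (A ∪ B) := fun x y h hy =>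
          hy.elim (fun hy => Or.inl (hA h hy)) fun hy => Or.inr (hB h hy)
        have h2 : IsDownSet P (A ∩ B) := fun x y h hy => ⟨hA h hy.1, hB h hy.2⟩
        simpa [hA, hB, h1, h2] using z.submodular' A B
      · simp [hB]
    · simp [hA]

theorem isModular_cone {z : SubmodFun I} {P : Preorder I} (h : Compatible z P) :
    (cone z P).IsModular := by
  intro A B hA hB
  have hA' : IsDownSet P A := by
    by_contra hn
    exact hA (if_neg hn)
  have hB' : IsDownSet P B := by
    by_contra hn
    exact hB (if_neg hn)
  have h1 : IsDownSet P (A ∪ B) := fun x y h hy =>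
    hy.elim (fun hy => Or.inl (hA' h hy)) fun hy => Or.inr (hB' h hy)
  have h2 : IsDownSet P (A ∩ B) := fun x y h hy => ⟨hA' h hy.1, hB' h hy.2⟩
  simp only [cone, hA', hB', h1, h2, if_true]
  have hs := h.splits (A ∩ B) (A ∪ B) h2 h1 (fun x hx => Or.inl hx.1) (A \ B) (B \ A)
    (Set.disjoint_left.2 fun x hx hy => hx.2 hy.1)
    (by ext x; simp only [Set.mem_union, Set.mem_sdiff, Set.mem_inter_iff]; tauto)
    (fun x hx y hy => ⟨fun hxy => hx.2 (hB' hxy hy.1), fun hyx => hy.2 (hA' hyx hx.1)⟩)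
    _ subset_rfl
  have e1 : A ∩ B ∪ (A \ B ∪ B \ A) = A ∪ B := by
    ext x; simp only [Set.mem_union, Set.mem_sdiff, Set.mem_inter_iff]; tauto
  have e2 : A ∩ B ∪ (A \ B ∪ B \ A) ∩ (A \ B) = A := by
    ext x; simp only [Set.mem_union, Set.mem_sdiff, Set.mem_inter_iff]; tauto
  have e3 : A ∩ B ∪ (A \ B ∪ B \ A) ∩ (B \ A) = B := by
    ext x; simp only [Set.mem_union, Set.mem_sdiff, Set.mem_inter_iff]; tauto
  simp only [minor, e1, e2, e3] at hs
  have f1 := h.finite _ hA'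
  have f2 := h.finite _ hB'
  have f3 := h.finite _ h1
  have f4 := h.finite _ h2
  generalize z A = a at *
  generalize z B = b at *
  generalize z (A ∪ B) = c at *
  generalize z (A ∩ B) = d at *
  lift a to ℝ using f1
  lift b to ℝ using f2
  lift c to ℝ using f3
  lift d to ℝ using f4
  simp only [← WithTop.LinearOrderedAddCommGroup.coe_sub] at hs
  norm_cast at hs ⊢
  linarith

/-- The function `z_P`, the product of the `z_C` over the bubbles `C` of `P`. Its value at `E` is
the sum of the `z_C(E ∩ C)`, where `z_C(U) = z(A ∪ U) - z(A)` with `A = below P C`. -/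
def face [Finite I] (z : SubmodFun I) (P : Preorder I) (h : Compatible z P) : SubmodFun I where
  toFun E := ∑ C : bubbles P, minor z (below P C) (E ∩ C)
  empty' := by
    refine Finset.sum_eq_zero fun C _ => ?_
    simpa [minor] using
      SubmodFun.sub_self_of_ne_top (h.finite _ (isDownSet_below P C.2))
  univ_ne_top' := by
    refine WithTop.sum_ne_top.2 fun C _ => ?_
    rw [Set.univ_inter]
    exact SubmodFun.sub_ne_top (h.finite _ (isDownSet_below_union P C))
      (h.finite _ (isDownSet_below P C.2))
  submodular' A B := by
    rw [← Finset.sum_add_distrib, ← Finset.sum_add_distrib]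
    refine Finset.sum_le_sum fun C _ => ?_
    rw [Set.union_inter_distrib_right, Set.inter_inter_distrib_right]
    exact z.submodular_minor _ _ _

theorem isModular_face [Finite I] {z : SubmodFun I} (hz : z.IsModular) (P : Preorder I)
    (h : Compatible z P) : (face z P h).IsModular := by
  intro A B hA hB
  simp only [face] at hA hB ⊢
  rw [← Finset.sum_add_distrib, ← Finset.sum_add_distrib]
  refine Finset.sum_congr rfl fun C _ => ?_
  rw [Set.union_inter_distrib_right, Set.inter_inter_distrib_right]
  exact SubmodFun.modular_minor hz _ _ _ (WithTop.sum_ne_top.1 hA C (Finset.mem_univ _))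
    (WithTop.sum_ne_top.1 hB C (Finset.mem_univ _))

/-- The preorder `pre(z)`, whose down-sets are the sets on which `z` is finite: `x ≤ y` when every
set with finite value that contains `y` contains `x`. -/
abbrev pre (z : SubmodFun I) : Preorder I where
  le x y := ∀ A, z A ≠ ⊤ → y ∈ A → x ∈ A
  le_refl _ _ _ h := h
  le_trans _ _ _ h1 h2 A hA h := h1 A hA (h2 A hA h)

end Preorders

/-! ### The species `SM` of submodular functions -/

/-- The species `SM`; `SM[I]` is the vector space with basis the submodular functions on `I`. -/
abbrev SM : Species.{u} where
  obj I _ := SubmodFun I →₀ ℝ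
  map e := Finsupp.lmapDomain ℝ ℝ (SubmodFun.map e)
  map_refl _ _ := Finsupp.lmapDomain_id _ _
  map_trans e f := Finsupp.lmapDomain_comp _ _ (SubmodFun.map e) (SubmodFun.map f)

/-- The product and coproduct of `SM`. -/
def SM.ops : CauchyOps SM.{u} where
  mul S T _ _ := TensorProduct.lift <| Finsupp.linearCombination ℝ fun u : SubmodFun S =>
    Finsupp.linearCombination ℝ fun v : SubmodFun T => Finsupp.single (u.prod v) (1 : ℝ)
  one := Finsupp.single SubmodFun.zero 1
  comul S T _ _ := Finsupp.linearCombination ℝ fun z : SubmodFun (S ⊕ T) =>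
    open Classical in
    if h : z (SubmodFun.left S T) ≠ ⊤ then
      Finsupp.single (z.restrict h) (1 : ℝ) ⊗ₜ[ℝ] Finsupp.single (z.corestrict h) (1 : ℝ)
    else 0
  counit := Finsupp.linearCombination ℝ fun _ => (1 : ℝ)

/-! ### The species `MOD` of modular functions -/

/-- The modular functions on `I`. -/
abbrev ModFun (I : Type u) : Type u := {z : SubmodFun I // z.IsModular}

/-- Transport of modular functions along a bijection. -/
def ModFun.map {I J : Type u} (e : I ≃ J) (z : ModFun I) : ModFun J := ⟨z.1.map e, z.2.map e⟩

/-- The species `MOD`; `MOD[I]` is the vector space with basis the modular functions on `I`. -/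
abbrev MOD : Species.{u} where
  obj I _ := ModFun I →₀ ℝ
  map e := Finsupp.lmapDomain ℝ ℝ (ModFun.map e)
  map_refl _ _ := Finsupp.lmapDomain_id _ _
  map_trans e f := Finsupp.lmapDomain_comp _ _ (ModFun.map e) (ModFun.map f)

/-- The product and coproduct of `MOD`. -/
def MOD.ops : CauchyOps MOD.{u} where
  mul S T _ _ := TensorProduct.lift <| Finsupp.linearCombination ℝ fun u : ModFun S =>
    Finsupp.linearCombination ℝ fun v : ModFun T =>
      Finsupp.single (⟨u.1.prod v.1, u.2.prod v.2⟩ : ModFun (S ⊕ T)) (1 : ℝ)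
  one := Finsupp.single ⟨SubmodFun.zero, SubmodFun.isModular_zero⟩ 1
  comul S T _ _ := Finsupp.linearCombination ℝ fun z : ModFun (S ⊕ T) =>
    open Classical in
    if h : z.1 (SubmodFun.left S T) ≠ ⊤ then
      Finsupp.single (⟨z.1.restrict h, z.2.restrict h⟩ : ModFun S) (1 : ℝ) ⊗ₜ[ℝ]
        Finsupp.single (⟨z.1.corestrict h, z.2.corestrict h⟩ : ModFun T) (1 : ℝ)
    else 0
  counit := Finsupp.linearCombination ℝ fun _ => (1 : ℝ)

/-- The inclusion of `MOD` in `SM`. -/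
def incl : Family MOD.{u} SM.{u} := fun _ _ => Finsupp.lmapDomain ℝ ℝ Subtype.val

/-! ### The internal coproducts, and the morphism `φ` -/

/-- `δ_SM(z) = ∑ z_P ⊗ z^P` over the preorders `P` conforming to `z`. -/
def deltaSM : Coaction SM.{u} MOD.{u} := fun I _ =>
  Finsupp.linearCombination ℝ fun z : SubmodFun I => ∑ P : ConformingPre z,
    Finsupp.single (face z P.1 P.2.toCompatible) (1 : ℝ) ⊗ₜ[ℝ]
      Finsupp.single (⟨cone z P.1, isModular_cone P.2.toCompatible⟩ : ModFun I) (1 : ℝ)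

/-- `δ_MOD(z) = ∑ z_P ⊗ z^P` over the preorders `P` conforming to the modular function `z`. -/
def deltaMOD : Coaction MOD.{u} MOD.{u} := fun I _ =>
  Finsupp.linearCombination ℝ fun z : ModFun I => ∑ P : ConformingPre z.1,
    Finsupp.single (⟨face z.1 P.1 P.2.toCompatible,
      isModular_face z.2 P.1 P.2.toCompatible⟩ : ModFun I) (1 : ℝ) ⊗ₜ[ℝ]
      Finsupp.single (⟨cone z.1 P.1, isModular_cone P.2.toCompatible⟩ : ModFun I) (1 : ℝ)

/-- The internal counit: `1` if `pre(z)` is totally disconnected and `0` otherwise. -/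
def epsMOD : Forms MOD.{u} := fun I _ =>
  Finsupp.linearCombination ℝ fun z : ModFun I =>
    open Classical in if IsTotallyDisconnected (pre z.1) then (1 : ℝ) else 0

/-- The internal unit: the basis element of the coarse topology on `I`. -/
def etaMOD (I : Type u) [Finite I] : MOD.obj I :=
  Finsupp.single ⟨SubmodFun.lowCoarse I, SubmodFun.isModular_lowCoarse⟩ 1

/-- `φ(z) = ∑ z^P` over the minimal preorders `P` conforming to `z`. -/
def phi : Family SM.{u} MOD.{u} := fun I _ =>
  Finsupp.linearCombination ℝ fun z : SubmodFun I => ∑ P : MinConformingPre z,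
    Finsupp.single (⟨cone z P.1, isModular_cone P.2.1.toCompatible⟩ : ModFun I) (1 : ℝ)

end

end Cointeraction

open Cointeraction

/-! On a finite set, preorders correspond to lattices of subsets containing `∅` and the whole set: a
preorder is determined by its down-sets. In this language (`compatible_iff`, `conforms_iff`) `P` is
compatible with `z` when `z` is finite and modular on the down-sets of `P`. It conforms when, in
addition, every pair `X`, `Y` with `X ∩ Y` and `X ∪ Y` down-sets and with equality in the submodular
inequality consists of down-sets. All later arguments are about such equalities.

The core is the behaviour of conforming preorders under `z ↦ z^P` and `z ↦ z_Q`. The preorders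
conforming to `z^P` are those conforming to `z` and coarser than `P` (`conforms_cone_iff`). The
preorders conforming to `z_Q` correspond to those conforming to `z` and finer than `Q`, by cutting
`P` down to the bubbles of `Q` (`restEquiv`); the inverse keeps the down-sets on which `z` and `z_Q`
agree. Under this bijection `(z_Q)_R = z_P` (`face_rest`) and `(z_Q)^R = (z^P)_Q` (`cone_rest`).
Both sides of coassociativity are therefore the sum of `z_P ⊗ (z^P)_Q ⊗ z^Q` over conforming pairs
`P ≼ Q`. The bijection preserves minimality, so both sides of the comodule property of `φ` are the
part of the sum of `(z^P)_Q ⊗ z^Q` where `P` is minimal.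

For the counits, `splitPre z` is the only totally disconnected conforming preorder and its face is
`z`; when `z` is modular, `pre z` is the least conforming preorder and its cone is `z`. The latter
also makes `φ` a retraction of the inclusion of `MOD`.

For the external coproduct, the product of restriction and corestriction is the face of `z` at the
preorder `ordPre` placing `S` below `T` (`face_ordPre`). The coproduct kills `z^P` unless `P`
refines `ordPre`, and it undoes the product. So the compatibility of `δ` and of `φ` with coproducts
follows from their multiplicativity and from `restEquiv` at `ordPre`. This preorder is compatible
but need not conform, which is why the bijection asks only for compatibility of `Q`.

The bimonoid axioms are checked on basis functions. Both bimonoids are connected, so Takeuchi's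
formula gives the antipodes, and bimonoid morphisms preserve them. -/

namespace Cointeraction

noncomputable section

/-! ### Down-sets, and lattice criteria for compatible and conforming preorders. -/

section Downsets

variable {I : Type u}

theorem withTop_add_left_cancel {a b c : WithTop ℝ} (ha : a ≠ ⊤) (h : a + b = a + c) : b = c := by
  lift a to ℝ using ha
  cases b <;> cases c <;> simp_all; norm_cast at h

theorem withTop_add_right_cancel {a b c : WithTop ℝ} (ha : a ≠ ⊤) (h : b + a = c + a) : b = c :=
  withTop_add_left_cancel ha (by rwa [add_comm a, add_comm a])

theorem withTop_le_of_add_le_add_left {a b c : WithTop ℝ} (ha : a ≠ ⊤) (h : a + b ≤ a + c) :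
    b ≤ c := by
  lift a to ℝ using ha
  cases b <;> cases c <;> simp_all

theorem withTop_sub_add_cancel {a b : WithTop ℝ} (hb : b ≠ ⊤) : a - b + b = a := by
  lift b to ℝ using hb
  cases a
  · simp
  · rw [← WithTop.LinearOrderedAddCommGroup.coe_sub]; norm_cast; ring

theorem withTop_sub_eq_top_iff {a b : WithTop ℝ} (hb : b ≠ ⊤) : a - b = ⊤ ↔ a = ⊤ := by
  rw [← not_iff_not]
  refine ⟨fun h ha => h ?_, fun h => SubmodFun.sub_ne_top h hb⟩
  by_contra h'
  have := withTop_sub_add_cancel (a := a) hb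
  rw [ha] at h' this
  exact WithTop.add_ne_top.2 ⟨h', hb⟩ this

theorem minor_add {z : SubmodFun I} {A : Set I} (hA : z A ≠ ⊤) (U : Set I) :
    minor z A U + z A = z (A ∪ U) :=
  withTop_sub_add_cancel hA

theorem minor_eq_iff {z : SubmodFun I} {A : Set I} (hA : z A ≠ ⊤) (U : Set I) (a : WithTop ℝ) :
    minor z A U = a ↔ z (A ∪ U) = a + z A := by
  rw [← minor_add hA U]
  exact ⟨fun h => by rw [h], fun h => withTop_add_right_cancel hA h⟩

theorem SubmodFun.inter_union_ne_top {z : SubmodFun I} {A B : Set I} (hA : z A ≠ ⊤) (hB : z B ≠ ⊤) :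
    z (A ∩ B) ≠ ⊤ ∧ z (A ∪ B) ≠ ⊤ := by
  have h := ne_top_of_le_ne_top (WithTop.add_ne_top.2 ⟨hA, hB⟩) (z.submodular' A B)
  exact (WithTop.add_ne_top.1 h).symm

/-- For finite minors, splitting is detected by the top value alone. -/
theorem splits_iff {z : SubmodFun I} {A C₁ C₂ : Set I} (hA : z A ≠ ⊤)
    (hB : z (A ∪ (C₁ ∪ C₂)) ≠ ⊤) (hd : Disjoint C₁ C₂) :
    Splits z A C₁ C₂ ↔ z (A ∪ C₁) + z (A ∪ C₂) = z A + z (A ∪ (C₁ ∪ C₂)) := by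
  constructor
  · intro h
    have h := h _ subset_rfl
    rw [Set.union_inter_cancel_left, Set.union_inter_cancel_right, minor_eq_iff hA] at h
    rw [h, ← minor_add hA C₁, ← minor_add hA C₂]
    ac_rfl
  · intro h U hU
    rw [minor_eq_iff hA]
    apply withTop_add_right_cancel hA
    rw [add_assoc (minor z A _ + _), add_add_add_comm, minor_add hA, minor_add hA]
    have hC₁ : z (A ∪ C₁) ≠ ⊤ := fun h' => by
      rw [h', top_add] at h
      exact WithTop.add_ne_top.2 ⟨hA, hB⟩ h.symm
    have hC₂ : z (A ∪ C₂) ≠ ⊤ := fun h' => by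
      rw [h', add_top] at h
      exact WithTop.add_ne_top.2 ⟨hA, hB⟩ h.symm
    have hd' : ∀ x, x ∈ C₁ → x ∉ C₂ := fun x h1 h2 => Set.disjoint_left.1 hd h1 h2
    -- Adding `s1` and `s2` cancels `z (A ∪ U ∪ C₁)` and, by the hypothesis on the top value, bounds
    -- the sum over the two pieces of `U` from above; `s3` is the opposite inequality.
    have s1 := z.submodular' (A ∪ U) (A ∪ C₁)
    have s2 := z.submodular' (A ∪ U ∪ C₁) (A ∪ C₂)
    have s3 := z.submodular' (A ∪ (U ∩ C₁)) (A ∪ (U ∩ C₂))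
    have e1 : A ∪ U ∪ (A ∪ C₁) = A ∪ U ∪ C₁ := by ext x; simp; tauto
    have e2 : (A ∪ U) ∩ (A ∪ C₁) = A ∪ (U ∩ C₁) := by ext x; simp; tauto
    have e3 : A ∪ U ∪ C₁ ∪ (A ∪ C₂) = A ∪ (C₁ ∪ C₂) := by
      ext x; have := @hU x; simp at this ⊢; tauto
    have e4 : (A ∪ U ∪ C₁) ∩ (A ∪ C₂) = A ∪ (U ∩ C₂) := by
      ext x; have := hd' x; simp at this ⊢; tauto
    have e5 : A ∪ (U ∩ C₁) ∪ (A ∪ (U ∩ C₂)) = A ∪ U := by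
      ext x; have := @hU x; simp at this ⊢; tauto
    have e6 : (A ∪ (U ∩ C₁)) ∩ (A ∪ (U ∩ C₂)) = A := by
      ext x; have := hd' x; simp at this ⊢; tauto
    rw [e1, e2] at s1
    rw [e3, e4] at s2
    rw [e5, e6] at s3
    by_cases hU' : z (A ∪ U) = ⊤
    · rw [hU', top_add] at s3 ⊢
      exact (top_le_iff.1 s3).symm
    · have f1 := WithTop.add_ne_top.1 (ne_top_of_le_ne_top (WithTop.add_ne_top.2 ⟨hU', hC₁⟩) s1)
      have f2 := WithTop.add_ne_top.1 (ne_top_of_le_ne_top (WithTop.add_ne_top.2 ⟨f1.1, hC₂⟩) s2)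
      have f3 := f1.2
      have f4 := f2.2
      have f5 := f1.1
      generalize z (A ∪ U) = a at *
      generalize z (A ∪ C₁) = b at *
      generalize z (A ∪ C₂) = c at *
      generalize z (A ∪ U ∪ C₁) = d at *
      generalize z (A ∪ (U ∩ C₁)) = e at *
      generalize z (A ∪ (U ∩ C₂)) = f at *
      generalize z (A ∪ (C₁ ∪ C₂)) = g at *
      generalize z A = k at *
      lift a to ℝ using hU'
      lift b to ℝ using hC₁
      lift c to ℝ using hC₂
      lift d to ℝ using f5
      lift e to ℝ using f3
      lift f to ℝ using f4
      lift g to ℝ using hB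
      lift k to ℝ using hA
      norm_cast at *
      linarith

theorem IsDownSet.union {P : Preorder I} {A B : Set I} (hA : IsDownSet P A) (hB : IsDownSet P B) :
    IsDownSet P (A ∪ B) := fun _ _ h hy =>
  hy.elim (fun hy => Or.inl (hA h hy)) fun hy => Or.inr (hB h hy)

theorem IsDownSet.inter {P : Preorder I} {A B : Set I} (hA : IsDownSet P A) (hB : IsDownSet P B) :
    IsDownSet P (A ∩ B) := fun _ _ h hy => ⟨hA h hy.1, hB h hy.2⟩

theorem isDownSet_empty (P : Preorder I) : IsDownSet P ∅ := fun _ _ _ h => h.elim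

theorem isDownSet_univ (P : Preorder I) : IsDownSet P Set.univ := fun _ _ _ _ => Set.mem_univ _

theorem Refines.isDownSet {P Q : Preorder I} (h : Refines P Q) {A : Set I} (hA : IsDownSet Q A) :
    IsDownSet P A := fun _ _ hxy => hA (h hxy)

theorem isDownSet_Iic (P : Preorder I) (y : I) : IsDownSet P {x | P.le x y} :=
  fun _ _ h h' => P.le_trans _ _ _ h h'

/-- Principal down-sets suffice for the converse, so inclusions and equalities of preorders can be
tested on down-sets. -/
theorem refines_iff {P Q : Preorder I} :
    Refines P Q ↔ ∀ A, IsDownSet Q A → IsDownSet P A :=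
  ⟨fun h _ hA => h.isDownSet hA, fun h _ y hxy => h _ (isDownSet_Iic Q y) hxy (Q.le_refl y)⟩

theorem Refines.refl (P : Preorder I) : Refines P P := fun _ _ h => h

theorem Refines.trans {P Q R : Preorder I} (h : Refines P Q) (h' : Refines Q R) : Refines P R :=
  fun _ _ hxy => h' (h hxy)

theorem preorder_ext {P Q : Preorder I} (h : ∀ x y, P.le x y ↔ Q.le x y) : P = Q :=
  Preorder.toLE_injective (LE.ext (by funext x y; exact propext (h x y)))

theorem Refines.antisymm {P Q : Preorder I} (h : Refines P Q) (h' : Refines Q P) : P = Q :=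
  preorder_ext fun _ _ => ⟨fun a => h a, fun a => h' a⟩

theorem preorder_ext_isDownSet {P Q : Preorder I} (h : ∀ A, IsDownSet P A ↔ IsDownSet Q A) :
    P = Q :=
  (refines_iff.2 fun A hA => (h A).2 hA).antisymm (refines_iff.2 fun A hA => (h A).1 hA)

/-- A relation between `C₁` and `C₂` is exactly what could prevent one of them from being closed
downward once `A` is adjoined. This replaces comparability by membership in the lattice of
down-sets. -/
theorem separated_iff {P : Preorder I} {A B C₁ C₂ : Set I} (hA : IsDownSet P A)
    (hB : IsDownSet P B) (hd : Disjoint C₁ C₂) (hC : C₁ ∪ C₂ = B \ A) :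
    Separated P C₁ C₂ ↔ IsDownSet P (A ∪ C₁) ∧ IsDownSet P (A ∪ C₂) := by
  have hmem : ∀ x, (x ∈ C₁ ∨ x ∈ C₂) ↔ (x ∈ B ∧ x ∉ A) := fun x => by
    simpa using Set.ext_iff.1 hC x
  have hd' : ∀ x, x ∈ C₁ → x ∉ C₂ := fun x h1 h2 => Set.disjoint_left.1 hd h1 h2
  constructor
  · intro h
    refine ⟨fun x y hxy hy => ?_, fun x y hxy hy => ?_⟩
    · rcases hy with hy | hy
      · exact Or.inl (hA hxy hy)
      · have := hB hxy ((hmem y).1 (Or.inl hy)).1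
        by_cases hx : x ∈ A
        · exact Or.inl hx
        · rcases (hmem x).2 ⟨this, hx⟩ with h1 | h2
          · exact Or.inr h1
          · exact ((h y hy x h2).2 hxy).elim
    · rcases hy with hy | hy
      · exact Or.inl (hA hxy hy)
      · have := hB hxy ((hmem y).1 (Or.inr hy)).1
        by_cases hx : x ∈ A
        · exact Or.inl hx
        · rcases (hmem x).2 ⟨this, hx⟩ with h1 | h2
          · exact ((h x h1 y hy).1 hxy).elim
          · exact Or.inr h2
  · rintro ⟨h1, h2⟩ x hx y hy
    refine ⟨fun hxy => ?_, fun hyx => ?_⟩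
    · rcases h2 hxy (Or.inr hy) with h | h
      · exact ((hmem x).1 (Or.inl hx)).2 h
      · exact hd' x hx h
    · rcases h1 hyx (Or.inr hx) with h | h
      · exact ((hmem y).1 (Or.inr hy)).2 h
      · exact hd' y h hy

/-- Two down-sets `X`, `Y` give the separated pieces `X \ Y` and `Y \ X` above `X ∩ Y`, and every
separated decomposition arises from two down-sets in this way. By `splits_iff`, splitting is then
one modular equality. -/
theorem compatible_iff {z : SubmodFun I} {P : Preorder I} :
    Compatible z P ↔ (∀ A, IsDownSet P A → z A ≠ ⊤) ∧
      ∀ X Y, IsDownSet P X → IsDownSet P Y → z X + z Y = z (X ∩ Y) + z (X ∪ Y) := by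
  constructor
  · refine fun h => ⟨h.finite, fun X Y hX hY => ?_⟩
    have := isModular_cone h X Y
    simpa [cone, hX, hY, hX.inter hY, hX.union hY, h.finite] using this
  · rintro ⟨h1, h2⟩
    refine ⟨h1, fun A B hA hB hAB C₁ C₂ hd hC hs => ?_⟩
    have e : A ∪ (C₁ ∪ C₂) = B := by rw [hC, Set.union_sdiff_cancel hAB]
    rw [splits_iff (h1 _ hA) (by rw [e]; exact h1 _ hB) hd]
    obtain ⟨h3, h4⟩ := (separated_iff hA hB hd hC).1 hs
    rw [h2 _ _ h3 h4, ← Set.union_inter_distrib_left, hd.inter_eq, Set.union_empty,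
      ← Set.union_union_distrib_left]

/-- The same dictionary read backwards: a pair `X`, `Y` with modular equality is a splitting of the
interval from `X ∩ Y` to `X ∪ Y`, and conformity asks that it be visible in `P`. -/
theorem conforms_iff {z : SubmodFun I} {P : Preorder I} :
    Conforms z P ↔ Compatible z P ∧ ∀ X Y, IsDownSet P (X ∩ Y) → IsDownSet P (X ∪ Y) →
      z X + z Y = z (X ∩ Y) + z (X ∪ Y) → IsDownSet P X ∧ IsDownSet P Y := by
  constructor
  · refine fun h => ⟨h.toCompatible, fun X Y h1 h2 h3 => ?_⟩
    have e1 : X ∩ Y ∪ X \ Y = X := Set.inter_union_sdiff X Y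
    have e2 : X ∩ Y ∪ Y \ X = Y := by rw [Set.inter_comm]; exact Set.inter_union_sdiff Y X
    have hd : Disjoint (X \ Y) (Y \ X) := Set.disjoint_left.2 fun x hx hy => hx.2 hy.1
    have hC : X \ Y ∪ Y \ X = (X ∪ Y) \ (X ∩ Y) := by ext x; simp; tauto
    have e : X ∩ Y ∪ (X \ Y ∪ Y \ X) = X ∪ Y := by ext x; simp; tauto
    have := h.separated _ _ h1 h2 (fun x hx => Or.inl hx.1) (X \ Y) (Y \ X) hd hC
      ((splits_iff (h.finite _ h1) (by rw [e]; exact h.finite _ h2) hd).2 (by rw [e1, e2, e, h3]))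
    rwa [separated_iff h1 h2 hd hC, e1, e2] at this
  · rintro ⟨h1, h2⟩
    refine ⟨h1, fun A B hA hB hAB C₁ C₂ hd hC hs => ?_⟩
    have e : A ∪ (C₁ ∪ C₂) = B := by rw [hC, Set.union_sdiff_cancel hAB]
    rw [splits_iff (h1.finite _ hA) (by rw [e]; exact h1.finite _ hB) hd] at hs
    rw [separated_iff hA hB hd hC]
    have e1 : (A ∪ C₁) ∩ (A ∪ C₂) = A := by
      rw [← Set.union_inter_distrib_left, hd.inter_eq, Set.union_empty]
    have e2 : (A ∪ C₁) ∪ (A ∪ C₂) = A ∪ (C₁ ∪ C₂) := (Set.union_union_distrib_left ..).symm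
    exact h2 _ _ (by rwa [e1]) (by rw [e2, e]; exact hB) (by rw [e1, e2, hs])

theorem Compatible.modular {z : SubmodFun I} {P : Preorder I} (h : Compatible z P) {X Y : Set I}
    (hX : IsDownSet P X) (hY : IsDownSet P Y) : z X + z Y = z (X ∩ Y) + z (X ∪ Y) :=
  (compatible_iff.1 h).2 _ _ hX hY

theorem Compatible.refines {z : SubmodFun I} {P Q : Preorder I} (h : Compatible z P)
    (hPQ : Refines P Q) :
    Compatible z Q :=
  compatible_iff.2 ⟨fun _ hA => h.finite _ (hPQ.isDownSet hA),
    fun _ _ hX hY => h.modular (hPQ.isDownSet hX) (hPQ.isDownSet hY)⟩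

theorem Conforms.closed {z : SubmodFun I} {P : Preorder I} (h : Conforms z P) {X Y : Set I}
    (h1 : IsDownSet P (X ∩ Y)) (h2 : IsDownSet P (X ∪ Y))
    (h3 : z X + z Y = z (X ∩ Y) + z (X ∪ Y)) : IsDownSet P X ∧ IsDownSet P Y :=
  (conforms_iff.1 h).2 _ _ h1 h2 h3

/-- The preorder of a family of sets. -/
abbrev ofFamily (D : Set (Set I)) : Preorder I where
  le x y := ∀ A ∈ D, y ∈ A → x ∈ A
  le_refl _ _ _ h := h
  le_trans _ _ _ h1 h2 A hA h := h1 A hA (h2 A hA h)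

/-- Birkhoff's correspondence: a down-set is the union, over its points `y`, of the least member of
`D` containing `y`, and finiteness turns binary closure into closure under these intersections and
unions. -/
theorem isDownSet_ofFamily [Finite I] {D : Set (Set I)} (h0 : ∅ ∈ D) (h1 : Set.univ ∈ D)
    (hu : ∀ A ∈ D, ∀ B ∈ D, A ∪ B ∈ D) (hi : ∀ A ∈ D, ∀ B ∈ D, A ∩ B ∈ D) (A : Set I) :
    IsDownSet (ofFamily D) A ↔ A ∈ D := by
  constructor
  · intro hA
    have hsi : ∀ s : Set (Set I), s ⊆ D → ⋂₀ s ∈ D := fun s hs => by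
      induction s, s.toFinite using Set.Finite.induction_on with
      | empty => simpa using h1
      | @insert a s _ _ ih =>
        rw [Set.sInter_insert]
        exact hi _ (hs (Set.mem_insert _ _)) _ (ih fun x hx => hs (Set.mem_insert_of_mem _ hx))
    have hsu : ∀ s : Set (Set I), s ⊆ D → ⋃₀ s ∈ D := fun s hs => by
      induction s, s.toFinite using Set.Finite.induction_on with
      | empty => simpa using h0
      | @insert a s _ _ ih =>
        rw [Set.sUnion_insert]
        exact hu _ (hs (Set.mem_insert _ _)) _ (ih fun x hx => hs (Set.mem_insert_of_mem _ hx))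
    have e : A = ⋃₀ ((fun y => ⋂₀ {B | B ∈ D ∧ y ∈ B}) '' A) := by
      ext x
      simp only [Set.sUnion_image, Set.mem_iUnion, Set.mem_sInter, Set.mem_ofPred_eq, exists_prop]
      exact ⟨fun hx => ⟨x, hx, fun B hB => hB.2⟩,
        fun ⟨y, hy, h⟩ => hA (fun B hB hyB => h B ⟨hB, hyB⟩) hy⟩
    rw [e]
    refine hsu _ ?_
    rintro _ ⟨y, _, rfl⟩
    exact hsi _ fun B hB => hB.1
  · intro hA x y hxy hy
    exact hxy A hA hy

end Downsets

/-! ### The face `z_P`, computed one bubble at a time. -/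

section Faces

variable {I : Type u}

theorem bubble_le {P : Preorder I} {C : Set I} (hC : C ∈ bubbles P) {x y : I} (hx : x ∈ C)
    (hy : y ∈ C) : P.le x y := by
  obtain ⟨c, rfl⟩ := hC
  exact P.le_trans _ _ _ hx.2 hy.1

theorem mem_bubble {P : Preorder I} {C : Set I} (hC : C ∈ bubbles P) {x y : I} (hx : x ∈ C)
    (hxy : P.le x y) (hyx : P.le y x) : y ∈ C := by
  obtain ⟨c, rfl⟩ := hC
  exact ⟨P.le_trans _ _ _ hx.1 hxy, P.le_trans _ _ _ hyx hx.2⟩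

theorem bubble_nonempty {P : Preorder I} {C : Set I} (hC : C ∈ bubbles P) : C.Nonempty := by
  obtain ⟨c, rfl⟩ := hC
  exact ⟨c, P.le_refl c, P.le_refl c⟩

theorem exists_bubble (P : Preorder I) (x : I) : ∃ C ∈ bubbles P, x ∈ C :=
  ⟨_, ⟨x, rfl⟩, P.le_refl x, P.le_refl x⟩

/-- Unions of bubbles. -/
def IsSaturated (P : Preorder I) (A : Set I) : Prop :=
  ∀ ⦃x y⦄, P.le x y → P.le y x → x ∈ A → y ∈ A

theorem IsDownSet.isSaturated {P : Preorder I} {A : Set I} (hA : IsDownSet P A) :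
    IsSaturated P A := fun _ _ _ hyx hx => hA hyx hx

theorem isSaturated_bubble {P : Preorder I} {C : Set I} (hC : C ∈ bubbles P) : IsSaturated P C :=
  fun _ _ hxy hyx hx => mem_bubble hC hx hxy hyx

theorem IsSaturated.subset_or_disjoint {P : Preorder I} {A C : Set I} (hA : IsSaturated P A)
    (hC : C ∈ bubbles P) : C ⊆ A ∨ Disjoint C A := by
  by_cases h : ∃ x ∈ C, x ∈ A
  · obtain ⟨x, hx, hxA⟩ := h
    exact Or.inl fun y hy => hA (bubble_le hC hx hy) (bubble_le hC hy hx) hxA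
  · push Not at h
    exact Or.inr (Set.disjoint_left.2 h)

theorem bubble_eq_or_disjoint {P : Preorder I} {C C' : Set I} (hC : C ∈ bubbles P)
    (hC' : C' ∈ bubbles P) : C = C' ∨ Disjoint C C' := by
  rcases (isSaturated_bubble hC').subset_or_disjoint hC with h | h
  · rcases (isSaturated_bubble hC).subset_or_disjoint hC' with h' | h'
    · exact Or.inl (h.antisymm h')
    · exact Or.inr h'.symm
  · exact Or.inr h

/-- Down-sets are built by adding one bubble at a time. -/
theorem IsDownSet.induction [Finite I] {P : Preorder I} {p : Set I → Prop} (h0 : p ∅)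
    (hs : ∀ A C, IsDownSet P A → C ∈ bubbles P → Disjoint A C → IsDownSet P (A ∪ C) → p A →
      p (A ∪ C)) (B : Set I) (hB : IsDownSet P B) : p B := by
  induction hn : B.ncard using Nat.strong_induction_on generalizing B with
  | _ n ih =>
    rcases B.eq_empty_or_nonempty with rfl | hne
    · exact h0
    -- The bubble of a maximal element of `B` can be removed, since nothing else in `B` lies above
    -- it.
    · obtain ⟨x, hx, hmax⟩ := B.toFinite.exists_maximal hne
      set C : Set I := {y | P.le x y ∧ P.le y x} with hCdef
      have hC : C ∈ bubbles P := ⟨x, rfl⟩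
      have hCB : C ⊆ B := fun y hy => hB hy.2 hx
      have hA : IsDownSet P (B \ C) := fun w y hwy hy =>
        ⟨hB hwy hy.1, fun hw => hy.2
          ⟨P.le_trans _ _ _ hw.1 hwy, hmax hy.1 (P.le_trans _ _ _ hw.1 hwy)⟩⟩
      have e : B \ C ∪ C = B := Set.sdiff_union_of_subset hCB
      have := hs (B \ C) C hA hC Set.disjoint_sdiff_left (by rwa [e]) (ih _ (by
        rw [← hn]
        exact Set.ncard_lt_ncard ⟨Set.sdiff_subset, fun h =>
          (h hx).2 ⟨P.le_refl x, P.le_refl x⟩⟩ B.toFinite) _ hA rfl)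
      rwa [e] at this

theorem below_subset {P : Preorder I} {A C : Set I} (h : IsDownSet P (A ∪ C)) :
    below P C ⊆ A := by
  rintro y ⟨⟨x, hx, hyx⟩, hy⟩
  exact (h hyx (Or.inr hx)).resolve_right hy

theorem disjoint_below (P : Preorder I) (C : Set I) : Disjoint (below P C) C :=
  Set.disjoint_sdiff_left

theorem minor_empty {z : SubmodFun I} {A : Set I} (hA : z A ≠ ⊤) : minor z A ∅ = 0 := by
  rw [minor_eq_iff hA]; simp

/-- `A \ below P C` and `C` are separated above `below P C`, so the minor splits there. Hence `z_C`
can be computed over any down-set `A` to which `C` can be adjoined, which makes inductions along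
down-sets possible. -/
theorem minor_below {z : SubmodFun I} {P : Preorder I} (h : Compatible z P) {A C U : Set I}
    (hA : IsDownSet P A) (hC : C ∈ bubbles P) (hd : Disjoint A C) (hAC : IsDownSet P (A ∪ C))
    (hU : U ⊆ C) : minor z (below P C) U + z A = z (A ∪ U) := by
  have hb := isDownSet_below P hC
  have hbA := below_subset hAC
  have e : below P C ∪ A \ below P C = A := Set.union_sdiff_cancel hbA
  have hd' : Disjoint (A \ below P C) C := hd.mono_left Set.sdiff_subset
  have hCC : A \ below P C ∪ C = (A ∪ C) \ below P C := by
    have := disjoint_below P C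
    rw [Set.union_sdiff_distrib, this.symm.sdiff_eq_left]
  have hsep := (separated_iff hb hAC hd' hCC).2 ⟨by rwa [e], isDownSet_below_union P C⟩
  have hs := h.splits _ _ hb hAC (hbA.trans Set.subset_union_left) _ _ hd' hCC hsep
    (A \ below P C ∪ U) (Set.union_subset_union_right _ hU)
  have e1 : (A \ below P C ∪ U) ∩ (A \ below P C) = A \ below P C := by simp
  have e2 : (A \ below P C ∪ U) ∩ C = U := by
    rw [Set.union_inter_distrib_right, hd'.inter_eq, Set.empty_union, Set.inter_eq_left.2 hU]
  have fb := h.finite _ hb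
  rw [e1, e2, minor_eq_iff fb, ← Set.union_assoc, e] at hs
  rw [hs, add_right_comm, minor_add fb, e, add_comm]


variable [Finite I] {z : SubmodFun I} {P : Preorder I}

/-- Every bubble is either inside `A` or disjoint from it, so each summand goes to one side. -/
theorem face_inter_add_sdiff (h : Compatible z P) {A : Set I} (hA : IsSaturated P A) (E : Set I) :
    face z P h E = face z P h (E ∩ A) + face z P h (E \ A) := by
  simp only [face]
  rw [← Finset.sum_add_distrib]
  refine Finset.sum_congr rfl fun C _ => ?_
  have h0 := minor_empty (h.finite _ (isDownSet_below P C.2))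
  rcases hA.subset_or_disjoint C.2 with h' | h'
  · have e1 : E ∩ A ∩ C = E ∩ C := by rw [Set.inter_assoc, Set.inter_eq_right.2 h']
    have e2 : (E \ A) ∩ C = ∅ := by
      ext x; have := @h' x; simp; tauto
    rw [e1, e2, h0, add_zero]
  · have h'' : ∀ x, x ∈ C.1 → x ∉ A := fun x h1 h2 => Set.disjoint_left.1 h' h1 h2
    have e1 : E ∩ A ∩ C = ∅ := by
      ext x; have := h'' x; simp; tauto
    have e2 : (E \ A) ∩ C = E ∩ C := by
      ext x; have := h'' x; simp; tauto
    rw [e1, e2, h0, zero_add]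

theorem face_bubble (h : Compatible z P) {C U : Set I} (hC : C ∈ bubbles P) (hU : U ⊆ C) :
    face z P h U = minor z (below P C) U := by
  simp only [face]
  rw [Finset.sum_eq_single (⟨C, hC⟩ : bubbles P)]
  · rw [Set.inter_eq_left.2 hU]
  · intro D _ hD
    have : U ∩ D = ∅ := by
      rcases bubble_eq_or_disjoint D.2 hC with h' | h'
      · exact (hD (Subtype.ext h')).elim
      · exact (h'.symm.mono_left hU).inter_eq
    rw [this, minor_empty (h.finite _ (isDownSet_below P D.2))]
  · simp

theorem face_add (h : Compatible z P) {A C U : Set I} (hA : IsDownSet P A) (hC : C ∈ bubbles P)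
    (hd : Disjoint A C) (hAC : IsDownSet P (A ∪ C)) (hU : U ⊆ C) :
    face z P h U + z A = z (A ∪ U) := by
  rw [face_bubble h hC hU, minor_below h hA hC hd hAC hU]

theorem face_inter_union (h : Compatible z P) {A C : Set I} (hA : IsSaturated P A)
    (hd : Disjoint A C) (E : Set I) :
    face z P h (E ∩ (A ∪ C)) = face z P h (E ∩ A) + face z P h (E ∩ C) := by
  have hd' : ∀ x, x ∈ A → x ∉ C := fun x h1 h2 => Set.disjoint_left.1 hd h1 h2
  rw [face_inter_add_sdiff h hA]
  congr 2
  · ext x; simp; tauto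
  · ext x; have := hd' x; simp; tauto

theorem face_isDownSet (h : Compatible z P) {A : Set I} (hA : IsDownSet P A) :
    face z P h A = z A := by
  refine IsDownSet.induction (p := fun A => face z P h A = z A) ?_ ?_ A hA
  · rw [SubmodFun.empty', SubmodFun.empty']
  · intro A C hA hC hd hAC ih
    have := face_inter_union h hA.isSaturated hd Set.univ
    rw [Set.univ_inter, Set.univ_inter, Set.univ_inter, ih, add_comm,
      face_add h hA hC hd hAC subset_rfl] at this
    exact this

/-- The increments along a chain of down-sets determine the function. Later identifications of faces
check these increments and never reindex sums over bubbles. -/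
theorem face_unique (h : Compatible z P) (y : SubmodFun I)
    (hy : ∀ E A C, IsDownSet P A → C ∈ bubbles P → Disjoint A C → IsDownSet P (A ∪ C) →
      y (E ∩ (A ∪ C)) + z A = y (E ∩ A) + z (A ∪ (E ∩ C))) : y = face z P h := by
  apply SubmodFun.ext
  funext E
  have := IsDownSet.induction (p := fun A => y (E ∩ A) = face z P h (E ∩ A)) ?_ ?_ _
    (isDownSet_univ P)
  · simpa using this
  · rw [Set.inter_empty, SubmodFun.empty', SubmodFun.empty']
  · intro A C hA hC hd hAC ih
    refine withTop_add_right_cancel (h.finite _ hA) ?_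
    rw [hy E A C hA hC hd hAC, ih, face_inter_union h hA.isSaturated hd, add_assoc,
      face_add h hA hC hd hAC Set.inter_subset_right]

/-- The inductive step is submodularity of `z` for `E ∩ (A ∪ C)` and `A`. -/
theorem face_le (h : Compatible z P) (E : Set I) : face z P h E ≤ z E := by
  have := IsDownSet.induction (p := fun A => face z P h (E ∩ A) ≤ z (E ∩ A)) ?_ ?_ _
    (isDownSet_univ P)
  · simpa using this
  · rw [Set.inter_empty, SubmodFun.empty', SubmodFun.empty']
  · intro A C hA hC hd hAC ih
    refine withTop_le_of_add_le_add_left (h.finite _ hA) ?_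
    rw [face_inter_union h hA.isSaturated hd, add_left_comm, add_comm (z A),
      face_add h hA hC hd hAC Set.inter_subset_right]
    have hs := z.submodular' (E ∩ (A ∪ C)) A
    have e1 : E ∩ (A ∪ C) ∪ A = A ∪ E ∩ C := by ext x; simp; tauto
    have e2 : E ∩ (A ∪ C) ∩ A = E ∩ A := by ext x; simp; tauto
    rw [e1, e2, add_comm, add_comm _ (z A)] at hs
    exact (add_le_add_left ih _).trans hs

/-- `z_Q` agrees with `z` on the down-sets of all finer compatible preorders. -/
theorem face_isDownSet_of_refines {Q : Preorder I} (hP : Compatible z P) (hPQ : Refines P Q)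
    (hQ : Compatible z Q) {E : Set I} (hE : IsDownSet P E) : face z Q hQ E = z E := by
  have := IsDownSet.induction (P := Q) (p := fun A => face z Q hQ (E ∩ A) = z (E ∩ A)) ?_ ?_ _
    (isDownSet_univ Q)
  · simpa using this
  · rw [Set.inter_empty, SubmodFun.empty', SubmodFun.empty']
  · intro A C hA hC hd hAC ih
    -- The two sets used for `face_le` are now down-sets of `P`, so the submodular inequality is an
    -- equality.
    refine withTop_add_right_cancel (hQ.finite _ hA) ?_
    rw [face_inter_union hQ hA.isSaturated hd, add_assoc,
      face_add hQ hA hC hd hAC Set.inter_subset_right, ih,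
      hP.modular (hE.inter (hPQ.isDownSet hAC)) (hPQ.isDownSet hA)]
    have e1 : E ∩ (A ∪ C) ∪ A = A ∪ E ∩ C := by ext x; simp; tauto
    have e2 : E ∩ (A ∪ C) ∩ A = E ∩ A := by ext x; simp; tauto
    rw [e1, e2]

end Faces

/-! ### Preorders conforming to a face or to a cone of `z`. -/

section Restriction

variable {I : Type u}

/-- The preorder with a given relation. -/
abbrev preorderOfRel (r : I → I → Prop) (h : ∀ x, r x x) (h' : ∀ x y z, r x y → r y z → r x z) :
    Preorder I where
  le := r
  le_refl := h
  le_trans := h'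

/-- The intersection of `P` with the equivalence relation of `Q`. -/
abbrev rest (P Q : Preorder I) : Preorder I :=
  preorderOfRel (fun x y => P.le x y ∧ Q.le x y ∧ Q.le y x)
    (fun x => ⟨P.le_refl x, Q.le_refl x, Q.le_refl x⟩)
    fun _ _ _ h1 h2 => ⟨P.le_trans _ _ _ h1.1 h2.1, Q.le_trans _ _ _ h1.2.1 h2.2.1,
      Q.le_trans _ _ _ h2.2.2 h1.2.2⟩

theorem rest_refines (P Q : Preorder I) : Refines (rest P Q) P := fun _ _ h => h.1

theorem rest_mono {P P' : Preorder I} (Q : Preorder I) (h : Refines P P') :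
    Refines (rest P Q) (rest P' Q) := fun _ _ h' => ⟨h h'.1, h'.2⟩

/-- A relation of `P` leaving a bubble `C` of `Q` downward ends in `below Q C`, so adjoining that
set forgets everything except the relations inside `C`. -/
theorem isDownSet_rest {P Q : Preorder I} (h : Refines P Q) {X : Set I} :
    IsDownSet (rest P Q) X ↔ ∀ C ∈ bubbles Q, IsDownSet P (below Q C ∪ X ∩ C) := by
  constructor
  · rintro hX C hC x y hxy (hy | hy)
    · exact Or.inl (isDownSet_below Q hC (h hxy) hy)
    · by_cases hx : x ∈ C
      · exact Or.inr ⟨hX ⟨hxy, h hxy, bubble_le hC hy.2 hx⟩ hy.1, hx⟩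
      · exact Or.inl ⟨⟨y, hy.2, h hxy⟩, hx⟩
  · rintro hX x y ⟨hxy, h1, h2⟩ hy
    obtain ⟨C, hC, hyC⟩ := exists_bubble Q y
    rcases hX C hC hxy (Or.inr ⟨hy, hyC⟩) with h' | h'
    · exact (h'.2 (mem_bubble hC hyC h2 h1)).elim
    · exact h'.1

theorem minor_modular_iff {z : SubmodFun I} {A : Set I} (hA : z A ≠ ⊤) (X Y : Set I) :
    minor z A X + minor z A Y = minor z A (X ∩ Y) + minor z A (X ∪ Y) ↔
      z (A ∪ X) + z (A ∪ Y) = z ((A ∪ X) ∩ (A ∪ Y)) + z ((A ∪ X) ∪ (A ∪ Y)) := by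
  rw [← Set.union_inter_distrib_left, ← Set.union_union_distrib_left]
  simp only [← minor_add hA]
  rw [add_add_add_comm, add_add_add_comm (minor z A (X ∩ Y))]
  exact ⟨fun h => by rw [h], fun h => withTop_add_right_cancel (WithTop.add_ne_top.2 ⟨hA, hA⟩) h⟩

theorem eq_of_sum_eq_sum {ι : Type*} {s : Finset ι} {f g : ι → WithTop ℝ}
    (hfg : ∀ i ∈ s, f i ≤ g i) (h : ∑ i ∈ s, f i = ∑ i ∈ s, g i) (hf : ∑ i ∈ s, f i ≠ ⊤) :
    ∀ i ∈ s, f i = g i := by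
  classical
  intro i hi
  refine (hfg i hi).antisymm ?_
  rw [← Finset.add_sum_erase _ _ hi] at h hf
  rw [← Finset.add_sum_erase _ _ hi] at h
  refine withTop_le_of_add_le_add_left (WithTop.add_ne_top.1 hf).2 ?_
  rw [add_comm _ (f i), h, add_comm (g i)]
  exact add_le_add_left (Finset.sum_le_sum fun j hj => hfg j (Finset.mem_of_mem_erase hj)) _

/-- The preorder whose down-sets are the down-sets of `R` on which `z` and `y` agree. -/
abbrev liftPre (z y : SubmodFun I) (R : Preorder I) : Preorder I :=
  ofFamily {A | IsDownSet R A ∧ z A = y A}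

theorem liftPre_mono {z y : SubmodFun I} {R R' : Preorder I} (h : Refines R R') :
    Refines (liftPre z y R) (liftPre z y R') :=
  fun _ _ hxy A hA => hxy A ⟨h.isDownSet hA.1, hA.2⟩

theorem bubbles_rest {P Q : Preorder I} (hPQ : Refines P Q) : bubbles (rest P Q) = bubbles P := by
  have : ∀ x, {y | (rest P Q).le x y ∧ (rest P Q).le y x} = {y | P.le x y ∧ P.le y x} :=
    fun x => Set.ext fun y => ⟨fun h => ⟨h.1.1, h.2.1⟩, fun h =>
      ⟨⟨h.1, hPQ h.1, hPQ h.2⟩, ⟨h.2, hPQ h.2, hPQ h.1⟩⟩⟩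
  simp only [bubbles, this]

theorem cone_of_isDownSet {z : SubmodFun I} {P : Preorder I} {A : Set I} (hA : IsDownSet P A) :
    cone z P A = z A := by
  simp [cone, hA]

theorem cone_of_not_isDownSet {z : SubmodFun I} {P : Preorder I} {A : Set I}
    (hA : ¬ IsDownSet P A) : cone z P A = ⊤ := by
  simp [cone, hA]

theorem compatible_cone {z : SubmodFun I} {P Q : Preorder I} (hPQ : Refines P Q)
    (hQ : Compatible z Q) : Compatible (cone z P) Q := by
  refine compatible_iff.2 ⟨fun A hA => ?_, fun X Y hX hY => ?_⟩
  · rw [cone_of_isDownSet (hPQ.isDownSet hA)]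
    exact hQ.finite _ hA
  · rw [cone_of_isDownSet (hPQ.isDownSet hX), cone_of_isDownSet (hPQ.isDownSet hY),
      cone_of_isDownSet (hPQ.isDownSet (hX.inter hY)),
      cone_of_isDownSet (hPQ.isDownSet (hX.union hY)), hQ.modular hX hY]

theorem cone_cone {z : SubmodFun I} {P Q : Preorder I} (hPQ : Refines P Q) :
    cone (cone z P) Q = cone z Q := by
  apply SubmodFun.ext
  funext X
  by_cases hX : IsDownSet Q X
  · rw [cone_of_isDownSet hX, cone_of_isDownSet hX, cone_of_isDownSet (hPQ.isDownSet hX)]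
  · rw [cone_of_not_isDownSet hX, cone_of_not_isDownSet hX]

/-- Finiteness of `z^P` forces down-sets of `Q` to be down-sets of `P`. Sets `X`, `Y` with a modular
equality between down-sets of `Q` are down-sets of `P`, by conformity of `P` or by finiteness of
`z^P`, and on those `z` and `z^P` agree. -/
theorem conforms_cone_iff {z : SubmodFun I} {P Q : Preorder I} (hP : Conforms z P) :
    Conforms (cone z P) Q ↔ Refines P Q ∧ Conforms z Q := by
  constructor
  · intro h
    have hPQ : Refines P Q := refines_iff.2 fun A hA => by
      by_contra hn
      exact h.finite _ hA (cone_of_not_isDownSet hn)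
    have hQ := hP.toCompatible.refines hPQ
    refine ⟨hPQ, conforms_iff.2 ⟨hQ, fun X Y h1 h2 h3 => ?_⟩⟩
    obtain ⟨dX, dY⟩ := hP.closed (hPQ.isDownSet h1) (hPQ.isDownSet h2) h3
    refine h.closed h1 h2 ?_
    rw [cone_of_isDownSet dX, cone_of_isDownSet dY, cone_of_isDownSet (hPQ.isDownSet h1),
      cone_of_isDownSet (hPQ.isDownSet h2), h3]
  · rintro ⟨hPQ, hQ⟩
    refine conforms_iff.2 ⟨compatible_cone hPQ hQ.toCompatible, fun X Y h1 h2 h3 => ?_⟩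
    rw [cone_of_isDownSet (hPQ.isDownSet h1), cone_of_isDownSet (hPQ.isDownSet h2)] at h3
    have hf : ∀ X, cone z P X ≠ ⊤ → IsDownSet P X := fun X h => by
      by_contra hn
      exact h (cone_of_not_isDownSet hn)
    have hne := WithTop.add_ne_top.2 ⟨hQ.finite _ h1, hQ.finite _ h2⟩
    rw [← h3, WithTop.add_ne_top] at hne
    have dX := hf _ hne.1
    have dY := hf _ hne.2
    rw [cone_of_isDownSet dX, cone_of_isDownSet dY] at h3
    exact hQ.closed h1 h2 h3

variable [Finite I] {z : SubmodFun I} {P Q : Preorder I}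

/-- `z_Q` is a sum of submodular functions, one for each bubble. A modular equality of finite sums
forces equality in each bubble `C`, where it is an equality for `z` between sets containing `below Q
C`, and conformity of `P` applies. -/
theorem conforms_rest (hP : Conforms z P) (hPQ : Refines P Q) (hQ : Compatible z Q) :
    Conforms (face z Q hQ) (rest P Q) := by
  have fb : ∀ C : bubbles Q, z (below Q C) ≠ ⊤ := fun C =>
    hQ.finite _ (isDownSet_below Q C.2)
  have hfin : ∀ A, IsDownSet (rest P Q) A → face z Q hQ A ≠ ⊤ := fun A hA =>
    WithTop.sum_ne_top.2 fun C _ => SubmodFun.sub_ne_top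
      (hP.finite _ ((isDownSet_rest hPQ).1 hA C C.2)) (fb C)
  rw [conforms_iff, compatible_iff]
  refine ⟨⟨hfin, fun X Y hX hY => ?_⟩, fun X Y h1 h2 h3 => ?_⟩
  · simp only [face]
    rw [← Finset.sum_add_distrib, ← Finset.sum_add_distrib]
    refine Finset.sum_congr rfl fun C _ => ?_
    rw [Set.inter_inter_distrib_right, Set.union_inter_distrib_right, minor_modular_iff (fb C)]
    exact hP.modular ((isDownSet_rest hPQ).1 hX C C.2) ((isDownSet_rest hPQ).1 hY C C.2)
  · have hne := WithTop.add_ne_top.2 ⟨hfin _ h1, hfin _ h2⟩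
    simp only [face] at h3 hne
    rw [← Finset.sum_add_distrib, ← Finset.sum_add_distrib] at h3
    rw [← Finset.sum_add_distrib] at hne
    have key := eq_of_sum_eq_sum (fun C _ => ?_) h3.symm hne
    · have : ∀ C ∈ bubbles Q, IsDownSet P (below Q C ∪ X ∩ C) ∧
          IsDownSet P (below Q C ∪ Y ∩ C) := fun C hC => by
        have k := (key ⟨C, hC⟩ (Finset.mem_univ _)).symm
        rw [Set.inter_inter_distrib_right, Set.union_inter_distrib_right,
          minor_modular_iff (fb _)] at k
        refine hP.closed ?_ ?_ k
        · rw [← Set.union_inter_distrib_left, ← Set.inter_inter_distrib_right]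
          exact (isDownSet_rest hPQ).1 h1 C hC
        · rw [← Set.union_union_distrib_left, ← Set.union_inter_distrib_right]
          exact (isDownSet_rest hPQ).1 h2 C hC
      exact ⟨(isDownSet_rest hPQ).2 fun C hC => (this C hC).1,
        (isDownSet_rest hPQ).2 fun C hC => (this C hC).2⟩
    · rw [Set.inter_inter_distrib_right, Set.union_inter_distrib_right, add_comm]
      exact z.submodular_minor _ _ _

/-- On the down-sets of `R` the function `y` is modular, so `z - y` is nonnegative and submodular
there; its zeros are closed under unions and intersections. -/
theorem isDownSet_liftPre {y : SubmodFun I} (hle : ∀ A, y A ≤ z A) (hu : z Set.univ = y Set.univ)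
    {R : Preorder I} (hR : Compatible y R) (A : Set I) :
    IsDownSet (liftPre z y R) A ↔ IsDownSet R A ∧ z A = y A := by
  have key : ∀ A ∈ {A | IsDownSet R A ∧ z A = y A}, ∀ B ∈ {A | IsDownSet R A ∧ z A = y A},
      z (A ∪ B) = y (A ∪ B) ∧ z (A ∩ B) = y (A ∩ B) := by
    rintro A ⟨hA, hA'⟩ B ⟨hB, hB'⟩
    have h1 := z.submodular' A B
    rw [hA', hB', hR.modular hA hB, add_comm] at h1
    have f1 := hR.finite _ (hA.inter hB)
    have f2 := hR.finite _ (hA.union hB)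
    refine ⟨(withTop_le_of_add_le_add_left f1 (le_trans ?_ h1)).antisymm (hle _),
      (withTop_le_of_add_le_add_left f2 (le_trans ?_
        (h1.trans (add_comm _ _).le))).antisymm (hle _)⟩
    · exact add_le_add_left (hle _) _
    · rw [add_comm]; exact add_le_add_right (hle _) _
  exact isDownSet_ofFamily (D := {A | IsDownSet R A ∧ z A = y A})
    ⟨isDownSet_empty R, by rw [z.empty', y.empty']⟩ ⟨isDownSet_univ R, hu⟩
    (fun A hA B hB => ⟨hA.1.union hB.1, (key A hA B hB).1⟩)
    (fun A hA B hB => ⟨hA.1.inter hB.1, (key A hA B hB).2⟩) A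

/-- If `z` satisfies a modular equality whose right side agrees with that of `y`, then `y X + y Y`
lies between the two sides by `y ≤ z` and submodularity. So `y` satisfies the same equality,
conformity of `R` gives the down-sets, and `z` and `y` agree on each of them. -/
theorem conforms_liftPre {y : SubmodFun I} (hle : ∀ A, y A ≤ z A) (hu : z Set.univ = y Set.univ)
    {R : Preorder I} (hR : Conforms y R) : Conforms z (liftPre z y R) := by
  have hds := isDownSet_liftPre hle hu hR.toCompatible
  rw [conforms_iff, compatible_iff]
  refine ⟨⟨fun A hA => ?_, fun X Y hX hY => ?_⟩, fun X Y h1 h2 h3 => ?_⟩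
  · rw [hds] at hA
    rw [hA.2]
    exact hR.finite _ hA.1
  · have h1 := ((hds _).1 (hX.inter hY)).2
    have h2 := ((hds _).1 (hX.union hY)).2
    rw [hds] at hX hY
    rw [hX.2, hY.2, h1, h2, hR.modular hX.1 hY.1]
  · rw [hds] at h1 h2
    have h4 := y.submodular' X Y
    have h5 := add_le_add (hle X) (hle Y)
    rw [h3, h1.2, h2.2] at h5
    have h6 : y X + y Y = y (X ∩ Y) + y (X ∪ Y) := h5.antisymm (by rwa [add_comm] at h4)
    have h7 : y X + y Y = z X + z Y := by rw [h6, h3, h1.2, h2.2]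
    have h8 := WithTop.add_ne_top.2 ⟨hR.finite _ h1.1, hR.finite _ h2.1⟩
    rw [← h6] at h8
    obtain ⟨fX, fY⟩ := WithTop.add_ne_top.1 h8
    obtain ⟨dX, dY⟩ := hR.closed h1.1 h2.1 h6
    rw [hds, hds]
    refine ⟨⟨dX, (hle _).antisymm' ?_⟩, ⟨dY, (hle _).antisymm' ?_⟩⟩
    · refine withTop_le_of_add_le_add_left fY ?_
      rw [add_comm, add_comm (y Y), h7]
      exact add_le_add_right (hle Y) _
    · refine withTop_le_of_add_le_add_left fX ?_
      rw [h7]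
      exact add_le_add_left (hle X) _

/-- `z_Q` splits along every union of bubbles of `Q`, and conformity detects the splitting into `A`
and its complement. -/
theorem IsSaturated.isDownSet_of_conforms_face {hQ : Compatible z Q} {R : Preorder I}
    (hR : Conforms (face z Q hQ) R) {A : Set I} (hA : IsSaturated Q A) : IsDownSet R A := by
  refine (hR.closed (X := A) (Y := Aᶜ) ?_ ?_ ?_).1
  · rw [Set.inter_compl_self]; exact isDownSet_empty R
  · rw [Set.union_compl_self]; exact isDownSet_univ R
  · have := face_inter_add_sdiff hQ hA Set.univ
    rw [Set.univ_inter, ← Set.compl_eq_univ_sdiff] at this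
    rw [← this, Set.inter_compl_self, Set.union_compl_self, SubmodFun.empty', zero_add]

theorem isDownSet_liftPre_face {hQ : Compatible z Q} {R : Preorder I}
    (hR : Conforms (face z Q hQ) R) (A : Set I) :
    IsDownSet (liftPre z (face z Q hQ) R) A ↔ IsDownSet R A ∧ z A = face z Q hQ A :=
  isDownSet_liftPre (face_le hQ) (face_isDownSet hQ (isDownSet_univ Q)).symm hR.toCompatible A

theorem conforms_liftPre_face {hQ : Compatible z Q} {R : Preorder I}
    (hR : Conforms (face z Q hQ) R) : Conforms z (liftPre z (face z Q hQ) R) :=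
  conforms_liftPre (face_le hQ) (face_isDownSet hQ (isDownSet_univ Q)).symm hR

theorem liftPre_refines {hQ : Compatible z Q} {R : Preorder I}
    (hR : Conforms (face z Q hQ) R) : Refines (liftPre z (face z Q hQ) R) Q :=
  refines_iff.2 fun _ hA => (isDownSet_liftPre_face hR _).2
    ⟨hA.isSaturated.isDownSet_of_conforms_face hR, (face_isDownSet hQ hA).symm⟩

/-- The inverse must recover the relations of `P` between different bubbles of `Q`. They are encoded
by where `z` and `z_Q` agree. -/
theorem liftPre_rest (hP : Conforms z P) (hPQ : Refines P Q) (hQ : Compatible z Q) :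
    liftPre z (face z Q hQ) (rest P Q) = P := by
  refine preorder_ext_isDownSet fun A => ?_
  rw [isDownSet_liftPre_face (conforms_rest hP hPQ hQ)]
  constructor
  · rintro ⟨hA, hzA⟩
    have hfA : face z Q hQ A ≠ ⊤ := (conforms_rest hP hPQ hQ).finite _ hA
    -- Agreement on `A` passes to `A ∩ B`: `z_Q` is modular for the pair `A`, `B`, whereas `z` is
    -- submodular and at least `z_Q`.
    have hB : ∀ B, IsDownSet Q B → z (A ∩ B) = face z Q hQ (A ∩ B) := fun B hB => by
      have h1 := z.submodular' A B
      have h2 := face_inter_add_sdiff hQ hB.isSaturated (A ∪ B)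
      have h3 := face_inter_add_sdiff hQ hB.isSaturated A
      have e1 : (A ∪ B) ∩ B = B := by simp
      have e2 : (A ∪ B) \ B = A \ B := by simp
      rw [e1, e2] at h2
      have h4 : face z Q hQ (A ∪ B) + face z Q hQ (A ∩ B) = face z Q hQ A + face z Q hQ B := by
        rw [h2, h3]; ac_rfl
      rw [hzA, ← face_isDownSet hQ hB, ← h4] at h1
      have f1 : face z Q hQ (A ∪ B) ≠ ⊤ := (WithTop.add_ne_top.1 (h4 ▸ WithTop.add_ne_top.2
        ⟨hfA, by rw [face_isDownSet hQ hB]; exact hQ.finite _ hB⟩)).1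
      refine (withTop_le_of_add_le_add_left f1 (le_trans ?_ h1)).antisymm (face_le hQ _)
      exact add_le_add_left (face_le hQ _) _
    have := IsDownSet.induction (P := Q) (p := fun B => IsDownSet P (A ∩ B)) ?_ ?_ _
      (isDownSet_univ Q)
    · simpa using this
    · rw [Set.inter_empty]; exact isDownSet_empty P
    · intro B C hB' hC hd hBC ih
      have e1 : A ∩ (B ∪ C) ∪ B = B ∪ A ∩ C := by ext x; simp; tauto
      have e2 : A ∩ (B ∪ C) ∩ B = A ∩ B := by ext x; simp; tauto
      -- The intersection `A ∩ B` is a down-set by induction and the union `B ∪ A ∩ C` by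
      -- restriction to `C`. Agreement of `z` with `z_Q` supplies the modular equality, so
      -- conformity of `P` adds the bubble.
      refine (hP.closed (X := A ∩ (B ∪ C)) (Y := B) ?_ ?_ ?_).1
      · rwa [e2]
      · have e3 : B ∪ A ∩ C = B ∪ (below Q C ∪ A ∩ C) := by
          rw [← Set.union_assoc, Set.union_eq_left.2 (below_subset hBC)]
        rw [e1, e3]
        exact (hPQ.isDownSet hB').union ((isDownSet_rest hPQ).1 hA C hC)
      · rw [e1, e2, hB _ hBC, hB _ hB', face_inter_union hQ hB'.isSaturated hd, add_assoc,
          face_add hQ hB' hC hd hBC Set.inter_subset_right]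
  · intro hA
    exact ⟨(rest_refines P Q).isDownSet hA,
        (face_isDownSet_of_refines hP.toCompatible hPQ hQ hA).symm⟩

/-- Inside a bubble `C` of `Q` no relation of `R` is lost, because `z` and `z_Q` agree on `below Q C
∪ U` for every `U ⊆ C`. -/
theorem rest_liftPre {hQ : Compatible z Q} {R : Preorder I} (hR : Conforms (face z Q hQ) R) :
    rest (liftPre z (face z Q hQ) R) Q = R := by
  refine preorder_ext_isDownSet fun X => ?_
  rw [isDownSet_rest (liftPre_refines hR)]
  simp only [isDownSet_liftPre_face hR]
  constructor
  · intro h x y hxy hy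
    obtain ⟨C, hC, hyC⟩ := exists_bubble Q y
    have hx : x ∈ C := (isSaturated_bubble hC).isDownSet_of_conforms_face hR hxy hyC
    exact (((h C hC).1 hxy (Or.inr ⟨hy, hyC⟩)).resolve_left fun h => h.2 hx).1
  · intro hX C hC
    have hb := isDownSet_below Q hC
    refine ⟨(hb.isSaturated.isDownSet_of_conforms_face hR).union
      (hX.inter ((isSaturated_bubble hC).isDownSet_of_conforms_face hR)), ?_⟩
    have hd := disjoint_below Q C
    rw [← face_add hQ hb hC hd (isDownSet_below_union Q C) Set.inter_subset_right,
      ← face_isDownSet hQ hb]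
    have := face_inter_union hQ hb.isSaturated (hd.mono_right (Set.inter_subset_right (s := X)))
      Set.univ
    simpa [add_comm] using this.symm

/-- Faces of a face of `z`, as conforming preorders. -/
def restEquiv (hQ : Compatible z Q) :
    {P : ConformingPre z // Refines P.1 Q} ≃ ConformingPre (face z Q hQ) where
  toFun P := ⟨rest P.1.1 Q, conforms_rest P.1.2 P.2 hQ⟩
  invFun R := ⟨⟨liftPre z (face z Q hQ) R.1, conforms_liftPre_face R.2⟩, liftPre_refines R.2⟩
  left_inv P := Subtype.ext (Subtype.ext (liftPre_rest P.1.2 P.2 hQ))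
  right_inv R := Subtype.ext (rest_liftPre R.2)

theorem rest_refines_rest (hQ : Compatible z Q) {P P' : Preorder I} (hP : Conforms z P)
    (hP' : Conforms z P') (h : Refines P Q) (h' : Refines P' Q)
    (hr : Refines (rest P Q) (rest P' Q)) : Refines P P' := by
  rw [← liftPre_rest hP h hQ, ← liftPre_rest hP' h' hQ]
  exact liftPre_mono hr

/-- `(z_Q)_R = z_P` when `R` is the restriction of `P` to the bubbles of `Q`. -/
theorem face_rest (hP : Conforms z P) (hPQ : Refines P Q) (hQ : Compatible z Q)
    (hR : Compatible (face z Q hQ) (rest P Q)) :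
    face (face z Q hQ) (rest P Q) hR = face z P hP.toCompatible := by
  symm
  refine face_unique hR _ fun E A K hA hK hd hAK => ?_
  have hK' : K ∈ bubbles P := by rwa [bubbles_rest hPQ] at hK
  rw [face_inter_add_sdiff hP.toCompatible (isSaturated_bubble hK')]
  have e1 : E ∩ (A ∪ K) ∩ K = E ∩ K := by ext x; simp; tauto
  have e2 : (E ∩ (A ∪ K)) \ K = E ∩ A := by
    have hd' : ∀ x, x ∈ A → x ∉ K := fun x h1 h2 => Set.disjoint_left.1 hd h1 h2
    ext x; have := hd' x; simp; tauto
  rw [e1, e2, add_comm (face z P _ (E ∩ K)), add_assoc]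
  congr 1
  have hU : E ∩ K ⊆ K := Set.inter_subset_right
  generalize E ∩ K = U at hU
  -- The increment takes place within the bubble `C` of `Q` containing `K`. Outside `C` nothing
  -- changes, and inside it `z_Q` is the minor of `z` above `below Q C`, where the increment formula
  -- for `P` applies.
  obtain ⟨k, hk⟩ := bubble_nonempty hK
  obtain ⟨C, hC, hkC⟩ := exists_bubble Q k
  have hKC : K ⊆ C := fun x hx => mem_bubble hC hkC (hPQ (bubble_le hK' hk hx))
    (hPQ (bubble_le hK' hx hk))
  have hUC := hU.trans hKC
  have hb := isDownSet_below Q hC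
  have hbd := disjoint_below Q C
  have hbu := isDownSet_below_union Q C
  rw [face_inter_add_sdiff hQ (isSaturated_bubble hC) A,
    face_inter_add_sdiff hQ (isSaturated_bubble hC) (A ∪ U)]
  have e3 : (A ∪ U) \ C = A \ C := by
    ext x; have := @hUC x; simp; tauto
  rw [e3, ← add_assoc]
  congr 1
  refine withTop_add_right_cancel (hQ.finite _ hb) ?_
  rw [add_assoc, face_add hQ hb hC hbd hbu Set.inter_subset_right,
    face_add hQ hb hC hbd hbu Set.inter_subset_right]
  have hAK' := (isDownSet_rest hPQ).1 hAK C hC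
  have e4 : below Q C ∪ (A ∪ K) ∩ C = below Q C ∪ A ∩ C ∪ K := by
    ext x; have := @hKC x; simp; tauto
  have e5 : below Q C ∪ (A ∪ U) ∩ C = below Q C ∪ A ∩ C ∪ U := by
    ext x; have := @hUC x; simp; tauto
  rw [e4] at hAK'
  rw [e5]
  refine face_add hP.toCompatible ((isDownSet_rest hPQ).1 hA C hC) hK' ?_ hAK' hU
  exact Set.disjoint_union_left.2 ⟨hbd.mono_right hKC, hd.mono_left Set.inter_subset_left⟩

/-- `(z_Q)^R = (z^P)_Q` when `R` is the restriction of `P` to the bubbles of `Q`. -/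
theorem cone_rest (hPQ : Refines P Q) (hQ : Compatible z Q) :
    cone (face z Q hQ) (rest P Q) = face (cone z P) Q (compatible_cone hPQ hQ) := by
  apply SubmodFun.ext
  funext X
  have hb : ∀ C ∈ bubbles Q, cone z P (below Q C) = z (below Q C) := fun C hC =>
    cone_of_isDownSet (hPQ.isDownSet (isDownSet_below Q hC))
  by_cases hX : IsDownSet (rest P Q) X
  · rw [cone_of_isDownSet hX]
    simp only [face]
    refine Finset.sum_congr rfl fun C _ => ?_
    simp only [minor]
    rw [cone_of_isDownSet ((isDownSet_rest hPQ).1 hX C C.2), hb C C.2]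
  -- If `X` is not a down-set of the restriction, one bubble of `Q` already witnesses this, and its
  -- summand is infinite.
  · rw [cone_of_not_isDownSet hX]
    rw [isDownSet_rest hPQ] at hX
    push Not at hX
    obtain ⟨C, hC, h⟩ := hX
    symm
    refine WithTop.sum_eq_top.2 ⟨⟨C, hC⟩, Finset.mem_univ _, ?_⟩
    rw [minor_eq_iff, cone_of_not_isDownSet h, top_add]
    rw [hb C hC]
    exact hQ.finite _ (isDownSet_below Q hC)

end Restriction

/-! ### Bijections, products and ordered decompositions. -/

section Transport

variable {I J S T : Type u}

/-- The preorder induced by a map. -/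
abbrev comapPre (f : J → I) (P : Preorder I) : Preorder J :=
  preorderOfRel (fun x y => P.le (f x) (f y)) (fun _ => P.le_refl _)
    fun _ _ _ => P.le_trans _ _ _

theorem comapPre_symm_le (e : I ≃ J) (P : Preorder I) (x y : I) :
    (comapPre e.symm P).le (e x) (e y) ↔ P.le x y := by
  change P.le (e.symm (e x)) (e.symm (e y)) ↔ _
  rw [e.symm_apply_apply, e.symm_apply_apply]

theorem comapPre_comapPre_symm (e : I ≃ J) (P : Preorder I) :
    comapPre e (comapPre e.symm P) = P :=
  preorder_ext (comapPre_symm_le e P)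

theorem isDownSet_comapPre_symm (e : I ≃ J) (P : Preorder I) (A : Set J) :
    IsDownSet (comapPre e.symm P) A ↔ IsDownSet P (e ⁻¹' A) := by
  constructor
  · intro h x y hxy hy
    exact h (x := e x) (y := e y) ((comapPre_symm_le e P x y).2 hxy) hy
  · intro h x y hxy hy
    simpa using h (x := e.symm x) (y := e.symm y) hxy (by simpa using hy)

theorem compatible_comapPre_symm (e : I ≃ J) {z : SubmodFun I} {P : Preorder I}
    (h : Compatible z P) : Compatible (z.map e) (comapPre e.symm P) := by
  simp only [compatible_iff, isDownSet_comapPre_symm, SubmodFun.map]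
  exact ⟨fun A hA => h.finite _ hA, fun X Y hX hY => h.modular hX hY⟩

theorem conforms_comapPre_symm (e : I ≃ J) {z : SubmodFun I} {P : Preorder I}
    (h : Conforms z P) : Conforms (z.map e) (comapPre e.symm P) := by
  refine conforms_iff.2 ⟨compatible_comapPre_symm e h.toCompatible, fun X Y => ?_⟩
  simp only [isDownSet_comapPre_symm, SubmodFun.map]
  exact fun h1 h2 h3 => h.closed h1 h2 h3

theorem SubmodFun.map_map_symm (e : I ≃ J) (z : SubmodFun I) : (z.map e).map e.symm = z := by
  ext A
  simp [SubmodFun.map, ← Set.preimage_comp]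

/-- Transport of conforming preorders. -/
def conformingMap (e : I ≃ J) (z : SubmodFun I) : ConformingPre z ≃ ConformingPre (z.map e) where
  toFun P := ⟨comapPre e.symm P.1, conforms_comapPre_symm e P.2⟩
  invFun P := ⟨comapPre e P.1, by
    simpa only [SubmodFun.map_map_symm, Equiv.symm_symm] using conforms_comapPre_symm e.symm P.2⟩
  left_inv P := Subtype.ext (comapPre_comapPre_symm e P.1)
  right_inv P := Subtype.ext (comapPre_comapPre_symm e.symm P.1)

theorem bubble_comapPre_symm (e : I ≃ J) {P : Preorder I} {C : Set J}
    (hC : C ∈ bubbles (comapPre e.symm P)) : e ⁻¹' C ∈ bubbles P := by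
  obtain ⟨c, rfl⟩ := hC
  refine ⟨e.symm c, Set.ext fun y => ?_⟩
  change P.le _ _ ∧ P.le _ _ ↔ P.le _ (e.symm (e y)) ∧ P.le (e.symm (e y)) _
  rw [e.symm_apply_apply]

theorem face_map [Finite I] [Finite J] (e : I ≃ J) {z : SubmodFun I} {P : Preorder I}
    (h : Compatible z P) (h' : Compatible (z.map e) (comapPre e.symm P)) :
    face (z.map e) (comapPre e.symm P) h' = (face z P h).map e := by
  symm
  refine face_unique h' _ fun E A C hA hC hd hAC => ?_
  rw [isDownSet_comapPre_symm] at hA hAC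
  have hd' := hd.preimage e
  simp only [SubmodFun.map, Set.preimage_inter, Set.preimage_union] at hAC ⊢
  rw [face_inter_union h hA.isSaturated hd', add_assoc,
    face_add h hA (bubble_comapPre_symm e hC) hd' hAC Set.inter_subset_right]

theorem cone_map (e : I ≃ J) (z : SubmodFun I) (P : Preorder I) :
    cone (z.map e) (comapPre e.symm P) = (cone z P).map e := by
  ext1
  funext A
  by_cases h : IsDownSet P (e ⁻¹' A) <;>
    simp [cone, SubmodFun.map, isDownSet_comapPre_symm, h]

theorem refines_comapPre_symm (e : I ≃ J) {P Q : Preorder I} :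
    Refines (comapPre e.symm P) (comapPre e.symm Q) ↔ Refines P Q :=
  ⟨fun h x y hxy => (comapPre_symm_le e Q x y).1 (h ((comapPre_symm_le e P x y).2 hxy)),
    fun h _ _ hxy => h hxy⟩

/-- The disjoint union of preorders. -/
abbrev sumPre (P : Preorder S) (Q : Preorder T) : Preorder (S ⊕ T) :=
  preorderOfRel (Sum.LiftRel P.le Q.le)
    (by rintro (x | x); exacts [.inl (P.le_refl x), .inr (Q.le_refl x)])
    (by
      rintro _ _ _ (h | h) (h' | h')
      exacts [.inl (P.le_trans _ _ _ h h'), .inr (Q.le_trans _ _ _ h h')])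

theorem isDownSet_sumPre {P : Preorder S} {Q : Preorder T} {A : Set (S ⊕ T)} :
    IsDownSet (sumPre P Q) A ↔ IsDownSet P (Sum.inl ⁻¹' A) ∧ IsDownSet Q (Sum.inr ⁻¹' A) := by
  constructor
  · exact fun h => ⟨fun x y hxy hy => h (.inl hxy) hy, fun x y hxy hy => h (.inr hxy) hy⟩
  · rintro ⟨h1, h2⟩ _ _ (h | h) hy
    exacts [h1 h hy, h2 h hy]

theorem refines_sumPre {P P' : Preorder S} {Q Q' : Preorder T} :
    Refines (sumPre P Q) (sumPre P' Q') ↔ Refines P P' ∧ Refines Q Q' := by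
  constructor
  · exact fun h => ⟨fun x y hxy => Sum.liftRel_inl_inl.1 (h (.inl hxy)),
      fun x y hxy => Sum.liftRel_inr_inr.1 (h (.inr hxy))⟩
  · rintro ⟨h1, h2⟩ _ _ (h | h)
    exacts [.inl (h1 h), .inr (h2 h)]

theorem bubble_sumPre {P : Preorder S} {Q : Preorder T} {C : Set (S ⊕ T)}
    (hC : C ∈ bubbles (sumPre P Q)) :
    (Sum.inl ⁻¹' C ∈ bubbles P ∧ Sum.inr ⁻¹' C = ∅) ∨
      (Sum.inl ⁻¹' C = ∅ ∧ Sum.inr ⁻¹' C ∈ bubbles Q) := by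
  obtain ⟨c | c, rfl⟩ := hC
  · exact Or.inl ⟨⟨c, by ext y; simp⟩, by ext y; simp⟩
  · exact Or.inr ⟨by ext y; simp, ⟨c, by ext y; simp⟩⟩

theorem compatible_sumPre {u : SubmodFun S} {v : SubmodFun T} {P : Preorder S} {Q : Preorder T}
    (hP : Compatible u P) (hQ : Compatible v Q) : Compatible (u.prod v) (sumPre P Q) := by
  simp only [compatible_iff, isDownSet_sumPre, SubmodFun.prod]
  refine ⟨fun A hA => WithTop.add_ne_top.2 ⟨hP.finite _ hA.1, hQ.finite _ hA.2⟩,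
    fun X Y hX hY => ?_⟩
  rw [add_add_add_comm, hP.modular hX.1 hY.1, hQ.modular hX.2 hY.2, add_add_add_comm]
  rfl

theorem withTop_eq_and_eq {a b c d : WithTop ℝ} (h1 : a ≤ b) (h2 : c ≤ d) (h : b + d = a + c)
    (ha : a ≠ ⊤) (hc : c ≠ ⊤) : b = a ∧ d = c := by
  constructor
  · refine h1.antisymm' (withTop_le_of_add_le_add_left hc ?_)
    rw [add_comm c a, ← h, add_comm]
    exact add_le_add_right h2 b
  · refine h2.antisymm' (withTop_le_of_add_le_add_left ha ?_)
    rw [← h]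
    exact add_le_add_left h1 d

theorem conforms_sumPre {u : SubmodFun S} {v : SubmodFun T} {P : Preorder S} {Q : Preorder T} :
    Conforms (u.prod v) (sumPre P Q) ↔ Conforms u P ∧ Conforms v Q := by
  constructor
  · intro h
    constructor
    · have key : ∀ X : Set S, IsDownSet (sumPre P Q) (Sum.inl '' X) ↔ IsDownSet P X := fun X => by
        rw [isDownSet_sumPre, Set.preimage_image_eq _ Sum.inl_injective,
          Set.preimage_inr_image_inl]
        exact and_iff_left (isDownSet_empty Q)
      have hv : ∀ X : Set S, (u.prod v) (Sum.inl '' X) = u X := fun X => by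
        simp [SubmodFun.prod, Set.preimage_image_eq _ Sum.inl_injective, v.empty']
      rw [conforms_iff, compatible_iff] at h ⊢
      simp only [← key, ← hv, Set.image_union, Set.image_inter Sum.inl_injective]
      exact ⟨⟨fun A => h.1.1 _, fun X Y => h.1.2 _ _⟩, fun X Y => h.2 _ _⟩
    · have key : ∀ X : Set T, IsDownSet (sumPre P Q) (Sum.inr '' X) ↔ IsDownSet Q X := fun X => by
        rw [isDownSet_sumPre, Set.preimage_image_eq _ Sum.inr_injective,
          Set.preimage_inl_image_inr]
        exact and_iff_right (isDownSet_empty P)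
      have hv : ∀ X : Set T, (u.prod v) (Sum.inr '' X) = v X := fun X => by
        simp [SubmodFun.prod, Set.preimage_image_eq _ Sum.inr_injective, u.empty']
      rw [conforms_iff, compatible_iff] at h ⊢
      simp only [← key, ← hv, Set.image_union, Set.image_inter Sum.inr_injective]
      exact ⟨⟨fun A => h.1.1 _, fun X Y => h.1.2 _ _⟩, fun X Y => h.2 _ _⟩
  · rintro ⟨hP, hQ⟩
    refine conforms_iff.2 ⟨compatible_sumPre hP.toCompatible hQ.toCompatible, fun X Y => ?_⟩
    simp only [isDownSet_sumPre, SubmodFun.prod, Set.preimage_inter, Set.preimage_union]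
    rintro ⟨a1, a2⟩ ⟨b1, b2⟩ h
    rw [add_add_add_comm, add_add_add_comm (u _) (v _)] at h
    have hu := u.submodular' (Sum.inl ⁻¹' X) (Sum.inl ⁻¹' Y)
    have hv := v.submodular' (Sum.inr ⁻¹' X) (Sum.inr ⁻¹' Y)
    rw [add_comm] at hu hv
    -- The sum of two submodular inequalities with finite smaller sides is an equality only if each
    -- of them is.
    obtain ⟨e1, e2⟩ := withTop_eq_and_eq hu hv h
      (WithTop.add_ne_top.2 ⟨hP.finite _ a1, hP.finite _ b1⟩)
      (WithTop.add_ne_top.2 ⟨hQ.finite _ a2, hQ.finite _ b2⟩)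
    obtain ⟨c1, c2⟩ := hP.closed a1 b1 e1
    obtain ⟨d1, d2⟩ := hQ.closed a2 b2 e2
    exact ⟨⟨c1, d1⟩, c2, d2⟩

/-- A product splits along the two summands, so conformity makes both of them down-sets and no
relation of `R` crosses between them. -/
theorem sumPre_comapPre {u : SubmodFun S} {v : SubmodFun T} {R : Preorder (S ⊕ T)}
    (hR : Conforms (u.prod v) R) : sumPre (comapPre Sum.inl R) (comapPre Sum.inr R) = R := by
  have h : IsDownSet R (Set.range Sum.inl) ∧ IsDownSet R (Set.range Sum.inr) := by
    refine hR.closed ?_ ?_ ?_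
    · rw [Set.range_inl_inter_range_inr]
      exact isDownSet_empty R
    · rw [Set.range_inl_union_range_inr]
      exact isDownSet_univ R
    · rw [Set.range_inl_inter_range_inr, Set.range_inl_union_range_inr]
      simp [SubmodFun.prod, u.empty', v.empty']
  refine preorder_ext fun x y => ?_
  constructor
  · rintro (h | h) <;> exact h
  · rcases x with x | x <;> rcases y with y | y <;> intro hxy
    · exact .inl hxy
    · obtain ⟨w, hw⟩ := h.2 hxy ⟨y, rfl⟩
      cases hw
    · obtain ⟨w, hw⟩ := h.1 hxy ⟨y, rfl⟩
      cases hw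
    · exact .inr hxy

/-- Conforming preorders of a product. -/
def conformingProd (u : SubmodFun S) (v : SubmodFun T) :
    ConformingPre u × ConformingPre v ≃ ConformingPre (u.prod v) where
  toFun P := ⟨sumPre P.1.1 P.2.1, conforms_sumPre.2 ⟨P.1.2, P.2.2⟩⟩
  invFun R :=
    have h : Conforms (u.prod v) (sumPre (comapPre Sum.inl R.1) (comapPre Sum.inr R.1)) := by
      rw [sumPre_comapPre R.2]; exact R.2
    (⟨comapPre Sum.inl R.1, (conforms_sumPre.1 h).1⟩,
      ⟨comapPre Sum.inr R.1, (conforms_sumPre.1 h).2⟩)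
  left_inv P := Prod.ext (Subtype.ext (preorder_ext fun _ _ => Sum.liftRel_inl_inl))
    (Subtype.ext (preorder_ext fun _ _ => Sum.liftRel_inr_inr))
  right_inv R := Subtype.ext (sumPre_comapPre R.2)

theorem face_sumPre [Finite S] [Finite T] {u : SubmodFun S} {v : SubmodFun T} {P : Preorder S}
    {Q : Preorder T} (hP : Compatible u P) (hQ : Compatible v Q)
    (h : Compatible (u.prod v) (sumPre P Q)) :
    face (u.prod v) (sumPre P Q) h = (face u P hP).prod (face v Q hQ) := by
  symm
  refine face_unique h _ fun E A C hA hC hd hAC => ?_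
  rw [isDownSet_sumPre] at hA hAC
  have hd1 := hd.preimage Sum.inl
  have hd2 := hd.preimage Sum.inr
  simp only [SubmodFun.prod, Set.preimage_inter, Set.preimage_union] at hAC ⊢
  rw [face_inter_union hP hA.1.isSaturated hd1, face_inter_union hQ hA.2.isSaturated hd2]
  rcases bubble_sumPre hC with ⟨h1, h2⟩ | ⟨h1, h2⟩
  · rw [h2, Set.inter_empty, SubmodFun.empty', Set.union_empty,
      ← face_add hP hA.1 h1 hd1 hAC.1 Set.inter_subset_right]
    ac_rfl
  · rw [h1, Set.inter_empty, SubmodFun.empty', Set.union_empty,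
      ← face_add hQ hA.2 h2 hd2 hAC.2 Set.inter_subset_right]
    ac_rfl

theorem cone_sumPre (u : SubmodFun S) (v : SubmodFun T) (P : Preorder S) (Q : Preorder T) :
    cone (u.prod v) (sumPre P Q) = (cone u P).prod (cone v Q) := by
  ext1
  funext A
  by_cases h1 : IsDownSet P (Sum.inl ⁻¹' A) <;> by_cases h2 : IsDownSet Q (Sum.inr ⁻¹' A) <;>
    simp [cone, SubmodFun.prod, isDownSet_sumPre, h1, h2]

/-- The preorder on `S ⊕ T` with the elements of `S` below all others. -/
abbrev ordPre (S T : Type u) : Preorder (S ⊕ T) :=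
  preorderOfRel (fun x y => y ∈ SubmodFun.left S T → x ∈ SubmodFun.left S T) (fun _ h => h)
    fun _ _ _ h h' hz => h (h' hz)

theorem refines_ordPre {P : Preorder (S ⊕ T)} :
    Refines P (ordPre S T) ↔ IsDownSet P (SubmodFun.left S T) := Iff.rfl

/-- The only down-sets are `∅`, `S` and the whole set. They form a chain, on which modularity is
automatic. When `z` has further splittings this preorder does not conform. -/
theorem compatible_ordPre {z : SubmodFun (S ⊕ T)} (h : z (SubmodFun.left S T) ≠ ⊤) :
    Compatible z (ordPre S T) := by
  have hle : ∀ t : T, ∀ x, (ordPre S T).le x (Sum.inr t) := by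
    rintro t x ⟨s, hs⟩
    cases hs
  have hle' : ∀ s : S, ∀ x, (ordPre S T).le (Sum.inl s) x := fun s x _ => ⟨s, rfl⟩
  have hds : ∀ A, IsDownSet (ordPre S T) A → A = ∅ ∨ A = SubmodFun.left S T ∨ A = Set.univ := by
    intro A hA
    by_cases hT : ∃ t : T, Sum.inr t ∈ A
    · obtain ⟨t, ht⟩ := hT
      exact Or.inr (Or.inr (Set.eq_univ_of_forall fun x => hA (hle t x) ht))
    · push Not at hT
      rcases A.eq_empty_or_nonempty with h0 | ⟨y, hy⟩
      · exact Or.inl h0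
      · refine Or.inr (Or.inl (Set.Subset.antisymm ?_ ?_))
        · rintro (s | t) hx
          exacts [⟨s, rfl⟩, (hT t hx).elim]
        · rintro _ ⟨s, rfl⟩
          exact hA (hle' s y) hy
  rw [compatible_iff]
  constructor
  · intro A hA
    rcases hds A hA with rfl | rfl | rfl
    exacts [by simp [z.empty'], h, z.univ_ne_top']
  · intro X Y hX hY
    rcases hds X hX with rfl | rfl | rfl <;> rcases hds Y hY with rfl | rfl | rfl <;>
      simp [add_comm]

theorem bubble_ordPre {C : Set (S ⊕ T)} (hC : C ∈ bubbles (ordPre S T)) :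
    (Nonempty S ∧ C = Set.range Sum.inl) ∨ (Nonempty T ∧ C = Set.range Sum.inr) := by
  obtain ⟨c | c, rfl⟩ := hC
  · exact Or.inl ⟨⟨c⟩, Set.ext fun y => ⟨fun h => h.2 ⟨c, rfl⟩, fun h => ⟨fun _ => ⟨c, rfl⟩,
      fun _ => h⟩⟩⟩
  · refine Or.inr ⟨⟨c⟩, ?_⟩
    rw [← Set.compl_range_inl]
    have hc : Sum.inr c ∉ SubmodFun.left S T := by simp
    exact Set.ext fun y => ⟨fun h hy => hc (h.1 hy), fun h => ⟨fun hy => (h hy).elim,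
        fun hy => (hc hy).elim⟩⟩

/-- The product of restriction and corestriction is the face of the ordered decomposition. -/
theorem face_ordPre [Finite S] [Finite T] {z : SubmodFun (S ⊕ T)}
    (h : z (SubmodFun.left S T) ≠ ⊤) :
    face z (ordPre S T) (compatible_ordPre h) = (z.restrict h).prod (z.corestrict h) := by
  symm
  refine face_unique _ _ fun E A C hA hC hd hAC => ?_
  rcases bubble_ordPre hC with ⟨⟨s⟩, rfl⟩ | ⟨⟨t⟩, rfl⟩
  · have hA0 : A = ∅ := by
      refine Set.eq_empty_of_forall_notMem fun y hy => ?_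
      exact Set.disjoint_left.1 hd (hA (x := Sum.inl s) (fun _ => ⟨s, rfl⟩) hy) ⟨s, rfl⟩
    subst hA0
    have e1 : E ∩ Set.range Sum.inl ∩ Set.range Sum.inl = E ∩ Set.range (Sum.inl : S → S ⊕ T) := by
      simp
    have e2 : E ∩ Set.range Sum.inl ∩ Set.range Sum.inr = (∅ : Set (S ⊕ T)) := by
      rw [Set.inter_assoc, Set.range_inl_inter_range_inr, Set.inter_empty]
    simp [SubmodFun.prod, SubmodFun.restrict, SubmodFun.corestrict, z.empty',
      Set.image_preimage_eq_inter_range, SubmodFun.sub_self_of_ne_top h, e1, e2]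
  · have hA0 : A = SubmodFun.left S T := by
      refine Set.Subset.antisymm ?_ ?_
      · rintro (x | x) hx
        · exact ⟨x, rfl⟩
        · exact (Set.disjoint_left.1 hd hx ⟨x, rfl⟩).elim
      · rintro _ ⟨x, rfl⟩
        have := hAC (x := Sum.inl x) (y := Sum.inr t) (fun _ => ⟨x, rfl⟩) (Or.inr ⟨t, rfl⟩)
        rcases this with h' | ⟨w, hw⟩
        · exact h'
        · cases hw
    subst hA0
    have e1 : E ∩ SubmodFun.left S T ∩ Set.range Sum.inl = E ∩ SubmodFun.left S T := by
      simp
    have e2 : E ∩ SubmodFun.left S T ∩ Set.range Sum.inr = ∅ := by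
      rw [Set.inter_assoc, Set.range_inl_inter_range_inr, Set.inter_empty]
    simp only [SubmodFun.prod, SubmodFun.restrict, SubmodFun.corestrict,
      Set.range_inl_union_range_inr, Set.inter_univ, Set.image_preimage_eq_inter_range, e1, e2,
      Set.union_empty, SubmodFun.sub_self_of_ne_top h, add_zero]
    rw [add_assoc, withTop_sub_add_cancel h]

theorem face_congr [Finite I] {z z' : SubmodFun I} {P P' : Preorder I} (hz : z = z') (hP : P = P')
    (h : Compatible z P) (h' : Compatible z' P') : face z P h = face z' P' h' := by
  subst hz hP; rfl

end Transport

/-! ### Splittings of `z` and the totally disconnected conforming preorder. -/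

section Disconnected

variable {I : Type u}

/-- `z` is the product of its restrictions to `A` and to its complement. -/
def SplitsAlong (z : SubmodFun I) (A : Set I) : Prop := z A + z Aᶜ = z Set.univ

theorem SplitsAlong.compl {z : SubmodFun I} {A : Set I} (h : SplitsAlong z A) :
    SplitsAlong z Aᶜ := by
  rw [SplitsAlong, compl_compl, add_comm]; exact h

theorem SplitsAlong.ne_top {z : SubmodFun I} {A : Set I} (h : SplitsAlong z A) : z A ≠ ⊤ := by
  have := z.univ_ne_top'
  rw [← h, WithTop.add_ne_top] at this
  exact this.1

/-- By `splits_iff` above `∅`, the single equality for the whole set propagates to all subsets. -/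
theorem SplitsAlong.inter_add_sdiff {z : SubmodFun I} {A : Set I} (h : SplitsAlong z A)
    (E : Set I) : z E = z (E ∩ A) + z (E \ A) := by
  have h0 : z ∅ ≠ ⊤ := by simp [z.empty']
  have hs : Splits z ∅ A Aᶜ := by
    rw [splits_iff h0 (by simpa using z.univ_ne_top') disjoint_compl_right]
    simpa [z.empty', SplitsAlong] using h
  have hm : ∀ U, minor z ∅ U = z U := fun U => by
    rw [minor_eq_iff h0]; simp [z.empty']
  have := hs E (by simp)
  rwa [hm, hm, hm, ← Set.sdiff_eq] at this

theorem SplitsAlong.union {z : SubmodFun I} {A B : Set I} (hA : SplitsAlong z A)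
    (hB : SplitsAlong z B) : SplitsAlong z (A ∪ B) := by
  have h1 := hA.inter_add_sdiff (A ∪ B)
  have h2 := hB.inter_add_sdiff Aᶜ
  have e1 : (A ∪ B) ∩ A = A := by simp
  have e2 : (A ∪ B) \ A = Aᶜ ∩ B := by ext x; simp; tauto
  have e3 : Aᶜ \ B = (A ∪ B)ᶜ := by ext x; simp
  rw [e1, e2] at h1
  rw [e3] at h2
  rw [SplitsAlong, ← hA, h2, h1, add_assoc]

theorem SplitsAlong.inter {z : SubmodFun I} {A B : Set I} (hA : SplitsAlong z A)
    (hB : SplitsAlong z B) : SplitsAlong z (A ∩ B) := by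
  have := (hA.compl.union hB.compl).compl
  rwa [← Set.compl_inter, compl_compl] at this

theorem splitsAlong_empty (z : SubmodFun I) : SplitsAlong z ∅ := by
  simp [SplitsAlong, z.empty']

theorem SplitsAlong.modular {z : SubmodFun I} {A B : Set I} (hA : SplitsAlong z A) :
    z A + z B = z (A ∩ B) + z (A ∪ B) := by
  rw [hA.inter_add_sdiff B, hA.inter_add_sdiff (A ∪ B)]
  have e1 : (A ∪ B) ∩ A = A := by simp
  have e2 : (A ∪ B) \ A = B \ A := by simp
  rw [e1, e2, Set.inter_comm B A]
  ac_rfl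

/-- Cut `Y` along `X ∩ Y`, and `Xᶜ` along `X ∪ Y`: both contain the piece `Y \ (X ∩ Y)`. Comparing
the two formulas cancels it and leaves the splitting along `X`. This is what makes `splitPre`
conform. -/
theorem splitsAlong_of_modular {z : SubmodFun I} {X Y : Set I} (h1 : SplitsAlong z (X ∩ Y))
    (h2 : SplitsAlong z (X ∪ Y)) (h : z X + z Y = z (X ∩ Y) + z (X ∪ Y)) : SplitsAlong z X := by
  have h3 := h1.inter_add_sdiff Y
  have h4 := h2.inter_add_sdiff Xᶜ
  have e1 : Y ∩ (X ∩ Y) = X ∩ Y := by ext x; simp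
  have e2 : Xᶜ ∩ (X ∪ Y) = Y \ (X ∩ Y) := by ext x; simp; tauto
  have e3 : Xᶜ \ (X ∪ Y) = (X ∪ Y)ᶜ := by ext x; simp
  rw [e1] at h3
  rw [e2, e3] at h4
  refine withTop_add_left_cancel h1.ne_top ?_
  rw [← h2, ← add_assoc _ (z (X ∪ Y)), ← h, h4, h3]
  ac_rfl

/-- The preorder whose down-sets are the sets along which `z` splits. -/
abbrev splitPre (z : SubmodFun I) : Preorder I := ofFamily {A | SplitsAlong z A}

theorem IsTotallyDisconnected.compl {P : Preorder I} (h : IsTotallyDisconnected P) {A : Set I}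
    (hA : IsDownSet P A) : IsDownSet P Aᶜ := fun _ _ hxy hy hx => hy (hA (h hxy) hx)

theorem IsTotallyDisconnected.splitsAlong {z : SubmodFun I} {P : Preorder I}
    (h : IsTotallyDisconnected P) (hP : Compatible z P) {A : Set I} (hA : IsDownSet P A) :
    SplitsAlong z A := by
  have := hP.modular hA (h.compl hA)
  rwa [Set.inter_compl_self, Set.union_compl_self, z.empty', zero_add] at this

/-- The down-sets of an equivalence relation have down-sets as complements, so `z` splits along them
and its own increments are those of the face. -/
theorem face_eq_self [Finite I] {z : SubmodFun I} {P : Preorder I} (h : IsTotallyDisconnected P)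
    (hP : Compatible z P) : face z P hP = z := by
  symm
  refine face_unique hP _ fun E A C hA _ hd _ => ?_
  have hs := h.splitsAlong hP hA
  have hd' : ∀ x, x ∈ A → x ∉ C := fun x h1 h2 => Set.disjoint_left.1 hd h1 h2
  rw [hs.inter_add_sdiff (E ∩ (A ∪ C)), hs.inter_add_sdiff (A ∪ E ∩ C)]
  have e1 : E ∩ (A ∪ C) ∩ A = E ∩ A := by ext x; simp; tauto
  have e2 : (E ∩ (A ∪ C)) \ A = E ∩ C := by ext x; have := hd' x; simp; tauto
  have e3 : (A ∪ E ∩ C) ∩ A = A := by simp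
  have e4 : (A ∪ E ∩ C) \ A = E ∩ C := by ext x; have := hd' x; simp; tauto
  rw [e1, e2, e3, e4]
  ac_rfl

theorem isDownSet_splitPre [Finite I] (z : SubmodFun I) (A : Set I) :
    IsDownSet (splitPre z) A ↔ SplitsAlong z A :=
  isDownSet_ofFamily (D := {A | SplitsAlong z A}) (splitsAlong_empty z)
    (by simpa using (splitsAlong_empty z).compl) (fun _ hA _ hB => hA.union hB)
    (fun _ hA _ hB => hA.inter hB) A

theorem conforms_splitPre [Finite I] (z : SubmodFun I) : Conforms z (splitPre z) := by
  simp only [conforms_iff, compatible_iff, isDownSet_splitPre]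
  exact ⟨⟨fun A hA => hA.ne_top, fun X Y hX _ => hX.modular⟩, fun X Y h1 h2 h3 =>
    ⟨splitsAlong_of_modular h1 h2 h3, splitsAlong_of_modular (Set.inter_comm X Y ▸ h1)
      (Set.union_comm X Y ▸ h2) (by rw [add_comm, Set.inter_comm, Set.union_comm, h3])⟩⟩

theorem isTotallyDisconnected_splitPre (z : SubmodFun I) :
    IsTotallyDisconnected (splitPre z) := fun x y hxy A hA hx => by
  by_contra hy
  exact hxy Aᶜ hA.compl hy hx

/-- Compatibility gives a splitting for each down-set and its complement, and conformity turns each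
splitting into a down-set. This uniqueness leaves one term in the right counit axiom. -/
theorem eq_splitPre [Finite I] {z : SubmodFun I} {P : Preorder I} (hP : Conforms z P)
    (h : IsTotallyDisconnected P) : P = splitPre z := by
  refine preorder_ext_isDownSet fun A => ?_
  rw [isDownSet_splitPre]
  refine ⟨h.splitsAlong hP.toCompatible, fun hA => ?_⟩
  refine (hP.closed (X := A) (Y := Aᶜ) ?_ ?_ ?_).1
  · rw [Set.inter_compl_self]; exact isDownSet_empty P
  · rw [Set.union_compl_self]; exact isDownSet_univ P
  · rw [Set.inter_compl_self, Set.union_compl_self, z.empty', zero_add]; exact hA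

end Disconnected

/-! ### Modular functions and their least conforming preorder. -/

section Modular

variable {I : Type u}

theorem pre_refines {z : SubmodFun I} {P : Preorder I} (hP : Compatible z P) :
    Refines (pre z) P := fun _ y hxy =>
  hxy _ (hP.finite _ (isDownSet_Iic P y)) (P.le_refl y)

theorem isDownSet_pre [Finite I] (z : SubmodFun I) (A : Set I) :
    IsDownSet (pre z) A ↔ z A ≠ ⊤ :=
  isDownSet_ofFamily (D := {A | z A ≠ ⊤}) (by simp [z.empty']) z.univ_ne_top'
    (fun _ hA _ hB => (SubmodFun.inter_union_ne_top hA hB).2)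
    (fun _ hA _ hB => (SubmodFun.inter_union_ne_top hA hB).1) A

/-- In a modular equality with finite right side both left terms are finite, hence down-sets of `pre
z`. With `pre_refines` this is the least conforming preorder. -/
theorem conforms_pre [Finite I] {z : SubmodFun I} (hz : z.IsModular) : Conforms z (pre z) := by
  simp only [conforms_iff, compatible_iff, isDownSet_pre]
  refine ⟨⟨fun _ h => h, fun X Y hX hY => hz X Y hX hY⟩, fun X Y h1 h2 h3 => ?_⟩
  rw [← WithTop.add_ne_top, h3]
  exact WithTop.add_ne_top.2 ⟨h1, h2⟩

theorem cone_pre [Finite I] (z : SubmodFun I) : cone z (pre z) = z := by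
  ext1
  funext A
  by_cases h : IsDownSet (pre z) A
  · exact cone_of_isDownSet h
  · rw [cone_of_not_isDownSet h]
    rw [isDownSet_pre, not_not] at h
    exact h.symm

theorem pre_cone [Finite I] {z : SubmodFun I} {P : Preorder I} (h : Compatible z P) :
    pre (cone z P) = P := by
  refine preorder_ext_isDownSet fun A => ?_
  rw [isDownSet_pre]
  by_cases hA : IsDownSet P A
  · simp [cone_of_isDownSet hA, hA, h.finite _ hA]
  · simp [cone_of_not_isDownSet hA, hA]

/-- As `z` is its own cone at `pre z`, the face is by `cone_rest` a cone at the restricted preorder,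
which `pre_cone` recovers. -/
theorem pre_face [Finite I] {z : SubmodFun I} {Q : Preorder I} (hz : z.IsModular)
    (hQ : Compatible z Q) : pre (face z Q hQ) = rest (pre z) Q := by
  have h := conforms_rest (conforms_pre hz) (pre_refines hQ) hQ
  rw [← pre_cone h.toCompatible, cone_rest (pre_refines hQ) hQ]
  exact congrArg _ (face_congr (cone_pre z).symm rfl _ _)

/-- If the restriction of `pre z` is totally disconnected, it and the restriction of `Q` to itself
are both `splitPre` of the face. Restriction is injective by `liftPre_rest`. This leaves one term in
the left counit axiom. -/
theorem isTotallyDisconnected_pre_face_iff [Finite I] {z : SubmodFun I} (hz : z.IsModular)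
    {Q : Preorder I} (hQ : Conforms z Q) :
    IsTotallyDisconnected (pre (face z Q hQ.toCompatible)) ↔ Q = pre z := by
  have hP := conforms_pre hz
  have hPQ := pre_refines hQ.toCompatible
  rw [pre_face hz]
  have hd : IsTotallyDisconnected (rest Q Q) := fun x y h => ⟨h.2.2, h.2.2, h.1⟩
  constructor
  · intro h
    have h1 := eq_splitPre (conforms_rest hP hPQ hQ.toCompatible) h
    have h2 := eq_splitPre (conforms_rest hQ (Refines.refl Q) hQ.toCompatible) hd
    rw [← liftPre_rest hP hPQ hQ.toCompatible, h1, ← h2,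
      liftPre_rest hQ (Refines.refl Q) hQ.toCompatible]
  · rintro rfl
    exact hd

theorem pre_lowCoarse_le (x y : I) : (pre (SubmodFun.lowCoarse I)).le x y := by
  intro A hA hy
  have : A = ∅ ∨ A = Set.univ := by
    by_contra h
    exact hA (if_neg h)
  rcases this with rfl | rfl
  exacts [hy.elim, trivial]

theorem isTotallyDisconnected_pre_lowCoarse :
    IsTotallyDisconnected (pre (SubmodFun.lowCoarse I)) := fun x y _ => pre_lowCoarse_le y x

theorem eq_pre_lowCoarse {P : Preorder I} (h : Conforms (SubmodFun.lowCoarse I) P) :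
    P = pre (SubmodFun.lowCoarse I) :=
  Refines.antisymm (fun x y _ => pre_lowCoarse_le x y) (pre_refines h.toCompatible)

end Modular

/-! ### The empty set. -/

section Empty

variable {I : Type u}

theorem SubmodFun.eq_of_isEmpty [IsEmpty I] (z w : SubmodFun I) : z = w := by
  ext1
  funext A
  rw [Set.eq_empty_of_isEmpty A, z.empty', w.empty']

instance [IsEmpty I] : Subsingleton (SubmodFun I) := ⟨SubmodFun.eq_of_isEmpty⟩

end Empty

/-! ### Identities between products, restrictions and corestrictions. -/

namespace SubmodFun

variable {I J R S S' T T' A B C D : Type u}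

@[simp]
theorem map_apply (e : I ≃ J) (z : SubmodFun I) (E : Set J) : z.map e E = z (e ⁻¹' E) := rfl

theorem prod_apply (u : SubmodFun S) (v : SubmodFun T) (E : Set (S ⊕ T)) :
    u.prod v E = u (Sum.inl ⁻¹' E) + v (Sum.inr ⁻¹' E) := rfl

theorem restrict_apply (z : SubmodFun (S ⊕ T)) (h : z (left S T) ≠ ⊤) (U : Set S) :
    z.restrict h U = z (Sum.inl '' U) := rfl

theorem corestrict_apply (z : SubmodFun (S ⊕ T)) (h : z (left S T) ≠ ⊤) (U : Set T) :
    z.corestrict h U = z (left S T ∪ Sum.inr '' U) - z (left S T) := rfl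

theorem ext_apply {z w : SubmodFun I} (h : ∀ A, z A = w A) : z = w := by
  ext1; funext A; exact h A

theorem map_prod (e : S ≃ S') (f : T ≃ T') (u : SubmodFun S) (v : SubmodFun T) :
    (u.prod v).map (Equiv.sumCongr e f) = (u.map e).prod (v.map f) :=
  ext_apply fun _ => rfl

theorem prod_assoc (u : SubmodFun R) (v : SubmodFun S) (w : SubmodFun T) :
    ((u.prod v).prod w).map (Equiv.sumAssoc R S T) = u.prod (v.prod w) :=
  ext_apply fun _ => add_assoc _ _ _

theorem zero_prod (v : SubmodFun T) :
    (zero.prod v).map (Equiv.emptySum PEmpty.{u + 1} T) = v :=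
  ext_apply fun E => by
    rw [map_apply, prod_apply]
    exact zero_add _

theorem prod_zero (v : SubmodFun T) :
    (v.prod zero).map (Equiv.sumEmpty T PEmpty.{u + 1}) = v :=
  ext_apply fun E => by
    rw [map_apply, prod_apply]
    exact add_zero _

theorem restrict_prod (u : SubmodFun S) (v : SubmodFun T) (h : u.prod v (left S T) ≠ ⊤) :
    (u.prod v).restrict h = u :=
  ext_apply fun E => by
    simp [restrict_apply, prod_apply, Set.preimage_image_eq _ Sum.inl_injective, v.empty']

theorem corestrict_prod (u : SubmodFun S) (v : SubmodFun T) (h : u.prod v (left S T) ≠ ⊤) :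
    (u.prod v).corestrict h = v :=
  ext_apply fun E => by
    have hu : u Set.univ ≠ ⊤ := u.univ_ne_top'
    have : u Set.univ + v E - u Set.univ = v E := by
      refine withTop_add_right_cancel hu ?_
      rw [withTop_sub_add_cancel hu, add_comm]
    simpa [corestrict_apply, prod_apply, Set.preimage_image_eq _ Sum.inr_injective, v.empty']
      using this

theorem prod_left_ne_top (u : SubmodFun S) (v : SubmodFun T) : u.prod v (left S T) ≠ ⊤ := by
  simp [prod_apply, v.empty', u.univ_ne_top']

theorem preimage_sumCongr_left (e : S ≃ S') (f : T ≃ T') :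
    Equiv.sumCongr e f ⁻¹' left S' T' = left S T := by
  ext (x | x) <;> simp

theorem map_sumCongr_left (z : SubmodFun (S ⊕ T)) (e : S ≃ S') (f : T ≃ T') :
    z.map (Equiv.sumCongr e f) (left S' T') = z (left S T) := by
  rw [map_apply, preimage_sumCongr_left]

theorem restrict_map (z : SubmodFun (S ⊕ T)) (e : S ≃ S') (f : T ≃ T') (h : z (left S T) ≠ ⊤)
    (h' : z.map (Equiv.sumCongr e f) (left S' T') ≠ ⊤) :
    (z.map (Equiv.sumCongr e f)).restrict h' = (z.restrict h).map e :=
  ext_apply fun E => by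
    rw [restrict_apply, map_apply, map_apply, restrict_apply]
    congr 1
    ext (x | x) <;> simp

theorem corestrict_map (z : SubmodFun (S ⊕ T)) (e : S ≃ S') (f : T ≃ T') (h : z (left S T) ≠ ⊤)
    (h' : z.map (Equiv.sumCongr e f) (left S' T') ≠ ⊤) :
    (z.map (Equiv.sumCongr e f)).corestrict h' = (z.corestrict h).map f :=
  ext_apply fun E => by
    rw [corestrict_apply, map_apply, map_apply, map_apply, corestrict_apply,
      preimage_sumCongr_left]
    congr 2
    ext (x | x) <;> simp

section Coassoc

variable (z : SubmodFun ((R ⊕ S) ⊕ T))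

theorem map_sumAssoc_left :
    z.map (Equiv.sumAssoc R S T) (left R (S ⊕ T)) = z (Sum.inl '' left R S) := by
  rw [map_apply]
  congr 1
  ext ((x | x) | x) <;> simp

theorem map_sumAssoc_left_union :
    z.map (Equiv.sumAssoc R S T) (left R (S ⊕ T) ∪ Sum.inr '' left S T) =
      z (left (R ⊕ S) T) := by
  rw [map_apply]
  congr 1
  ext ((x | x) | x) <;> simp

variable {z} (h₁ : z (left (R ⊕ S) T) ≠ ⊤) (h₂ : z.restrict h₁ (left R S) ≠ ⊤)
  (k₁ : z.map (Equiv.sumAssoc R S T) (left R (S ⊕ T)) ≠ ⊤)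
  (k₂ : (z.map (Equiv.sumAssoc R S T)).corestrict k₁ (left S T) ≠ ⊤)

theorem restrict_restrict :
    (z.restrict h₁).restrict h₂ = (z.map (Equiv.sumAssoc R S T)).restrict k₁ :=
  ext_apply fun E => by
    rw [restrict_apply, restrict_apply, restrict_apply, map_apply]
    congr 1
    ext ((x | x) | x) <;> simp

theorem corestrict_restrict :
    (z.restrict h₁).corestrict h₂ =
      ((z.map (Equiv.sumAssoc R S T)).corestrict k₁).restrict k₂ :=
  ext_apply fun E => by
    rw [restrict_apply, corestrict_apply, corestrict_apply, restrict_apply, restrict_apply,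
      map_sumAssoc_left, map_apply]
    congr 2
    ext ((x | x) | x) <;> simp

theorem corestrict_corestrict :
    z.corestrict h₁ = ((z.map (Equiv.sumAssoc R S T)).corestrict k₁).corestrict k₂ :=
  ext_apply fun E => by
    rw [corestrict_apply, corestrict_apply, corestrict_apply, corestrict_apply,
      map_sumAssoc_left_union]
    have e : z.map (Equiv.sumAssoc R S T)
        (left R (S ⊕ T) ∪ Sum.inr '' (left S T ∪ Sum.inr '' E)) =
        z (left (R ⊕ S) T ∪ Sum.inr '' E) := by
      rw [map_apply]
      congr 1
      ext ((x | x) | x) <;> simp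
    rw [e]
    -- Subtraction on `WithTop ℝ` is handled by adding back finite terms on both sides.
    refine withTop_add_right_cancel (sub_ne_top h₁ k₁) ?_
    rw [withTop_sub_add_cancel (sub_ne_top h₁ k₁)]
    refine withTop_add_right_cancel k₁ ?_
    rw [add_assoc, withTop_sub_add_cancel k₁, withTop_sub_add_cancel h₁, withTop_sub_add_cancel k₁]

end Coassoc

section Exchange

variable (u : SubmodFun (A ⊕ B)) (v : SubmodFun (C ⊕ D))

theorem exchange_left :
    (u.prod v).map (Equiv.sumSumSumComm A B C D) (left (A ⊕ C) (B ⊕ D)) =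
      u (left A B) + v (left C D) := by
  rw [map_apply, prod_apply]
  congr 2 <;> ext (x | x) <;> simp

variable {u v} (hu : u (left A B) ≠ ⊤) (hv : v (left C D) ≠ ⊤)
  (h : (u.prod v).map (Equiv.sumSumSumComm A B C D) (left (A ⊕ C) (B ⊕ D)) ≠ ⊤)

theorem exchange_restrict :
    ((u.prod v).map (Equiv.sumSumSumComm A B C D)).restrict h =
      (u.restrict hu).prod (v.restrict hv) :=
  ext_apply fun E => by
    rw [restrict_apply, map_apply, prod_apply, prod_apply, restrict_apply, restrict_apply]
    congr 2 <;> ext (x | x) <;> simp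

theorem exchange_corestrict :
    ((u.prod v).map (Equiv.sumSumSumComm A B C D)).corestrict h =
      (u.corestrict hu).prod (v.corestrict hv) :=
  ext_apply fun E => by
    rw [corestrict_apply, prod_apply, corestrict_apply, corestrict_apply, exchange_left]
    have e : (u.prod v).map (Equiv.sumSumSumComm A B C D)
        (left (A ⊕ C) (B ⊕ D) ∪ Sum.inr '' E) =
        u (left A B ∪ Sum.inr '' (Sum.inl ⁻¹' E)) + v (left C D ∪ Sum.inr '' (Sum.inr ⁻¹' E)) := by
      rw [map_apply, prod_apply]
      congr 2 <;> ext (x | x) <;> simp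
    have huv := WithTop.add_ne_top.2 ⟨hu, hv⟩
    rw [e]
    refine withTop_add_right_cancel huv ?_
    rw [withTop_sub_add_cancel huv, add_add_add_comm, withTop_sub_add_cancel hu,
      withTop_sub_add_cancel hv]

end Exchange

theorem map_emptySum_symm_left (z : SubmodFun T) :
    z.map (Equiv.emptySum PEmpty.{u + 1} T).symm (left PEmpty T) = 0 := by
  rw [map_apply]
  convert z.empty'
  ext x
  simp

theorem corestrict_emptySum (z : SubmodFun T)
    (h : z.map (Equiv.emptySum PEmpty.{u + 1} T).symm (left PEmpty T) ≠ ⊤) :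
    (z.map (Equiv.emptySum PEmpty.{u + 1} T).symm).corestrict h = z :=
  ext_apply fun E => by
    refine withTop_add_right_cancel h ?_
    rw [corestrict_apply, withTop_sub_add_cancel h, map_emptySum_symm_left, map_apply, add_zero]
    congr 1
    ext x
    simp

theorem map_sumEmpty_symm_left (z : SubmodFun T) :
    z.map (Equiv.sumEmpty T PEmpty.{u + 1}).symm (left T PEmpty) ≠ ⊤ := by
  rw [map_apply]
  convert z.univ_ne_top'
  ext x
  simp

theorem restrict_sumEmpty (z : SubmodFun T)
    (h : z.map (Equiv.sumEmpty T PEmpty.{u + 1}).symm (left T PEmpty) ≠ ⊤) :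
    (z.map (Equiv.sumEmpty T PEmpty.{u + 1}).symm).restrict h = z :=
  ext_apply fun E => by
    rw [restrict_apply, map_apply]
    congr 1
    ext x
    simp

theorem eq_zero (z : SubmodFun PEmpty.{u + 1}) : z = zero := Subsingleton.elim _ _

end SubmodFun

/-! ### Linearization: the bimonoid axioms on basis functions, for `SM` and `MOD` at once. -/

/-- The Cauchy structure `H` on `F` is the linearization of that of the submodular functions with
property `p`, the vectors `b z` being a basis. -/
structure IsBased {F : Species.{u}} (H : CauchyOps F) (p : ∀ {I : Type u}, SubmodFun I → Prop)
    (b : ∀ {I : Type u} [Finite I], SubmodFun I → F.obj I) : Prop where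
  hom_ext : ∀ {I : Type u} [Finite I] {M : Type u} [AddCommGroup M] [Module ℝ M]
    {f g : F.obj I →ₗ[ℝ] M}, (∀ z, p z → f (b z) = g (b z)) → f = g
  form_ext : ∀ {I : Type u} [Finite I] {f g : F.obj I →ₗ[ℝ] ℝ},
    (∀ z, p z → f (b z) = g (b z)) → f = g
  p_map : ∀ {I J : Type u} (e : I ≃ J) {z : SubmodFun I}, p z → p (z.map e)
  p_zero : p SubmodFun.zero.{u}
  p_prod : ∀ {S T : Type u} {x : SubmodFun S} {y : SubmodFun T}, p x → p y → p (x.prod y)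
  p_restrict : ∀ {S T : Type u} {z : SubmodFun (S ⊕ T)} (h : z (SubmodFun.left S T) ≠ ⊤), p z →
    p (z.restrict h)
  p_corestrict : ∀ {S T : Type u} {z : SubmodFun (S ⊕ T)} (h : z (SubmodFun.left S T) ≠ ⊤), p z →
    p (z.corestrict h)
  p_face : ∀ {I : Type u} [Finite I] {z : SubmodFun I} {P : Preorder I} (h : Compatible z P),
    p z → p (face z P h)
  map_b : ∀ {I J : Type u} [Finite I] [Finite J] (e : I ≃ J) {z : SubmodFun I}, p z →
    F.map e (b z) = b (z.map e)
  mul_b : ∀ {S T : Type u} [Finite S] [Finite T] {x : SubmodFun S} {y : SubmodFun T}, p x → p y →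
    H.mul S T (b x ⊗ₜ b y) = b (x.prod y)
  one_eq : H.one = b SubmodFun.zero.{u}
  comul_b : ∀ {S T : Type u} [Finite S] [Finite T] {z : SubmodFun (S ⊕ T)}, p z →
    ∀ h : z (SubmodFun.left S T) ≠ ⊤, H.comul S T (b z) = b (z.restrict h) ⊗ₜ b (z.corestrict h)
  comul_b_of_eq_top : ∀ {S T : Type u} [Finite S] [Finite T] {z : SubmodFun (S ⊕ T)}, p z →
    z (SubmodFun.left S T) = ⊤ → H.comul S T (b z) = 0
  counit_b : ∀ {z : SubmodFun PEmpty.{u + 1}}, p z → H.counit (b z) = 1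

/-- The basis vectors of `SM`. -/
def smBasis {I : Type u} [Finite I] (z : SubmodFun I) : SM.obj I := Finsupp.single z (1 : ℝ)

open Classical in
/-- The basis vectors of `MOD`. -/
def modBasis {I : Type u} [Finite I] (z : SubmodFun I) : MOD.obj I :=
  -- The value `0` off the modular functions makes the family total, so that both bases are indexed
  -- by all submodular functions.
  if h : z.IsModular then Finsupp.single ⟨z, h⟩ (1 : ℝ) else 0

theorem modBasis_eq {I : Type u} [Finite I] {z : SubmodFun I} (h : z.IsModular) :
    modBasis z = Finsupp.single (⟨z, h⟩ : ModFun I) (1 : ℝ) := dif_pos h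

theorem SM_hom_ext {I : Type u} [Finite I] {M : Type*} [AddCommGroup M] [Module ℝ M]
    {f g : SM.obj I →ₗ[ℝ] M} (h : ∀ z, True → f (smBasis z) = g (smBasis z)) : f = g :=
  Finsupp.lhom_ext' fun z => LinearMap.ext_ring (h z trivial)

theorem MOD_hom_ext {I : Type u} [Finite I] {M : Type*} [AddCommGroup M] [Module ℝ M]
    {f g : MOD.obj I →ₗ[ℝ] M} (h : ∀ z : SubmodFun I, z.IsModular →
    f (modBasis z) = g (modBasis z)) : f = g :=
  Finsupp.lhom_ext' fun z => LinearMap.ext_ring <| by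
    have := h z.1 z.2
    rwa [modBasis_eq z.2] at this

theorem SM_isBased : IsBased SM.ops.{u} (fun _ => True) smBasis where
  hom_ext := SM_hom_ext
  form_ext := SM_hom_ext
  p_map _ _ _ := trivial
  p_zero := trivial
  p_prod _ _ := trivial
  p_restrict _ _ := trivial
  p_corestrict _ _ := trivial
  p_face _ _ := trivial
  map_b e z _ := by simp [smBasis]
  mul_b _ _ := by simp [smBasis, SM.ops]
  one_eq := rfl
  comul_b _ h := by simp [smBasis, SM.ops, h]
  comul_b_of_eq_top _ h := by simp [smBasis, SM.ops, h]
  counit_b _ := by simp [smBasis, SM.ops]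

theorem MOD_isBased : IsBased MOD.ops.{u} SubmodFun.IsModular modBasis where
  hom_ext := MOD_hom_ext
  form_ext := MOD_hom_ext
  p_map e _ h := h.map e
  p_zero := SubmodFun.isModular_zero
  p_prod hu hv := hu.prod hv
  p_restrict h hz := hz.restrict h
  p_corestrict h hz := hz.corestrict h
  p_face h hz := isModular_face hz _ h
  map_b e z hz := by simp [modBasis_eq hz, modBasis_eq (hz.map e), ModFun.map]
  mul_b hu hv := by simp [modBasis_eq hu, modBasis_eq hv, modBasis_eq (hu.prod hv), MOD.ops]
  one_eq := (modBasis_eq SubmodFun.isModular_zero).symm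
  comul_b hz h := by
    simp [modBasis_eq hz, modBasis_eq (hz.restrict h), modBasis_eq (hz.corestrict h), MOD.ops, h]
  comul_b_of_eq_top hz h := by simp [modBasis_eq hz, MOD.ops, h]
  counit_b hz := by simp [modBasis_eq hz, MOD.ops]

namespace IsBased

open SubmodFun

variable {F : Species.{u}} {H : CauchyOps F} {p : ∀ {I : Type u}, SubmodFun I → Prop}
  {b : ∀ {I : Type u} [Finite I], SubmodFun I → F.obj I}

theorem tensor_ext (L : IsBased H p b) {S T : Type u} [Finite S] [Finite T] {M : Type u}
    [AddCommGroup M] [Module ℝ M] {f g : F.obj S ⊗[ℝ] F.obj T →ₗ[ℝ] M}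
    (h : ∀ x y, p x → p y → f (b x ⊗ₜ b y) = g (b x ⊗ₜ b y)) : f = g :=
  TensorProduct.ext <| L.hom_ext fun x hx => L.hom_ext fun y hy => h x y hx hy

/-- `ℝ` does not lie in the universe of the targets allowed by `hom_ext`, so linear forms are
treated separately. -/
theorem tensor_form_ext (L : IsBased H p b) {S T : Type u} [Finite S] [Finite T]
    {f g : F.obj S ⊗[ℝ] F.obj T →ₗ[ℝ] ℝ}
    (h : ∀ x y, p x → p y → f (b x ⊗ₜ b y) = g (b x ⊗ₜ b y)) : f = g :=
  TensorProduct.ext' fun x y => LinearMap.congr_fun (f := f ∘ₗ (TensorProduct.mk ℝ _ _).flip y)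
    (g := g ∘ₗ (TensorProduct.mk ℝ _ _).flip y) (L.form_ext fun x' hx => LinearMap.congr_fun
      (f := f ∘ₗ TensorProduct.mk ℝ _ _ (b x')) (g := g ∘ₗ TensorProduct.mk ℝ _ _ (b x'))
      (L.form_ext fun y' hy => h x' y' hx hy) y) x

theorem isMonoid (L : IsBased H p b) : IsMonoid H where
  mul_natural S S' T T' _ _ _ _ e f := L.tensor_ext fun x y hx hy => by
    simp only [LinearMap.comp_apply, TensorProduct.map_tmul]
    rw [L.mul_b hx hy, L.map_b _ (L.p_prod hx hy), L.map_b e hx, L.map_b f hy,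
      L.mul_b (L.p_map e hx) (L.p_map f hy), map_prod]
  mul_assoc R S T _ _ _ := TensorProduct.ext <| L.tensor_ext fun x y hx hy =>
      L.hom_ext fun w hw => by
    change F.map _ (H.mul _ _ ((H.mul R S).rTensor _ ((b x ⊗ₜ b y) ⊗ₜ b w))) =
      H.mul _ _ ((H.mul S T).lTensor _ (b x ⊗ₜ (b y ⊗ₜ b w)))
    rw [LinearMap.rTensor_tmul, LinearMap.lTensor_tmul, L.mul_b hx hy, L.mul_b hy hw,
      L.mul_b (L.p_prod hx hy) hw, L.mul_b hx (L.p_prod hy hw),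
      L.map_b _ (L.p_prod (L.p_prod hx hy) hw), prod_assoc]
  one_mul T _ x := by
    have : F.map (Equiv.emptySum PEmpty.{u + 1} T) ∘ₗ H.mul PEmpty T ∘ₗ
        TensorProduct.mk ℝ _ _ H.one = LinearMap.id := L.hom_ext fun z hz => by
      simp only [LinearMap.comp_apply, TensorProduct.mk_apply, LinearMap.id_apply]
      rw [L.one_eq, L.mul_b L.p_zero hz, L.map_b _ (L.p_prod L.p_zero hz), zero_prod]
    exact LinearMap.congr_fun this x
  mul_one T _ x := by
    have : F.map (Equiv.sumEmpty T PEmpty.{u + 1}) ∘ₗ H.mul T PEmpty ∘ₗ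
        (TensorProduct.mk ℝ _ _).flip H.one = LinearMap.id := L.hom_ext fun z hz => by
      simp only [LinearMap.comp_apply, LinearMap.flip_apply, TensorProduct.mk_apply,
        LinearMap.id_apply]
      rw [L.one_eq, L.mul_b hz L.p_zero, L.map_b _ (L.p_prod hz L.p_zero), prod_zero]
    exact LinearMap.congr_fun this x

theorem isComonoid (L : IsBased H p b) : IsComonoid H where
  comul_natural S S' T T' _ _ _ _ e f := L.hom_ext fun z hz => by
    simp only [LinearMap.comp_apply]
    rw [L.map_b _ hz]
    have h' := map_sumCongr_left z e f
    have hz' := L.p_map (Equiv.sumCongr e f) hz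
    by_cases h : z (left S T) = ⊤
    · rw [L.comul_b_of_eq_top hz h, L.comul_b_of_eq_top hz' (h'.trans h), map_zero]
    · have h'' : z.map (Equiv.sumCongr e f) (left S' T') ≠ ⊤ := by rwa [h']
      rw [L.comul_b hz h, L.comul_b hz' h'', TensorProduct.map_tmul, L.map_b _ (L.p_restrict h hz),
        L.map_b _ (L.p_corestrict h hz), restrict_map z e f h, corestrict_map z e f h]
  comul_coassoc R S T _ _ _ := L.hom_ext fun z hz => by
    simp only [LinearMap.comp_apply]
    rw [L.map_b _ hz]
    have hz' := L.p_map (Equiv.sumAssoc R S T) hz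
    by_cases h₂' : z (Sum.inl '' left R S) = ⊤
    · rw [L.comul_b_of_eq_top hz' ((map_sumAssoc_left z).trans h₂'), map_zero]
      by_cases h₁ : z (left (R ⊕ S) T) = ⊤
      · rw [L.comul_b_of_eq_top hz h₁, map_zero, map_zero]
      · rw [L.comul_b hz h₁, LinearMap.rTensor_tmul, L.comul_b_of_eq_top (L.p_restrict h₁ hz) h₂',
          TensorProduct.zero_tmul, map_zero]
    · have k₁ : z.map (Equiv.sumAssoc R S T) (left R (S ⊕ T)) ≠ ⊤ := by
        rwa [map_sumAssoc_left]
      have hz'' := L.p_corestrict k₁ hz'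
      rw [L.comul_b hz' k₁, LinearMap.lTensor_tmul]
      by_cases h₁ : z (left (R ⊕ S) T) = ⊤
      -- Here `z` is finite on `R` but not on `R ⊔ S`: both sides vanish, the left at its outer
      -- coproduct and the right at its inner one.
      · have k₂ : (z.map (Equiv.sumAssoc R S T)).corestrict k₁ (left S T) = ⊤ := by
          rw [corestrict_apply, map_sumAssoc_left_union, h₁]
          exact (withTop_sub_eq_top_iff k₁).2 rfl
        rw [L.comul_b_of_eq_top hz h₁, L.comul_b_of_eq_top hz'' k₂, TensorProduct.tmul_zero,
          map_zero, map_zero]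
      · have k₂ : (z.map (Equiv.sumAssoc R S T)).corestrict k₁ (left S T) ≠ ⊤ := by
          rw [corestrict_apply, map_sumAssoc_left_union]
          exact sub_ne_top h₁ k₁
        have h₂ : z.restrict h₁ (left R S) ≠ ⊤ := h₂'
        rw [L.comul_b hz h₁, LinearMap.rTensor_tmul, L.comul_b (L.p_restrict h₁ hz) h₂,
          L.comul_b hz'' k₂, LinearEquiv.coe_coe, TensorProduct.assoc_tmul,
          restrict_restrict h₁ h₂ k₁, corestrict_restrict h₁ h₂ k₁ k₂,
          corestrict_corestrict h₁ k₁ k₂]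
  counit_comul T _ x := by
    have : (TensorProduct.lid ℝ (F.obj T)).toLinearMap ∘ₗ H.counit.rTensor (F.obj T) ∘ₗ
        H.comul PEmpty T ∘ₗ F.map (Equiv.emptySum PEmpty.{u + 1} T).symm =
        LinearMap.id := L.hom_ext fun z hz => by
      have h : z.map (Equiv.emptySum PEmpty.{u + 1} T).symm (left PEmpty T) ≠ ⊤ := by
        rw [map_emptySum_symm_left]; exact WithTop.zero_ne_top
      have hz' := L.p_map (Equiv.emptySum PEmpty.{u + 1} T).symm hz
      simp only [LinearMap.comp_apply, LinearEquiv.coe_coe, LinearMap.id_apply]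
      rw [L.map_b _ hz, L.comul_b hz' h, LinearMap.rTensor_tmul, L.counit_b (L.p_restrict h hz'),
        TensorProduct.lid_tmul, one_smul, corestrict_emptySum]
    exact LinearMap.congr_fun this x
  comul_counit T _ x := by
    have : (TensorProduct.rid ℝ (F.obj T)).toLinearMap ∘ₗ H.counit.lTensor (F.obj T) ∘ₗ
        H.comul T PEmpty ∘ₗ F.map (Equiv.sumEmpty T PEmpty.{u + 1}).symm =
        LinearMap.id := L.hom_ext fun z hz => by
      have h := map_sumEmpty_symm_left z
      have hz' := L.p_map (Equiv.sumEmpty T PEmpty.{u + 1}).symm hz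
      simp only [LinearMap.comp_apply, LinearEquiv.coe_coe, LinearMap.id_apply]
      rw [L.map_b _ hz, L.comul_b hz' h, LinearMap.lTensor_tmul, L.counit_b (L.p_corestrict h hz'),
        TensorProduct.rid_tmul, one_smul, restrict_sumEmpty]
    exact LinearMap.congr_fun this x

theorem isBimonoid (L : IsBased H p b) : IsBimonoid H where
  isMonoid := L.isMonoid
  isComonoid := L.isComonoid
  comul_mul A B C D _ _ _ _ := L.tensor_ext fun x y hx hy => by
    simp only [LinearMap.comp_apply, TensorProduct.map_tmul, LinearEquiv.coe_coe]
    have hl := exchange_left x y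
    have hxy := L.p_prod hx hy
    rw [L.mul_b hx hy, L.map_b _ hxy]
    replace hxy := L.p_map (Equiv.sumSumSumComm A B C D) hxy
    by_cases hu : x (left A B) = ⊤
    · rw [hu, top_add] at hl
      rw [L.comul_b_of_eq_top hx hu, L.comul_b_of_eq_top hxy hl, TensorProduct.zero_tmul, map_zero,
        map_zero]
    by_cases hv : y (left C D) = ⊤
    · rw [hv, add_top] at hl
      rw [L.comul_b_of_eq_top hy hv, L.comul_b_of_eq_top hxy hl, TensorProduct.tmul_zero, map_zero,
        map_zero]
    have h : (x.prod y).map (Equiv.sumSumSumComm A B C D) (left (A ⊕ C) (B ⊕ D)) ≠ ⊤ := by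
      rw [hl]; exact WithTop.add_ne_top.2 ⟨hu, hv⟩
    rw [L.comul_b hxy h, L.comul_b hx hu, L.comul_b hy hv,
      TensorProduct.tensorTensorTensorComm_tmul, TensorProduct.map_tmul,
      L.mul_b (L.p_restrict hu hx) (L.p_restrict hv hy),
      L.mul_b (L.p_corestrict hu hx) (L.p_corestrict hv hy),
      exchange_restrict hu hv, exchange_corestrict hu hv]
  comul_one := by
    have h : zero.{u}.map (Equiv.emptySum PEmpty.{u + 1} PEmpty.{u + 1}).symm
        (left PEmpty PEmpty) ≠ ⊤ := by
      rw [map_emptySum_symm_left]; exact WithTop.zero_ne_top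
    rw [L.one_eq, L.map_b _ L.p_zero, L.comul_b (L.p_map _ L.p_zero) h]
    congr 2
    exact Subsingleton.elim _ _
  counit_mul x y := by
    have : H.counit ∘ₗ F.map (Equiv.emptySum PEmpty.{u + 1} PEmpty.{u + 1}) ∘ₗ
        H.mul PEmpty PEmpty = LinearMap.mul' ℝ ℝ ∘ₗ
          TensorProduct.map H.counit H.counit := L.tensor_form_ext fun x y hx hy => by
      simp only [LinearMap.comp_apply, TensorProduct.map_tmul, LinearMap.mul'_apply]
      rw [L.mul_b hx hy, L.map_b _ (L.p_prod hx hy), L.counit_b hx, L.counit_b hy,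
        L.counit_b (L.p_map _ (L.p_prod hx hy)), mul_one]
    exact LinearMap.congr_fun this (x ⊗ₜ y)
  counit_one := by rw [L.one_eq, L.counit_b L.p_zero]

end IsBased

/-! ### Single terms of convolution products, under relabelling and reassociation. -/

section Convolution

variable {F G : Species.{u}}

/-- The term of a convolution product at a decomposition `S ⊔ T = I`. -/
def convTerm (H : CauchyOps F) (K : CauchyOps G) {S T I : Type u} [Finite S] [Finite T] [Finite I]
    (e : S ⊕ T ≃ I) (f : F.obj S →ₗ[ℝ] G.obj S) (g : F.obj T →ₗ[ℝ] G.obj T) :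
    F.obj I →ₗ[ℝ] G.obj I :=
  G.map e ∘ₗ K.mul S T ∘ₗ TensorProduct.map f g ∘ₗ H.comul S T ∘ₗ F.map e.symm

theorem Species.map_map (F : Species.{u}) {I J K : Type u} [Finite I] [Finite J] [Finite K]
    (e : I ≃ J) (f : J ≃ K) (x : F.obj I) : F.map f (F.map e x) = F.map (e.trans f) x := by
  rw [F.map_trans]; rfl

theorem Species.map_refl_apply (F : Species.{u}) {I : Type u} [Finite I] (x : F.obj I) :
    F.map (Equiv.refl I) x = x := by
  rw [F.map_refl]; rfl

variable {H : CauchyOps F} {K : CauchyOps G}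

theorem IsMonoid.map_mul_apply (hK : IsMonoid K) {S S' T T' : Type u} [Finite S] [Finite S']
    [Finite T] [Finite T'] (e : S ≃ S') (f : T ≃ T') (x : G.obj S ⊗[ℝ] G.obj T) :
    G.map (Equiv.sumCongr e f) (K.mul S T x) =
      K.mul S' T' (TensorProduct.map (G.map e) (G.map f) x) :=
  LinearMap.congr_fun (hK.mul_natural S S' T T' e f) x

theorem IsComonoid.comul_map_apply (hH : IsComonoid H) {S S' T T' : Type u} [Finite S] [Finite S']
    [Finite T] [Finite T'] (e : S ≃ S') (f : T ≃ T') (x : F.obj (S ⊕ T)) :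
    H.comul S' T' (F.map (Equiv.sumCongr e f) x) =
      TensorProduct.map (F.map e) (F.map f) (H.comul S T x) :=
  LinearMap.congr_fun (hH.comul_natural S S' T T' e f) x

theorem tensor_map_map {M M' M'' N N' N'' : Type*} [AddCommGroup M] [AddCommGroup M']
    [AddCommGroup M''] [AddCommGroup N] [AddCommGroup N'] [AddCommGroup N''] [Module ℝ M]
    [Module ℝ M'] [Module ℝ M''] [Module ℝ N] [Module ℝ N'] [Module ℝ N'']
    (f : M →ₗ[ℝ] M') (f' : M' →ₗ[ℝ] M'') (g : N →ₗ[ℝ] N') (g' : N' →ₗ[ℝ] N'')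
    (x : M ⊗[ℝ] N) : TensorProduct.map f' g' (TensorProduct.map f g x) =
      TensorProduct.map (f' ∘ₗ f) (g' ∘ₗ g) x := by
  rw [TensorProduct.map_comp]; rfl

/-- Naturality of product and coproduct moves the relabelling through the term. It replaces
equalities of subtypes, which would need casts, by bijections. -/
theorem convTerm_congr (hH : IsComonoid H) (hK : IsMonoid K) {S T S' T' I : Type u} [Finite S]
    [Finite T] [Finite S'] [Finite T'] [Finite I] {e : S ⊕ T ≃ I} {e' : S' ⊕ T' ≃ I}
    (a : S ≃ S') (c : T ≃ T') (h : (Equiv.sumCongr a c).trans e' = e)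
    {f : F.obj S →ₗ[ℝ] G.obj S} {g : F.obj T →ₗ[ℝ] G.obj T}
    {f' : F.obj S' →ₗ[ℝ] G.obj S'} {g' : F.obj T' →ₗ[ℝ] G.obj T'}
    (hf : f' ∘ₗ F.map a = G.map a ∘ₗ f) (hg : g' ∘ₗ F.map c = G.map c ∘ₗ g) :
    convTerm H K e f g = convTerm H K e' f' g' := by
  subst h
  ext x
  simp only [convTerm, LinearMap.comp_apply]
  rw [← G.map_map, hK.map_mul_apply, tensor_map_map, ← hf, ← hg, ← tensor_map_map,
    ← hH.comul_map_apply, F.map_map]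
  have hs : ((Equiv.sumCongr a c).trans e').symm.trans (Equiv.sumCongr a c) = e'.symm := by
    ext y
    simp
  rw [hs]

theorem map_comp_convTerm {S T I J : Type u} [Finite S] [Finite T] [Finite I] [Finite J]
    (e : S ⊕ T ≃ I) (k : I ≃ J) (f : F.obj S →ₗ[ℝ] G.obj S) (g : F.obj T →ₗ[ℝ] G.obj T) :
    G.map k ∘ₗ convTerm H K e f g = convTerm H K (e.trans k) f g ∘ₗ F.map k := by
  ext x
  simp only [convTerm, LinearMap.comp_apply]
  rw [G.map_map, F.map_map]
  congr 5
  congr 1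
  ext y
  simp

/-- Both summands map into the corresponding ones and `e`, `e'` are bijective, so the two maps of
summands are forced to be bijective. -/
theorem exists_sumCongr {S T S' T' I : Type u} (e : S ⊕ T ≃ I) (e' : S' ⊕ T' ≃ I)
    (h1 : ∀ s, ∃ s', e' (Sum.inl s') = e (Sum.inl s))
    (h2 : ∀ t, ∃ t', e' (Sum.inr t') = e (Sum.inr t)) :
    ∃ (a : S ≃ S') (c : T ≃ T'), (Equiv.sumCongr a c).trans e' = e := by
  choose a ha using h1
  choose c hc using h2
  have hab : Function.Bijective a := by
    refine ⟨fun x y hxy => ?_, fun s' => ?_⟩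
    · have := ha x
      rw [hxy, ha y] at this
      exact (Sum.inl_injective (e.injective this)).symm
    · rcases hs : e.symm (e' (Sum.inl s')) with s | t
      · refine ⟨s, Sum.inl_injective (e'.injective ?_)⟩
        rw [ha s, ← hs, e.apply_symm_apply]
      · rw [e.symm_apply_eq, ← hc t] at hs
        cases e'.injective hs
  have hcb : Function.Bijective c := by
    refine ⟨fun x y hxy => ?_, fun t' => ?_⟩
    · have := hc x
      rw [hxy, hc y] at this
      exact (Sum.inr_injective (e.injective this)).symm
    · rcases hs : e.symm (e' (Sum.inr t')) with s | t
      · rw [e.symm_apply_eq, ← ha s] at hs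
        cases e'.injective hs
      · refine ⟨t, Sum.inr_injective (e'.injective ?_)⟩
        rw [hc t, ← hs, e.apply_symm_apply]
  refine ⟨Equiv.ofBijective a hab, Equiv.ofBijective c hcb, ?_⟩
  ext (x | x)
  · exact ha x
  · exact hc x

/-- Terms of convolution products of natural families only depend on the decomposition. -/
theorem convTerm_eq_of_range (hH : IsComonoid H) (hK : IsMonoid K) {f g : Family F G}
    (hf : IsSpeciesMorphism f) (hg : IsSpeciesMorphism g) {S T S' T' I : Type u} [Finite S]
    [Finite T] [Finite S'] [Finite T'] [Finite I] (e : S ⊕ T ≃ I) (e' : S' ⊕ T' ≃ I)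
    (h1 : ∀ s, ∃ s', e' (Sum.inl s') = e (Sum.inl s))
    (h2 : ∀ t, ∃ t', e' (Sum.inr t') = e (Sum.inr t)) :
    convTerm H K e (f S) (g T) = convTerm H K e' (f S') (g T') := by
  obtain ⟨a, c, h⟩ := exists_sumCongr e e' h1 h2
  exact convTerm_congr hH hK a c h (hf _ _ a) (hg _ _ c)

theorem convTerm_assoc (hH : IsComonoid H) (hK : IsMonoid K) {A B C I : Type u} [Finite A]
    [Finite B] [Finite C] [Finite I] (e : A ⊕ (B ⊕ C) ≃ I) (f : F.obj A →ₗ[ℝ] G.obj A)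
    (g : F.obj B →ₗ[ℝ] G.obj B) (h : F.obj C →ₗ[ℝ] G.obj C) :
    convTerm H K ((Equiv.sumAssoc A B C).trans e) (convTerm H K (Equiv.refl _) f g) h =
      convTerm H K e f (convTerm H K (Equiv.refl _) g h) := by
  have hl : convTerm H K (Equiv.refl _) f g = K.mul A B ∘ₗ TensorProduct.map f g ∘ₗ
      H.comul A B := by
    ext x
    simp [convTerm, Species.map_refl_apply]
  have hr : convTerm H K (Equiv.refl _) g h = K.mul B C ∘ₗ TensorProduct.map g h ∘ₗ
      H.comul B C := by
    ext x
    simp [convTerm, Species.map_refl_apply]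
  have e1 : TensorProduct.map (K.mul A B ∘ₗ TensorProduct.map f g ∘ₗ H.comul A B) h =
      (K.mul A B).rTensor (G.obj C) ∘ₗ TensorProduct.map (TensorProduct.map f g) h ∘ₗ
        (H.comul A B).rTensor (F.obj C) :=
    TensorProduct.ext' fun x y => rfl
  have e2 : TensorProduct.map f (K.mul B C ∘ₗ TensorProduct.map g h ∘ₗ H.comul B C) =
      (K.mul B C).lTensor (G.obj A) ∘ₗ TensorProduct.map f (TensorProduct.map g h) ∘ₗ
        (H.comul B C).lTensor (F.obj A) :=
    TensorProduct.ext' fun x y => rfl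
  have e3 : ∀ x, TensorProduct.map f (TensorProduct.map g h)
      (TensorProduct.assoc ℝ (F.obj A) (F.obj B) (F.obj C) x) =
      TensorProduct.assoc ℝ (G.obj A) (G.obj B) (G.obj C)
        (TensorProduct.map (TensorProduct.map f g) h x) := fun x =>
    LinearMap.congr_fun (TensorProduct.ext_threefold
      (g := TensorProduct.map f (TensorProduct.map g h) ∘ₗ
        (TensorProduct.assoc ℝ (F.obj A) (F.obj B) (F.obj C)).toLinearMap)
      (h := (TensorProduct.assoc ℝ (G.obj A) (G.obj B) (G.obj C)).toLinearMap ∘ₗ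
        TensorProduct.map (TensorProduct.map f g) h) fun _ _ _ => rfl) x
  ext x
  have hm := fun y => LinearMap.congr_fun (hK.mul_assoc A B C) y
  have hc := fun y => LinearMap.congr_fun (hH.comul_coassoc A B C) y
  simp only [LinearMap.comp_apply, LinearEquiv.coe_coe] at hm hc
  rw [hl, hr]
  simp only [convTerm, e1, e2, LinearMap.comp_apply]
  have hx : F.map e.symm x =
      F.map (Equiv.sumAssoc A B C) (F.map ((Equiv.sumAssoc A B C).trans e).symm x) := by
    rw [F.map_map]
    congr 2
    ext y
    simp
  rw [hx, ← hc, e3, ← hm, G.map_map]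

/-- The hypotheses say that the two bracketings cut `I` into the same three blocks. Flattening each
to a decomposition into three summands reduces the claim to `convTerm_assoc` and a relabelling. -/
theorem convTerm_convTerm (hH : IsComonoid H) (hK : IsMonoid K) {f g h : Family F G}
    (hf : IsSpeciesMorphism f) (hg : IsSpeciesMorphism g) (hh : IsSpeciesMorphism h)
    {A B X C A' B' C' Y I : Type u} [Finite A] [Finite B] [Finite X] [Finite C] [Finite A']
    [Finite B'] [Finite C'] [Finite Y] [Finite I] (e : X ⊕ C ≃ I) (e₁ : A ⊕ B ≃ X)
    (e' : A' ⊕ Y ≃ I) (e₂ : B' ⊕ C' ≃ Y)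
    (h1 : ∀ x, ∃ x', e' (Sum.inl x') = e (Sum.inl (e₁ (Sum.inl x))))
    (h2 : ∀ x, ∃ x', e' (Sum.inr (e₂ (Sum.inl x'))) = e (Sum.inl (e₁ (Sum.inr x))))
    (h3 : ∀ x, ∃ x', e' (Sum.inr (e₂ (Sum.inr x'))) = e (Sum.inr x)) :
    convTerm H K e (convTerm H K e₁ (f A) (g B)) (h C) =
      convTerm H K e' (f A') (convTerm H K e₂ (g B') (h C')) := by
  have s1 : convTerm H K ((Equiv.sumCongr e₁ (Equiv.refl C)).trans e)
      (convTerm H K (Equiv.refl _) (f A) (g B)) (h C) =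
      convTerm H K e (convTerm H K e₁ (f A) (g B)) (h C) := by
    refine convTerm_congr hH hK e₁ (Equiv.refl C) rfl ?_ ?_
    · rw [map_comp_convTerm]; rfl
    · rw [F.map_refl, G.map_refl]; rfl
  have s2 : convTerm H K ((Equiv.sumCongr (Equiv.refl A') e₂).trans e') (f A')
      (convTerm H K (Equiv.refl _) (g B') (h C')) =
      convTerm H K e' (f A') (convTerm H K e₂ (g B') (h C')) := by
    refine convTerm_congr hH hK (Equiv.refl A') e₂ rfl ?_ ?_
    · rw [F.map_refl, G.map_refl]; rfl
    · rw [map_comp_convTerm]; rfl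
  rw [← s1, ← s2, ← convTerm_assoc hH hK]
  set E := (Equiv.sumCongr e₁ (Equiv.refl C)).trans e
  set E' := (Equiv.sumAssoc A' B' C').trans ((Equiv.sumCongr (Equiv.refl A') e₂).trans e')
  obtain ⟨a, c, hac⟩ := exists_sumCongr E E'
    (by
      rintro (x | x)
      · obtain ⟨x', hx'⟩ := h1 x
        exact ⟨Sum.inl x', hx'⟩
      · obtain ⟨x', hx'⟩ := h2 x
        exact ⟨Sum.inr x', hx'⟩)
    (fun x => by
      obtain ⟨x', hx'⟩ := h3 x
      exact ⟨x', hx'⟩)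
  have hae : ∀ x, E' (Sum.inl (a x)) = E (Sum.inl x) := fun x => by rw [← hac]; rfl
  refine convTerm_congr hH hK a c hac ?_ (hh _ _ c)
  rw [map_comp_convTerm]
  congr 1
  symm
  refine convTerm_eq_of_range hH hK hf hg _ _ (fun x => ?_) (fun x => ?_)
  · obtain ⟨x', hx'⟩ := h1 x
    exact ⟨x', Sum.inl_injective (E'.injective (Eq.trans hx' (hae _).symm))⟩
  · obtain ⟨x', hx'⟩ := h2 x
    exact ⟨x', Sum.inl_injective (E'.injective (Eq.trans hx' (hae _).symm))⟩

theorem convTerm_emptySum (hH : IsComonoid H) (hK : IsMonoid K) {I : Type u} [Finite I]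
    (f : F.obj I →ₗ[ℝ] G.obj I) : convTerm H K (Equiv.emptySum PEmpty.{u + 1} I)
      (H.counit.smulRight K.one) f = f := by
  have e1 : ∀ y, TensorProduct.map (H.counit.smulRight K.one) f y =
      K.one ⊗ₜ[ℝ] f (TensorProduct.lid ℝ (F.obj I) (H.counit.rTensor (F.obj I) y)) := fun y =>
    LinearMap.congr_fun (f := TensorProduct.map (H.counit.smulRight K.one) f)
      (g := TensorProduct.mk ℝ _ _ K.one ∘ₗ f ∘ₗ (TensorProduct.lid ℝ (F.obj I)).toLinearMap ∘ₗ
        H.counit.rTensor (F.obj I)) (TensorProduct.ext' fun a b => by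
          simp [TensorProduct.smul_tmul]) y
  ext x
  simp only [convTerm, LinearMap.comp_apply]
  rw [e1, hH.counit_comul, hK.one_mul]

theorem convTerm_sumEmpty (hH : IsComonoid H) (hK : IsMonoid K) {I : Type u} [Finite I]
    (f : F.obj I →ₗ[ℝ] G.obj I) : convTerm H K (Equiv.sumEmpty I PEmpty.{u + 1})
      f (H.counit.smulRight K.one) = f := by
  have e1 : ∀ y, TensorProduct.map f (H.counit.smulRight K.one) y =
      f (TensorProduct.rid ℝ (F.obj I) (H.counit.lTensor (F.obj I) y)) ⊗ₜ[ℝ] K.one := fun y =>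
    LinearMap.congr_fun (f := TensorProduct.map f (H.counit.smulRight K.one))
      (g := (TensorProduct.mk ℝ _ _).flip K.one ∘ₗ f ∘ₗ
        (TensorProduct.rid ℝ (F.obj I)).toLinearMap ∘ₗ
        H.counit.lTensor (F.obj I)) (TensorProduct.ext' fun a b => by
          simp) y
  ext x
  simp only [convTerm, LinearMap.comp_apply]
  rw [e1, hH.comul_counit, hK.mul_one]

theorem convTerm_zero_left {S T I : Type u} [Finite S] [Finite T] [Finite I] (e : S ⊕ T ≃ I)
    (g : F.obj T →ₗ[ℝ] G.obj T) : convTerm H K e 0 g = 0 := by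
  simp [convTerm]

theorem convTerm_zero_right {S T I : Type u} [Finite S] [Finite T] [Finite I] (e : S ⊕ T ≃ I)
    (f : F.obj S →ₗ[ℝ] G.obj S) : convTerm H K e f 0 = 0 := by
  simp [convTerm]

/-- `convTerm` as a bilinear map. -/
def convTermBilin (H : CauchyOps F) (K : CauchyOps G) {S T I : Type u} [Finite S] [Finite T]
    [Finite I] (e : S ⊕ T ≃ I) :
    (F.obj S →ₗ[ℝ] G.obj S) →ₗ[ℝ] (F.obj T →ₗ[ℝ] G.obj T) →ₗ[ℝ] (F.obj I →ₗ[ℝ] G.obj I) :=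
  LinearMap.mk₂ ℝ (convTerm H K e)
    (fun f f' g => by
      simp only [convTerm, TensorProduct.map_add_left, LinearMap.add_comp, LinearMap.comp_add])
    (fun r f g => by
      simp only [convTerm, TensorProduct.map_smul_left, LinearMap.smul_comp, LinearMap.comp_smul])
    (fun f g g' => by
      simp only [convTerm, TensorProduct.map_add_right, LinearMap.add_comp, LinearMap.comp_add])
    (fun r f g => by
      simp only [convTerm, TensorProduct.map_smul_right, LinearMap.smul_comp, LinearMap.comp_smul])

theorem convTermBilin_apply {S T I : Type u} [Finite S] [Finite T] [Finite I] (e : S ⊕ T ≃ I)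
    (f : F.obj S →ₗ[ℝ] G.obj S) (g : F.obj T →ₗ[ℝ] G.obj T) :
    convTermBilin H K e f g = convTerm H K e f g := rfl

end Convolution

/-! ### Associativity of convolution, Takeuchi's antipode and its preservation by morphisms. -/

section Antipode

open Classical

variable {F G : Species.{u}} {H : CauchyOps F} {K : CauchyOps G}

theorem comp_sum {ι M N Q : Type*} [AddCommGroup M] [AddCommGroup N] [AddCommGroup Q] [Module ℝ M]
    [Module ℝ N] [Module ℝ Q] (s : Finset ι) (g : N →ₗ[ℝ] Q) (f : ι → M →ₗ[ℝ] N) :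
    g ∘ₗ ∑ i ∈ s, f i = ∑ i ∈ s, g ∘ₗ f i := by
  ext x
  simp

theorem sum_comp {ι M N Q : Type*} [AddCommGroup M] [AddCommGroup N] [AddCommGroup Q] [Module ℝ M]
    [Module ℝ N] [Module ℝ Q] (s : Finset ι) (g : ι → N →ₗ[ℝ] Q) (f : M →ₗ[ℝ] N) :
    (∑ i ∈ s, g i) ∘ₗ f = ∑ i ∈ s, g i ∘ₗ f := by
  ext x
  simp

theorem convolution_eq (H : CauchyOps F) (f g : Family F F) (I : Type u) [Finite I]
    [Fintype (Set I)] : convolution H f g I =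
      ∑ S : Set I, convTerm H H (Equiv.Set.sumCompl S) (f ↥S) (g ↥Sᶜ) := by
  simp only [convolution]
  congr 1
  congr 1
  exact Subsingleton.elim _ _

theorem IsSpeciesMorphism.convolution (hH : IsComonoid H) (hK : IsMonoid H) {f g : Family F F}
    (hf : IsSpeciesMorphism f) (hg : IsSpeciesMorphism g) :
    IsSpeciesMorphism (convolution H f g) := by
  intro I J _ _ e
  let _ : Fintype (Set I) := Fintype.ofFinite _
  let _ : Fintype (Set J) := Fintype.ofFinite _
  rw [convolution_eq, convolution_eq, comp_sum, sum_comp]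
  symm
  refine Fintype.sum_equiv (Equiv.Set.congr e) _ _ fun S => ?_
  rw [map_comp_convTerm]
  congr 1
  refine convTerm_eq_of_range hH hK hf hg _ _ ?_ ?_
  · rintro ⟨x, hx⟩
    exact ⟨⟨e x, x, hx, rfl⟩, rfl⟩
  · rintro ⟨x, hx⟩
    refine ⟨⟨e x, ?_⟩, rfl⟩
    rintro ⟨y, hy, hxy⟩
    exact hx (e.injective hxy ▸ hy)

/-- Chains `R ⊆ S ⊆ I`, described from the top or from the bottom. -/
def chainEquiv (I : Type u) : (Σ S : Set I, Set ↥S) ≃ (Σ R : Set I, Set ↥Rᶜ) where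
  toFun x := ⟨Subtype.val '' x.2, {y | (y : I) ∈ x.1}⟩
  invFun x := ⟨x.1 ∪ Subtype.val '' x.2, {y | (y : I) ∈ x.1}⟩
  left_inv := by
    rintro ⟨S, R⟩
    have h : Subtype.val '' R ∪ Subtype.val '' {y : ↥(Subtype.val '' R)ᶜ | (y : I) ∈ S} = S := by
      ext x
      constructor
      · rintro (⟨y, _, rfl⟩ | ⟨y, hy, rfl⟩)
        exacts [y.2, hy]
      · intro hx
        by_cases h : x ∈ Subtype.val '' R
        exacts [Or.inl h, Or.inr ⟨⟨x, h⟩, hx, rfl⟩]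
    refine Sigma.ext h ?_
    refine HEq.trans (b := {y : ↥S | (y : I) ∈ Subtype.val '' R}) ?_ ?_
    · exact congr_arg_heq (fun T : Set I => {y : ↥T | (y : I) ∈ Subtype.val '' R}) h
    · refine heq_of_eq (Set.ext fun y => ?_)
      simp
  right_inv := by
    rintro ⟨R, Q⟩
    have h : Subtype.val '' {y : ↥(R ∪ Subtype.val '' Q) | (y : I) ∈ R} = R := by
      ext x
      constructor
      · rintro ⟨y, hy, rfl⟩
        exact hy
      · exact fun hx => ⟨⟨x, Or.inl hx⟩, hx, rfl⟩
    refine Sigma.ext h ?_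
    refine HEq.trans (b := {y : ↥Rᶜ | (y : I) ∈ R ∪ Subtype.val '' Q}) ?_ ?_
    · exact congr_arg_heq (fun T : Set I => {y : ↥Tᶜ | (y : I) ∈ R ∪ Subtype.val '' Q}) h
    · refine heq_of_eq (Set.ext fun y => ?_)
      have := y.2
      simp only [Set.mem_compl_iff] at this
      simp [this]

/-- Bilinearity expands both sides over chains `R ⊆ S ⊆ I`; `chainEquiv` matches the indices and
`convTerm_convTerm` the terms. -/
theorem convolution_assoc (hH : IsComonoid H) (hK : IsMonoid H) {f g h : Family F F}
    (hf : IsSpeciesMorphism f) (hg : IsSpeciesMorphism g) (hh : IsSpeciesMorphism h) (I : Type u)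
    [Finite I] :
    convolution H (convolution H f g) h I = convolution H f (convolution H g h) I := by
  let _ : ∀ X : Set I, Fintype (Set ↥X) := fun _ => Fintype.ofFinite _
  let _ : Fintype (Set I) := Fintype.ofFinite _
  have e1 : convolution H (convolution H f g) h I = ∑ S : Set I, ∑ R : Set ↥S,
      convTerm H H (Equiv.Set.sumCompl S) (convTerm H H (Equiv.Set.sumCompl R) (f ↥R) (g ↥Rᶜ))
        (h ↥Sᶜ) := by
    rw [convolution_eq]
    refine Finset.sum_congr rfl fun S _ => ?_
    rw [convolution_eq, ← convTermBilin_apply, map_sum, LinearMap.sum_apply]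
    rfl
  have e2 : convolution H f (convolution H g h) I = ∑ R : Set I, ∑ Q : Set ↥Rᶜ,
      convTerm H H (Equiv.Set.sumCompl R) (f ↥R)
        (convTerm H H (Equiv.Set.sumCompl Q) (g ↥Q) (h ↥Qᶜ)) := by
    rw [convolution_eq]
    refine Finset.sum_congr rfl fun S _ => ?_
    rw [convolution_eq, ← convTermBilin_apply, map_sum]
    rfl
  rw [e1, e2, ← Fintype.sum_sigma', ← Fintype.sum_sigma']
  refine Fintype.sum_equiv (chainEquiv I) _ _ ?_
  rintro ⟨S, R⟩
  refine convTerm_convTerm hH hK hf hg hh _ _ _ _ ?_ ?_ ?_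
  · rintro ⟨x, hx⟩
    exact ⟨⟨x, x, hx, rfl⟩, rfl⟩
  · rintro ⟨x, hx⟩
    refine ⟨⟨⟨x, ?_⟩, x.2⟩, rfl⟩
    rintro ⟨y, hy, hxy⟩
    exact hx (Subtype.ext hxy ▸ hy)
  · rintro ⟨x, hx⟩
    refine ⟨⟨⟨x, ?_⟩, hx⟩, rfl⟩
    rintro ⟨y, hy, rfl⟩
    exact hx y.2

/-- Connectedness: the unit and the counit are inverse at the empty set. -/
def IsConnected (H : CauchyOps F) : Prop := ∀ x, H.counit x • H.one = x

theorem unitCounit_of_isEmpty (hc : IsConnected H) (I : Type u) [Finite I] [h : IsEmpty I] :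
    unitCounit H I = LinearMap.id := by
  ext x
  simp only [unitCounit, h, dif_pos, LinearMap.comp_apply, LinearMap.smulRight_apply,
    LinearMap.id_apply]
  rw [hc, F.map_map, Equiv.self_trans_symm, F.map_refl_apply]

theorem unitCounit_of_not_isEmpty (I : Type u) [Finite I] (h : ¬ IsEmpty I) :
    unitCounit H I = 0 := by
  simp [unitCounit, h]

theorem IsSpeciesMorphism.unitCounit (hc : IsConnected H) : IsSpeciesMorphism (unitCounit H) := by
  intro I J _ _ e
  by_cases h : IsEmpty I
  · have : IsEmpty J := e.symm.isEmpty
    rw [unitCounit_of_isEmpty hc, unitCounit_of_isEmpty hc]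
    rfl
  · have : ¬ IsEmpty J := fun _ => h e.isEmpty
    rw [unitCounit_of_not_isEmpty _ h, unitCounit_of_not_isEmpty _ this]
    simp

theorem isSpeciesMorphism_id : IsSpeciesMorphism (fun _ _ => LinearMap.id : Family F F) :=
  fun _ _ _ _ _ => rfl

theorem isSpeciesMorphism_sub {f g : Family F F} (hf : IsSpeciesMorphism f)
    (hg : IsSpeciesMorphism g) : IsSpeciesMorphism (fun I _ => f I - g I) := by
  intro I J _ _ e
  rw [LinearMap.sub_comp, LinearMap.comp_sub, hf, hg]

/-- The condition on `f` at the empty set makes the block `∅` contribute only the unit and counit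
laws. -/
theorem convTerm_sumCompl_empty (hH : IsComonoid H) (hK : IsMonoid K) {f g : Family F G}
    (hg : IsSpeciesMorphism g) (hf : IsSpeciesMorphism f)
    (hf' : f PEmpty = H.counit.smulRight K.one) (I : Type u) [Finite I]
    [DecidablePred (· ∈ (∅ : Set I))] :
    convTerm H K (Equiv.Set.sumCompl (∅ : Set I)) (f ↥(∅ : Set I)) (g ↥(∅ : Set I)ᶜ) = g I := by
  rw [← convTerm_emptySum hH hK (g I), ← hf']
  refine convTerm_eq_of_range hH hK hf hg _ _ ?_ ?_
  · rintro ⟨x, hx⟩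
    exact hx.elim
  · rintro ⟨x, hx⟩
    exact ⟨x, rfl⟩

theorem convTerm_sumCompl_univ (hH : IsComonoid H) (hK : IsMonoid K) {f g : Family F G}
    (hg : IsSpeciesMorphism g) (hf : IsSpeciesMorphism f)
    (hf' : f PEmpty = H.counit.smulRight K.one) (I : Type u) [Finite I]
    [DecidablePred (· ∈ (Set.univ : Set I))] :
    convTerm H K (Equiv.Set.sumCompl (Set.univ : Set I)) (g ↥(Set.univ : Set I))
      (f ↥(Set.univ : Set I)ᶜ) = g I := by
  rw [← convTerm_sumEmpty hH hK (g I), ← hf']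
  refine convTerm_eq_of_range hH hK hg hf _ _ ?_ ?_
  · rintro ⟨x, hx⟩
    exact ⟨x, rfl⟩
  · rintro ⟨x, hx⟩
    exact (hx trivial).elim

theorem smulRight_eq_of_isConnected (hc : IsConnected H) {φ : F.obj PEmpty →ₗ[ℝ] G.obj PEmpty}
    (h : φ H.one = K.one) : φ = H.counit.smulRight K.one := by
  ext x
  rw [LinearMap.smulRight_apply, ← h, ← map_smul, hc]

theorem unitCounit_convolution (hH : IsComonoid H) (hK : IsMonoid H) (hc : IsConnected H)
    {f : Family F F} (hf : IsSpeciesMorphism f) (I : Type u) [Finite I] :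
    convolution H (unitCounit H) f I = f I := by
  let _ : Fintype (Set I) := Fintype.ofFinite _
  rw [convolution_eq, Finset.sum_eq_single ∅]
  · refine @convTerm_sumCompl_empty _ _ _ _ hH hK _ _ hf (IsSpeciesMorphism.unitCounit hc) ?_
      I _ fun _ => propDecidable _
    rw [unitCounit_of_isEmpty hc]
    exact smulRight_eq_of_isConnected hc rfl
  · intro S _ hS
    rw [unitCounit_of_not_isEmpty _ (by rwa [Set.isEmpty_coe_sort]), convTerm_zero_left]
  · simp

theorem convolution_unitCounit (hH : IsComonoid H) (hK : IsMonoid H) (hc : IsConnected H)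
    {f : Family F F} (hf : IsSpeciesMorphism f) (I : Type u) [Finite I] :
    convolution H f (unitCounit H) I = f I := by
  let _ : Fintype (Set I) := Fintype.ofFinite _
  rw [convolution_eq, Finset.sum_eq_single Set.univ]
  · refine @convTerm_sumCompl_univ _ _ _ _ hH hK _ _ hf (IsSpeciesMorphism.unitCounit hc) ?_
      I _ fun _ => propDecidable _
    rw [unitCounit_of_isEmpty hc]
    exact smulRight_eq_of_isConnected hc rfl
  · intro S _ hS
    rw [unitCounit_of_not_isEmpty _ (by rwa [Set.isEmpty_coe_sort, Set.compl_empty_iff]),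
      convTerm_zero_right]
  · simp

/-- The convolution powers of `η ε - id`. -/
def takeuchi (H : CauchyOps F) : ℕ → Family F F
  | 0 => unitCounit H
  | n + 1 => convolution H (fun I _ => unitCounit H I - LinearMap.id) (takeuchi H n)

theorem IsSpeciesMorphism.takeuchi (hH : IsComonoid H) (hK : IsMonoid H) (hc : IsConnected H)
    (n : ℕ) : IsSpeciesMorphism (takeuchi H n) := by
  induction n with
  | zero => exact .unitCounit hc
  | succ n ih =>
    exact .convolution hH hK (isSpeciesMorphism_sub (.unitCounit hc) isSpeciesMorphism_id) ih

/-- A convolution power may be built from either side; this form serves the left inverse property.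
-/
theorem takeuchi_succ' (hH : IsComonoid H) (hK : IsMonoid H) (hc : IsConnected H) (n : ℕ) :
    takeuchi H (n + 1) =
      convolution H (takeuchi H n) (fun I _ => unitCounit H I - LinearMap.id) := by
  have hq : IsSpeciesMorphism (fun I _ => unitCounit H I - LinearMap.id : Family F F) :=
    isSpeciesMorphism_sub (.unitCounit hc) isSpeciesMorphism_id
  induction n with
  | zero =>
    funext I _
    exact (convolution_unitCounit hH hK hc hq I).trans (unitCounit_convolution hH hK hc hq I).symm
  | succ n ih =>
    funext I _
    rw [takeuchi, ih, ← convolution_assoc hH hK hq (.takeuchi hH hK hc n) hq, ← ih]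
    rfl

/-- Connectedness makes `η ε - id` vanish on the empty set, so a nonzero term needs `n` nonempty
disjoint blocks in `I`. -/
theorem takeuchi_eq_zero (hc : IsConnected H) (n : ℕ) (I : Type u) [Finite I]
    (h : Nat.card I < n) : takeuchi H n I = 0 := by
  induction n generalizing I with
  | zero => exact (Nat.not_lt_zero _ h).elim
  | succ n ih =>
    let _ : Fintype (Set I) := Fintype.ofFinite _
    rw [takeuchi, convolution_eq]
    refine Finset.sum_eq_zero fun S _ => ?_
    by_cases hS : IsEmpty ↥S
    · rw [unitCounit_of_isEmpty hc, sub_self, convTerm_zero_left]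
    · rw [ih ↥Sᶜ, convTerm_zero_right]
      rw [Set.isEmpty_coe_sort, ← ne_eq, ← Set.nonempty_iff_ne_empty] at hS
      have h1 := Set.ncard_add_ncard_compl S
      have h2 := (Set.ncard_pos (Set.toFinite S)).2 hS
      rw [Nat.card_coe_set_eq]
      omega

/-- Takeuchi's formula for the antipode. -/
def antipode (H : CauchyOps F) : Family F F := fun I _ =>
  ∑ k ∈ Finset.range (Nat.card I + 1), takeuchi H k I

/-- The extra powers vanish, so subsets of `I` of different sizes can share one summation range. -/
theorem antipode_eq (hc : IsConnected H) (I : Type u) [Finite I] {n : ℕ} (h : Nat.card I < n) :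
    antipode H I = ∑ k ∈ Finset.range n, takeuchi H k I := by
  rw [antipode]
  refine Finset.sum_subset (Finset.range_mono h) fun k _ hk => takeuchi_eq_zero hc k I ?_
  simp at hk
  omega

theorem card_subtype_lt {I : Type u} [Finite I] {n : ℕ} (h : Nat.card I < n) (S : Set I) :
    Nat.card ↥S < n := lt_of_le_of_lt (Finite.card_subtype_le _) h

/-- The geometric series: with `q = η ε - id`, one has `id = η ε - q`, so convolving with the sum of
the powers of `q` telescopes, and the last power vanishes by cardinality. -/
theorem isAntipode_antipode (hH : IsComonoid H) (hK : IsMonoid H) (hc : IsConnected H) :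
    IsAntipode H (antipode H) := by
  have hid : (fun I _ => LinearMap.id : Family F F) =
      (fun I _ => unitCounit H I - (unitCounit H I - LinearMap.id) : Family F F) := by
    funext I _
    simp
  refine ⟨fun I J _ _ e => ?_, fun I _ => ?_, fun I _ => ?_⟩
  · have hIJ : Nat.card I = Nat.card J := Nat.card_congr e
    rw [antipode, antipode, sum_comp, comp_sum, hIJ]
    exact Finset.sum_congr rfl fun k _ => IsSpeciesMorphism.takeuchi hH hK hc k I J e
  · let _ : Fintype (Set I) := Fintype.ofFinite _
    have h1 : convolution H (fun _ _ => LinearMap.id) (antipode H) I =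
        ∑ k ∈ Finset.range (Nat.card I + 1),
          (takeuchi H k I - takeuchi H (k + 1) I) := by
      rw [hid, convolution_eq]
      have h2 : ∀ k, takeuchi H k I - takeuchi H (k + 1) I = ∑ S : Set I,
          convTerm H H (Equiv.Set.sumCompl S)
            (unitCounit H ↥S - (unitCounit H ↥S - LinearMap.id)) (takeuchi H k ↥Sᶜ) := fun k => by
        conv_lhs => rw [← unitCounit_convolution hH hK hc (.takeuchi hH hK hc k) I]
        rw [takeuchi, convolution_eq, convolution_eq, ← Finset.sum_sub_distrib]
        refine Finset.sum_congr rfl fun S _ => ?_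
        simp only [← convTermBilin_apply, map_sub, LinearMap.sub_apply]
      rw [Finset.sum_congr rfl fun k _ => h2 k, Finset.sum_comm]
      refine Finset.sum_congr rfl fun S _ => ?_
      rw [antipode_eq hc ↥Sᶜ (card_subtype_lt (Nat.lt_succ_self _) _), ← convTermBilin_apply,
        map_sum]
      rfl
    rw [h1, Finset.sum_range_sub', takeuchi_eq_zero hc _ I (Nat.lt_succ_self _), sub_zero]
    rfl
  · let _ : Fintype (Set I) := Fintype.ofFinite _
    have h1 : convolution H (antipode H) (fun _ _ => LinearMap.id) I =
        ∑ k ∈ Finset.range (Nat.card I + 1),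
          (takeuchi H k I - takeuchi H (k + 1) I) := by
      rw [hid, convolution_eq]
      have h2 : ∀ k, takeuchi H k I - takeuchi H (k + 1) I = ∑ S : Set I,
          convTerm H H (Equiv.Set.sumCompl S) (takeuchi H k ↥S)
            (unitCounit H ↥Sᶜ - (unitCounit H ↥Sᶜ - LinearMap.id)) := fun k => by
        conv_lhs => rw [← convolution_unitCounit hH hK hc (.takeuchi hH hK hc k) I]
        rw [takeuchi_succ' hH hK hc, convolution_eq, convolution_eq, ← Finset.sum_sub_distrib]
        refine Finset.sum_congr rfl fun S _ => ?_
        simp only [← convTermBilin_apply, map_sub]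
      rw [Finset.sum_congr rfl fun k _ => h2 k, Finset.sum_comm]
      refine Finset.sum_congr rfl fun S _ => ?_
      rw [antipode_eq hc ↥S (card_subtype_lt (Nat.lt_succ_self _) _), ← convTermBilin_apply,
        map_sum, LinearMap.sum_apply]
      rfl
    rw [h1, Finset.sum_range_sub', takeuchi_eq_zero hc _ I (Nat.lt_succ_self _), sub_zero]
    rfl

theorem IsBimonoid.isHopfMonoid (hH : IsBimonoid H) (hc : IsConnected H) : IsHopfMonoid H :=
  ⟨hH, _, isAntipode_antipode hH.isComonoid hH.isMonoid hc⟩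

theorem IsSpeciesMorphism.comp {φ : Family F G} (hφ : IsSpeciesMorphism φ) {s : Family F F}
    (hs : IsSpeciesMorphism s) : IsSpeciesMorphism (fun I _ => φ I ∘ₗ s I) := by
  intro I J _ _ e
  rw [LinearMap.comp_assoc, hs, ← LinearMap.comp_assoc, hφ, LinearMap.comp_assoc]

theorem IsSpeciesMorphism.comp' {φ : Family F G} (hφ : IsSpeciesMorphism φ) {t : Family G G}
    (ht : IsSpeciesMorphism t) : IsSpeciesMorphism (fun I _ => t I ∘ₗ φ I) := by
  intro I J _ _ e
  rw [LinearMap.comp_assoc, hφ, ← LinearMap.comp_assoc, ht, LinearMap.comp_assoc]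

theorem comp_convTerm {φ : Family F G} (hφ : IsBimonoidMorphism H K φ) {S T I : Type u} [Finite S]
    [Finite T] [Finite I] (e : S ⊕ T ≃ I) (f : F.obj S →ₗ[ℝ] F.obj S)
    (g : F.obj T →ₗ[ℝ] F.obj T) :
    φ I ∘ₗ convTerm H H e f g = convTerm H K e (φ S ∘ₗ f) (φ T ∘ₗ g) := by
  have h1 : φ I ∘ₗ F.map e = G.map e ∘ₗ φ (S ⊕ T) := hφ.isMorphism _ _ e
  have h2 := hφ.map_mul S T
  simp only [convTerm, TensorProduct.map_comp, LinearMap.comp_assoc]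
  rw [← LinearMap.comp_assoc _ (TensorProduct.map (φ S) (φ T)), ← h2, ← LinearMap.comp_assoc, h1]
  simp only [LinearMap.comp_assoc]

theorem convTerm_comp {φ : Family F G} (hφ : IsBimonoidMorphism H K φ) {S T I : Type u} [Finite S]
    [Finite T] [Finite I] (e : S ⊕ T ≃ I) (f : G.obj S →ₗ[ℝ] G.obj S)
    (g : G.obj T →ₗ[ℝ] G.obj T) :
    convTerm K K e f g ∘ₗ φ I = convTerm H K e (f ∘ₗ φ S) (g ∘ₗ φ T) := by
  have h1 : G.map e.symm ∘ₗ φ I = φ (S ⊕ T) ∘ₗ F.map e.symm := (hφ.isMorphism _ _ e.symm).symm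
  simp only [convTerm, LinearMap.comp_assoc, h1, TensorProduct.map_comp]
  rw [← LinearMap.comp_assoc (F.map e.symm) (φ (S ⊕ T)), hφ.map_comul, LinearMap.comp_assoc]

theorem comp_unitCounit (hc : IsConnected H) (hc' : IsConnected K) (φ : Family F G) (I : Type u)
    [Finite I] : φ I ∘ₗ unitCounit H I = unitCounit K I ∘ₗ φ I := by
  by_cases h : IsEmpty I
  · rw [unitCounit_of_isEmpty hc, unitCounit_of_isEmpty hc']
    rfl
  · rw [unitCounit_of_not_isEmpty _ h, unitCounit_of_not_isEmpty _ h]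
    simp

/-- Morphisms of connected bimonoids commute with antipodes. -/
theorem IsBimonoidMorphism.isHopfMorphism (hH : IsBimonoid H) (hK : IsBimonoid K)
    (hc : IsConnected H) (hc' : IsConnected K) {φ : Family F G}
    (hφ : IsBimonoidMorphism H K φ) : IsHopfMorphism H K φ := by
  refine ⟨hφ, fun s t hs ht I _ => ?_⟩
  induction hn : Nat.card I using Nat.strong_induction_on generalizing I with
  | _ n ih =>
    let _ : Fintype (Set I) := Fintype.ofFinite _
    -- Both expansions equal the composite of `φ` with unit and counit. Their terms at `S = ∅` are
    -- the two maps to be compared, and the other terms agree by induction, since there `Sᶜ` is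
    -- smaller than `I`.
    have h1 := congrArg (φ I ∘ₗ ·) (hs.id_conv I)
    have h2 := congrArg (· ∘ₗ φ I) (ht.id_conv I)
    simp only [convolution_eq, comp_sum, sum_comp, comp_convTerm hφ,
      convTerm_comp hφ, LinearMap.comp_id, LinearMap.id_comp] at h1 h2
    rw [comp_unitCounit hc hc', ← h2, ← Finset.add_sum_erase _ _ (Finset.mem_univ ∅),
      ← Finset.add_sum_erase (a := ∅) _ _ (Finset.mem_univ _)] at h1
    have hφ' := smulRight_eq_of_isConnected hc hφ.map_one
    rw [convTerm_sumCompl_empty hH.isComonoid hK.isMonoid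
        (g := fun I _ => φ I ∘ₗ s I) (hφ.isMorphism.comp hs.isMorphism) hφ.isMorphism hφ',
      convTerm_sumCompl_empty hH.isComonoid hK.isMonoid
        (g := fun I _ => t I ∘ₗ φ I) (hφ.isMorphism.comp' ht.isMorphism) hφ.isMorphism hφ'] at h1
    refine add_right_cancel (h1.trans (congrArg _ (Finset.sum_congr rfl fun S hS => ?_)))
    rw [ih _ ?_ ↥Sᶜ inferInstance rfl]
    have hS' := Set.nonempty_iff_ne_empty.2 (Finset.ne_of_mem_erase hS)
    have h3 := Set.ncard_add_ncard_compl S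
    have h4 := (Set.ncard_pos (Set.toFinite S)).2 hS'
    rw [Nat.card_coe_set_eq]
    omega

end Antipode

/-! ### Reindexing sums over conforming preorders; minimality. -/

section Sums

open Classical

variable {I J S T : Type u} {M : Type*} [AddCommMonoid M]

/-- Conditions `P ≼ Q` become zero terms in sums over all preorders conforming to `z`, so that
double sums can be interchanged. -/
theorem sum_subtype_dite {α : Type*} [Fintype α] (p : α → Prop) [Fintype {a // p a}]
    (f : {a // p a} → M) : ∑ x, f x = ∑ a, if h : p a then f ⟨a, h⟩ else 0 := by
  refine Fintype.sum_of_injective Subtype.val Subtype.val_injective f _ (fun a ha => ?_)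
    fun x => ?_
  · exact dif_neg fun h => ha ⟨⟨a, h⟩, rfl⟩
  · rw [dif_pos x.2]

theorem sum_conforming_map [Finite I] [Finite J] (e : I ≃ J) (z : SubmodFun I)
    (f : ConformingPre (z.map e) → M) :
    ∑ P, f P = ∑ P : ConformingPre z,
      f ⟨comapPre e.symm P.1, conforms_comapPre_symm e P.2⟩ :=
  (Equiv.sum_comp (conformingMap e z) f).symm

theorem sum_conforming_prod [Finite S] [Finite T] (x : SubmodFun S) (y : SubmodFun T)
    (f : ConformingPre (x.prod y) → M) :
    ∑ R, f R = ∑ P : ConformingPre x, ∑ Q : ConformingPre y,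
      f ⟨sumPre P.1 Q.1, conforms_sumPre.2 ⟨P.2, Q.2⟩⟩ := by
  rw [← Equiv.sum_comp (conformingProd x y) f, Fintype.sum_prod_type]
  rfl

theorem sum_conforming_face [Finite I] {z : SubmodFun I} {Q : Preorder I} (hQ : Compatible z Q)
    (f : ConformingPre (face z Q hQ) → M) :
    ∑ R, f R = ∑ P : ConformingPre z, if h : Refines P.1 Q then
      f ⟨rest P.1 Q, conforms_rest P.2 h hQ⟩ else 0 := by
  let _ : Fintype {P : ConformingPre z // Refines P.1 Q} := Fintype.ofEquiv _ (restEquiv hQ).symm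
  rw [← Equiv.sum_comp (restEquiv hQ) f, sum_subtype_dite]
  rfl

theorem sum_conforming_cone [Finite I] {z : SubmodFun I} {P : Preorder I} (hP : Conforms z P)
    (f : ConformingPre (cone z P) → M) :
    ∑ R, f R = ∑ Q : ConformingPre z, if h : Refines P Q.1 then
      f ⟨Q.1, (conforms_cone_iff hP).2 ⟨h, Q.2⟩⟩ else 0 := by
  let E : {Q : ConformingPre z // Refines P Q.1} ≃ ConformingPre (cone z P) :=
    { toFun := fun Q => ⟨Q.1.1, (conforms_cone_iff hP).2 ⟨Q.2, Q.1.2⟩⟩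
      invFun := fun Q => ⟨⟨Q.1, ((conforms_cone_iff hP).1 Q.2).2⟩,
        ((conforms_cone_iff hP).1 Q.2).1⟩
      left_inv := fun _ => rfl
      right_inv := fun _ => rfl }
  let _ : Fintype {Q : ConformingPre z // Refines P Q.1} := Fintype.ofEquiv _ E.symm
  rw [← Equiv.sum_comp E f, sum_subtype_dite]
  rfl

theorem sum_conforming_eq [Finite I] {z : SubmodFun I} {f : ConformingPre z → M}
    (P : ConformingPre z)
    (h : ∀ Q : ConformingPre z, Q.1 ≠ P.1 → f Q = 0) : ∑ Q, f Q = f P :=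
  Finset.sum_eq_single P (fun Q _ hQ => h Q fun h' => hQ (Subtype.ext h')) (by simp)

/-- Minimality among the conforming preorders. -/
def IsMinPre (z : SubmodFun I) (P : Preorder I) : Prop :=
  ∀ Q, Conforms z Q → Refines Q P → Refines P Q

theorem sum_minConforming [Finite I] (z : SubmodFun I) (f : Preorder I → M) :
    ∑ P : MinConformingPre z, f P.1 = ∑ P : ConformingPre z,
      if IsMinPre z P.1 then f P.1 else 0 := by
  let E : {P : ConformingPre z // IsMinPre z P.1} ≃ MinConformingPre z :=
    { toFun := fun P => ⟨P.1.1, P.1.2, P.2⟩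
      invFun := fun P => ⟨⟨P.1, P.2.1⟩, P.2.2⟩
      left_inv := fun _ => rfl
      right_inv := fun _ => rfl }
  let _ : Fintype {P : ConformingPre z // IsMinPre z P.1} := Fintype.ofEquiv _ E.symm
  rw [← Equiv.sum_comp E, sum_subtype_dite]
  rfl

theorem isMinPre_map (e : I ≃ J) {z : SubmodFun I} {P : Preorder I} :
    IsMinPre (z.map e) (comapPre e.symm P) ↔ IsMinPre z P := by
  constructor
  · intro h Q hQ hQP
    exact (refines_comapPre_symm e).1
      (h _ (conforms_comapPre_symm e hQ) ((refines_comapPre_symm e).2 hQP))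
  · intro h Q hQ
    obtain ⟨Q', hQ'⟩ := (conformingMap e z).surjective ⟨Q, hQ⟩
    have : comapPre e.symm Q'.1 = Q := congrArg Subtype.val hQ'
    subst this
    rw [refines_comapPre_symm, refines_comapPre_symm]
    exact h _ Q'.2

theorem isMinPre_prod {x : SubmodFun S} {y : SubmodFun T} {P : Preorder S} {Q : Preorder T}
    (hP : Conforms x P) (hQ : Conforms y Q) :
    IsMinPre (x.prod y) (sumPre P Q) ↔ IsMinPre x P ∧ IsMinPre y Q := by
  constructor
  · intro h
    exact ⟨fun P' hP' hle => (refines_sumPre.1 (h (sumPre P' Q) (conforms_sumPre.2 ⟨hP', hQ⟩)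
      (refines_sumPre.2 ⟨hle, .refl Q⟩))).1, fun Q' hQ' hle => (refines_sumPre.1
        (h (sumPre P Q') (conforms_sumPre.2 ⟨hP, hQ'⟩) (refines_sumPre.2 ⟨.refl P, hle⟩))).2⟩
  · rintro ⟨h1, h2⟩ R hR
    have hR' := hR
    rw [← sumPre_comapPre hR, conforms_sumPre] at hR'
    rw [← sumPre_comapPre hR, refines_sumPre, refines_sumPre]
    exact fun h => ⟨h1 _ hR'.1 h.1, h2 _ hR'.2 h.2⟩

/-- Restriction to the bubbles of `Q` preserves and reflects order, and a preorder finer than `P` is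
automatically finer than `Q`, hence within the range of `restEquiv`. -/
theorem isMinPre_rest [Finite I] {z : SubmodFun I} {P Q : Preorder I} (hP : Conforms z P)
    (hPQ : Refines P Q) (hQ : Compatible z Q) :
    IsMinPre (face z Q hQ) (rest P Q) ↔ IsMinPre z P := by
  constructor
  · intro h P' hP' hle
    have hP'Q := hle.trans hPQ
    exact rest_refines_rest hQ hP hP' hPQ hP'Q (h _ (conforms_rest hP' hP'Q hQ) (rest_mono Q hle))
  · intro h R hR hle
    have hR' := rest_liftPre hR
    have hL := conforms_liftPre_face hR
    rw [← hR'] at hle ⊢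
    exact rest_mono Q (h _ hL (rest_refines_rest hQ hL hP (liftPre_refines hR) hPQ hle))

/-- A least element is the only minimal one. -/
theorem isMinPre_of_isModular [Finite I] {z : SubmodFun I} (hz : z.IsModular) {P : Preorder I}
    (hP : Conforms z P) : IsMinPre z P ↔ P = pre z := by
  constructor
  · intro h
    have h' := pre_refines hP.toCompatible
    exact (h _ (conforms_pre hz) h').antisymm h'
  · rintro rfl Q hQ _
    exact pre_refines hQ.toCompatible

end Sums

/-! ### The axioms for `δ`, `ε` and `φ`, from their values on basis functions. -/

section Coactions

open Classical SubmodFun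

variable {F C : Species.{u}} {H : CauchyOps F} {K : CauchyOps C}
  {p : ∀ {I : Type u}, SubmodFun I → Prop}
  {b : ∀ {I : Type u} [Finite I], SubmodFun I → F.obj I}
  {c : ∀ {I : Type u} [Finite I], SubmodFun I → C.obj I}

/-- `ρ(z) = ∑ z_P ⊗ z^P` on basis vectors. -/
def IsDelta (ρ : Coaction F C) (p : ∀ {I : Type u}, SubmodFun I → Prop)
    (b : ∀ {I : Type u} [Finite I], SubmodFun I → F.obj I)
    (c : ∀ {I : Type u} [Finite I], SubmodFun I → C.obj I) : Prop :=
  ∀ {I : Type u} [Finite I] {z : SubmodFun I}, p z →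
    ρ I (b z) = ∑ P : ConformingPre z, b (face z P.1 P.2.toCompatible) ⊗ₜ[ℝ] c (cone z P.1)

/-- `ε(z)` detects whether `pre z` is an equivalence relation. -/
def IsEps (ε : Forms C) (c : ∀ {I : Type u} [Finite I], SubmodFun I → C.obj I) : Prop :=
  ∀ {I : Type u} [Finite I] {z : SubmodFun I}, z.IsModular →
    ε I (c z) = if IsTotallyDisconnected (pre z) then 1 else 0

/-- `φ(z) = ∑ z^P` over minimal preorders, on basis vectors. -/
def IsPhi (φ : Family F C) (p : ∀ {I : Type u}, SubmodFun I → Prop)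
    (b : ∀ {I : Type u} [Finite I], SubmodFun I → F.obj I)
    (c : ∀ {I : Type u} [Finite I], SubmodFun I → C.obj I) : Prop :=
  ∀ {I : Type u} [Finite I] {z : SubmodFun I}, p z →
    φ I (b z) = ∑ P : ConformingPre z, if IsMinPre z P.1 then c (cone z P.1) else 0

variable {ρ : Coaction F C} {δ : Coaction C C} {ε : Forms C} {φ : Family F C}

theorem delta_natural (L : IsBased H p b) (N : IsBased K IsModular c) (hρ : IsDelta ρ p b c) :
    ρ.IsNatural := fun I J _ _ e => L.hom_ext fun z hz => by
  simp only [LinearMap.comp_apply]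
  rw [L.map_b e hz, hρ hz, hρ (L.p_map e hz), sum_conforming_map, map_sum]
  refine Finset.sum_congr rfl fun P _ => ?_
  rw [TensorProduct.map_tmul, L.map_b e (L.p_face P.2.toCompatible hz),
    N.map_b e (isModular_cone P.2.toCompatible), cone_map, face_map e P.2.toCompatible]

/-- Both sides become the sum of `z_P ⊗ (z^P)_Q ⊗ z^Q` over pairs `P ≼ Q` conforming to `z`: the
left from the preorders conforming to `z^P`, the right from those conforming to `z_Q`. -/
theorem delta_coassoc (L : IsBased H p b) (hρ : IsDelta ρ p b c) (hδ : IsDelta δ IsModular c c) :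
    ρ.IsCoassociative δ := fun I _ => L.hom_ext fun z hz => by
  simp only [LinearMap.comp_apply, LinearEquiv.coe_coe]
  rw [hρ hz, map_sum, map_sum, map_sum]
  have h1 : ∀ P : ConformingPre z, (δ I).lTensor (F.obj I)
      (b (face z P.1 P.2.toCompatible) ⊗ₜ[ℝ] c (cone z P.1)) =
      ∑ Q : ConformingPre z, if h : Refines P.1 Q.1 then
        b (face z P.1 P.2.toCompatible) ⊗ₜ[ℝ] (c (face (cone z P.1) Q.1
          (compatible_cone h Q.2.toCompatible)) ⊗ₜ[ℝ] c (cone z Q.1)) else 0 := fun P => by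
    rw [LinearMap.lTensor_tmul, hδ (isModular_cone P.2.toCompatible), TensorProduct.tmul_sum,
      sum_conforming_cone P.2]
    refine Finset.sum_congr rfl fun Q _ => ?_
    split_ifs with h
    · rw [cone_cone h]
    · rfl
  have h2 : ∀ Q : ConformingPre z, TensorProduct.assoc ℝ (F.obj I) (C.obj I) (C.obj I)
      ((ρ I).rTensor (C.obj I) (b (face z Q.1 Q.2.toCompatible) ⊗ₜ[ℝ] c (cone z Q.1))) =
      ∑ P : ConformingPre z, if h : Refines P.1 Q.1 then
        b (face z P.1 P.2.toCompatible) ⊗ₜ[ℝ] (c (face (cone z P.1) Q.1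
          (compatible_cone h Q.2.toCompatible)) ⊗ₜ[ℝ] c (cone z Q.1)) else 0 := fun Q => by
    rw [LinearMap.rTensor_tmul, hρ (L.p_face Q.2.toCompatible hz), TensorProduct.sum_tmul,
      map_sum, sum_conforming_face Q.2.toCompatible]
    refine Finset.sum_congr rfl fun P _ => ?_
    split_ifs with h
    · rw [TensorProduct.assoc_tmul, face_rest P.2 h, cone_rest h]
    · rfl
  rw [Finset.sum_congr rfl fun P _ => h1 P, Finset.sum_congr rfl fun Q _ => h2 Q, Finset.sum_comm]

/-- Since `pre (z^P) = P`, the counit selects the totally disconnected `P`; only `splitPre z`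
remains, and its face is `z`. -/
theorem delta_counital (L : IsBased H p b) (hρ : IsDelta ρ p b c) (hε : IsEps ε c) :
    ρ.IsCounital ε := fun I _ => L.hom_ext fun z hz => by
  simp only [LinearMap.comp_apply, LinearEquiv.coe_coe, LinearMap.id_apply]
  rw [hρ hz, map_sum, map_sum, sum_conforming_eq ⟨splitPre z, conforms_splitPre z⟩]
  · rw [LinearMap.lTensor_tmul, hε (isModular_cone (conforms_splitPre z).toCompatible),
      pre_cone (conforms_splitPre z).toCompatible, if_pos (isTotallyDisconnected_splitPre z),
      TensorProduct.rid_tmul, one_smul, face_eq_self (isTotallyDisconnected_splitPre z)]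
  · intro Q hQ
    rw [LinearMap.lTensor_tmul, hε (isModular_cone Q.2.toCompatible), pre_cone Q.2.toCompatible,
      if_neg fun h => hQ (eq_splitPre Q.2 h), TensorProduct.tmul_zero, map_zero]

/-- The counit of `z_Q` is nonzero only for `Q = pre z`, whose cone is `z`. -/
theorem delta_lid (N : IsBased K IsModular c) (hδ : IsDelta δ IsModular c c) (hε : IsEps ε c)
    (I : Type u) [Finite I] :
    (TensorProduct.lid ℝ (C.obj I)).toLinearMap ∘ₗ (ε I).rTensor (C.obj I) ∘ₗ δ I =
      LinearMap.id := N.hom_ext fun z hz => by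
  simp only [LinearMap.comp_apply, LinearEquiv.coe_coe, LinearMap.id_apply]
  rw [hδ hz, map_sum, map_sum, sum_conforming_eq ⟨pre z, conforms_pre hz⟩]
  · rw [LinearMap.rTensor_tmul, hε (N.p_face _ hz),
      if_pos ((isTotallyDisconnected_pre_face_iff hz (conforms_pre hz)).2 rfl),
      TensorProduct.lid_tmul, one_smul, cone_pre]
  · intro Q hQ
    rw [LinearMap.rTensor_tmul, hε (N.p_face _ hz),
      if_neg fun h => hQ ((isTotallyDisconnected_pre_face_iff hz Q.2).1 h),
      TensorProduct.zero_tmul, map_zero]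

theorem eps_natural (N : IsBased K IsModular c) (hε : IsEps ε c) {I J : Type u} [Finite I]
    [Finite J] (e : I ≃ J) : ε J ∘ₗ C.map e = ε I := N.form_ext fun z hz => by
  rw [LinearMap.comp_apply, N.map_b e hz, hε hz, hε (hz.map e)]
  have h : pre (z.map e) = comapPre e.symm (pre z) :=
    preorder_ext_isDownSet fun A => by
      rw [isDownSet_pre, isDownSet_comapPre_symm, isDownSet_pre]; rfl
  rw [h]
  refine if_congr ?_ rfl rfl
  constructor
  · intro h' x y hxy
    exact (comapPre_symm_le e (pre z) y x).1 (h' ((comapPre_symm_le e (pre z) x y).2 hxy))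
  · exact fun h' x y hxy => h' hxy

theorem eps_mul (N : IsBased K IsModular c) (hε : IsEps ε c) (S T : Type u) [Finite S]
    [Finite T] (x : C.obj S) (y : C.obj T) :
    ε (S ⊕ T) (K.mul S T (x ⊗ₜ y)) = ε S x * ε T y := by
  have : ε (S ⊕ T) ∘ₗ K.mul S T = LinearMap.mul' ℝ ℝ ∘ₗ TensorProduct.map (ε S) (ε T) :=
    N.tensor_form_ext fun x y hx hy => by
      simp only [LinearMap.comp_apply, TensorProduct.map_tmul, LinearMap.mul'_apply]
      rw [N.mul_b hx hy, hε hx, hε hy, hε (hx.prod hy)]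
      have h : pre (x.prod y) = sumPre (pre x) (pre y) := preorder_ext_isDownSet fun A => by
        rw [isDownSet_pre, isDownSet_sumPre, isDownSet_pre, isDownSet_pre, prod_apply,
          WithTop.add_ne_top]
      have h' : IsTotallyDisconnected (sumPre (pre x) (pre y)) ↔
          IsTotallyDisconnected (pre x) ∧ IsTotallyDisconnected (pre y) := by
        constructor
        · exact fun h => ⟨fun a a' haa => Sum.liftRel_inl_inl.1 (h (.inl haa)),
            fun a a' haa => Sum.liftRel_inr_inr.1 (h (.inr haa))⟩
        · rintro ⟨h1, h2⟩ _ _ (h | h)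
          exacts [.inl (h1 h), .inr (h2 h)]
      rw [h, if_congr h' rfl rfl]
      by_cases h1 : IsTotallyDisconnected (pre x) <;>
        by_cases h2 : IsTotallyDisconnected (pre y) <;> simp only [h1, h2] <;> norm_num
  exact LinearMap.congr_fun this (x ⊗ₜ y)

theorem sum_conforming_of_isEmpty {I : Type u} [Finite I] [IsEmpty I] {M : Type*}
    [AddCommMonoid M] {z : SubmodFun I} (f : ConformingPre z → M) :
    ∑ P, f P = f ⟨splitPre z, conforms_splitPre z⟩ :=
  sum_conforming_eq _ fun _ hQ => (hQ (preorder_ext fun x => isEmptyElim x)).elim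

theorem delta_of_isEmpty (hρ : IsDelta ρ p b c) {I : Type u} [Finite I] [IsEmpty I]
    {z : SubmodFun I} (hz : p z) : ρ I (b z) = b z ⊗ₜ[ℝ] c z := by
  rw [hρ hz, sum_conforming_of_isEmpty]
  congr 2
  exacts [Subsingleton.elim _ _, Subsingleton.elim _ _]

theorem delta_multiplicative (L : IsBased H p b) (N : IsBased K IsModular c)
    (hρ : IsDelta ρ p b c) : ρ.IsMultiplicative H K where
  map_mul S T _ _ := L.tensor_ext fun x y hx hy => by
    simp only [LinearMap.comp_apply, TensorProduct.map_tmul, LinearEquiv.coe_coe]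
    rw [L.mul_b hx hy, hρ hx, hρ hy, hρ (L.p_prod hx hy), sum_conforming_prod,
      TensorProduct.sum_tmul, map_sum, map_sum]
    refine Finset.sum_congr rfl fun P _ => ?_
    rw [TensorProduct.tmul_sum, map_sum, map_sum]
    refine Finset.sum_congr rfl fun Q _ => ?_
    rw [TensorProduct.tensorTensorTensorComm_tmul, TensorProduct.map_tmul,
      L.mul_b (L.p_face P.2.toCompatible hx) (L.p_face Q.2.toCompatible hy),
      N.mul_b (isModular_cone P.2.toCompatible) (isModular_cone Q.2.toCompatible), cone_sumPre,
      face_sumPre P.2.toCompatible Q.2.toCompatible]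
  map_one := by
    rw [L.one_eq, N.one_eq, delta_of_isEmpty hρ L.p_zero]

/-- Restriction and corestriction recover the factors of a product. -/
theorem comul_comp_mul (N : IsBased K IsModular c) (S T : Type u) [Finite S] [Finite T] :
    K.comul S T ∘ₗ K.mul S T = LinearMap.id := N.tensor_ext fun x y hx hy => by
  have h := prod_left_ne_top x y
  rw [LinearMap.comp_apply, N.mul_b hx hy, N.comul_b (hx.prod hy) h, restrict_prod,
    corestrict_prod, LinearMap.id_apply]

/-- The face at `ordPre` is the product of the two factors of the coproduct of `z`, and the
coproduct inverts the product. -/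
theorem comul_face_ordPre (N : IsBased K IsModular c) {S T : Type u} [Finite S] [Finite T]
    {z : SubmodFun (S ⊕ T)} (hz : z.IsModular) (h : z (left S T) ≠ ⊤)
    (hQ : Compatible z (ordPre S T)) :
    K.comul S T (c (face z (ordPre S T) hQ)) = K.comul S T (c z) := by
  rw [face_ordPre h, N.comul_b hz h, ← N.mul_b (hz.restrict h) (hz.corestrict h)]
  exact LinearMap.congr_fun (comul_comp_mul N S T) _

theorem comul_cone_eq_zero (N : IsBased K IsModular c) {S T : Type u} [Finite S] [Finite T]
    {z : SubmodFun (S ⊕ T)} {P : Preorder (S ⊕ T)} (hP : Compatible z P)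
    (h : ¬ Refines P (ordPre S T)) : K.comul S T (c (cone z P)) = 0 :=
  N.comul_b_of_eq_top (isModular_cone hP) (cone_of_not_isDownSet h)

theorem not_refines_ordPre {S T : Type u} {z : SubmodFun (S ⊕ T)} {P : Preorder (S ⊕ T)}
    (hP : Compatible z P) (h : z (left S T) = ⊤) : ¬ Refines P (ordPre S T) :=
  fun h' => hP.finite _ (refines_ordPre.1 h') h

theorem cone_left_ne_top {S T : Type u} {z : SubmodFun (S ⊕ T)} {P : Preorder (S ⊕ T)}
    (h : z (left S T) ≠ ⊤) (hP : Refines P (ordPre S T)) : cone z P (left S T) ≠ ⊤ := by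
  rwa [cone_of_isDownSet (refines_ordPre.1 hP)]

/-- After applying the coproduct of `C`, neither side distinguishes `z` from its face at `ordPre`.
That face is a product, so multiplicativity of `ρ` and the fact that the coproduct undoes the
product finish. -/
theorem delta_cointeraction (L : IsBased H p b) (N : IsBased K IsModular c)
    (hρ : IsDelta ρ p b c) (S T : Type u) [Finite S] [Finite T] :
    (K.comul S T).lTensor (F.obj (S ⊕ T)) ∘ₗ ρ (S ⊕ T) =
      (H.mul S T).rTensor (C.obj S ⊗[ℝ] C.obj T) ∘ₗ
        (TensorProduct.tensorTensorTensorComm ℝ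
          (F.obj S) (C.obj S) (F.obj T) (C.obj T)).toLinearMap ∘ₗ
        TensorProduct.map (ρ S) (ρ T) ∘ₗ H.comul S T := L.hom_ext fun z hz => by
  by_cases h : z (left S T) = ⊤
  · simp only [LinearMap.comp_apply]
    rw [L.comul_b_of_eq_top hz h, hρ hz, map_zero, map_zero, map_zero, map_sum]
    refine Finset.sum_eq_zero fun P _ => ?_
    rw [LinearMap.lTensor_tmul, comul_cone_eq_zero N P.2.toCompatible
      (not_refines_ordPre P.2.toCompatible h), TensorProduct.tmul_zero]
  · have hQ := compatible_ordPre h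
    -- Only preorders refining `ordPre` survive, since otherwise `z^P` is infinite on `S`. They
    -- correspond to the preorders conforming to the face, with the same first factor and with
    -- second factor replaced by its face at `ordPre`.
    have key : (K.comul S T).lTensor (F.obj (S ⊕ T)) (ρ (S ⊕ T) (b z)) =
        (K.comul S T).lTensor (F.obj (S ⊕ T)) (ρ (S ⊕ T) (b (face z (ordPre S T) hQ))) := by
      rw [hρ hz, hρ (L.p_face hQ hz), map_sum, map_sum, sum_conforming_face hQ]
      refine Finset.sum_congr rfl fun P _ => ?_
      split_ifs with hP
      · rw [LinearMap.lTensor_tmul, LinearMap.lTensor_tmul, face_rest P.2 hP, cone_rest hP,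
          comul_face_ordPre N (isModular_cone P.2.toCompatible) (cone_left_ne_top h hP)]
      · rw [LinearMap.lTensor_tmul, comul_cone_eq_zero N P.2.toCompatible hP,
          TensorProduct.tmul_zero]
    have hmul := LinearMap.congr_fun ((delta_multiplicative L N hρ).map_mul S T)
      (b (z.restrict h) ⊗ₜ b (z.corestrict h))
    simp only [LinearMap.comp_apply] at hmul ⊢
    rw [key, L.comul_b hz h, face_ordPre h,
      ← L.mul_b (L.p_restrict h hz) (L.p_corestrict h hz), hmul, ← LinearMap.comp_apply,
      LinearMap.lTensor_comp_map, comul_comp_mul N]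
    rfl

theorem delta_cointeraction_counit (L : IsBased H p b) (N : IsBased K IsModular c)
    (hρ : IsDelta ρ p b c) (x : F.obj PEmpty.{u + 1}) :
    TensorProduct.rid ℝ (F.obj PEmpty.{u + 1}) (K.counit.lTensor (F.obj PEmpty.{u + 1})
      (ρ PEmpty x)) = H.counit x • H.one := by
  have : (TensorProduct.rid ℝ (F.obj PEmpty.{u + 1})).toLinearMap ∘ₗ
      K.counit.lTensor (F.obj PEmpty.{u + 1}) ∘ₗ ρ PEmpty = H.counit.smulRight H.one :=
    L.hom_ext fun z hz => by
      obtain rfl := eq_zero z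
      simp only [LinearMap.comp_apply, LinearEquiv.coe_coe, LinearMap.smulRight_apply]
      rw [delta_of_isEmpty hρ hz, LinearMap.lTensor_tmul, N.counit_b isModular_zero,
        TensorProduct.rid_tmul, L.counit_b hz, L.one_eq]
  exact LinearMap.congr_fun this x

theorem isInternalBimonoid (N : IsBased K IsModular c) (hδ : IsDelta δ IsModular c c)
    (hε : IsEps ε c) : IsInternalBimonoid K δ ε where
  isMonoid := N.isMonoid
  isInternalComonoid :=
    { natural := delta_natural N N hδ
      counit_natural := fun _ _ _ _ e => eps_natural N hε e
      coassoc := delta_coassoc N hδ hδ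
      rid := delta_counital N hδ hε
      lid := fun I _ => delta_lid N hδ hε I }
  multiplicative := delta_multiplicative N N hδ
  counit_mul := eps_mul N hε
  counit_one := by
    rw [N.one_eq, hε isModular_zero, if_pos]
    exact fun x => isEmptyElim x

theorem isComoduleBimonoid (L : IsBased H p b) (N : IsBased K IsModular c)
    (hρ : IsDelta ρ p b c) (hδ : IsDelta δ IsModular c c) (hε : IsEps ε c) :
    IsComoduleBimonoid H K ρ δ ε where
  isBimonoid := L.isBimonoid
  isBimonoid_base := N.isBimonoid
  isInternalBimonoid_base := isInternalBimonoid N hδ hε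
  isComodule :=
    { natural := delta_natural L N hρ
      coassoc := delta_coassoc L hρ hδ
      counital := delta_counital L hρ hε }
  multiplicative := delta_multiplicative L N hρ
  cointeraction := delta_cointeraction L N hρ
  cointeraction_counit := delta_cointeraction_counit L N hρ

theorem phi_natural (L : IsBased H p b) (N : IsBased K IsModular c) (hφ : IsPhi φ p b c) :
    IsSpeciesMorphism φ := fun I J _ _ e => L.hom_ext fun z hz => by
  simp only [LinearMap.comp_apply]
  rw [L.map_b e hz, hφ hz, hφ (L.p_map e hz), sum_conforming_map, map_sum]
  refine Finset.sum_congr rfl fun P _ => ?_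
  rw [if_congr (isMinPre_map e) rfl rfl, cone_map]
  split_ifs
  · rw [N.map_b e (isModular_cone P.2.toCompatible)]
  · rw [map_zero]

theorem phi_mul (L : IsBased H p b) (N : IsBased K IsModular c) (hφ : IsPhi φ p b c)
    (S T : Type u) [Finite S] [Finite T] :
    φ (S ⊕ T) ∘ₗ H.mul S T = K.mul S T ∘ₗ TensorProduct.map (φ S) (φ T) :=
  L.tensor_ext fun x y hx hy => by
    simp only [LinearMap.comp_apply, TensorProduct.map_tmul]
    rw [L.mul_b hx hy, hφ hx, hφ hy, hφ (L.p_prod hx hy), sum_conforming_prod,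
      TensorProduct.sum_tmul, map_sum]
    refine Finset.sum_congr rfl fun P _ => ?_
    rw [TensorProduct.tmul_sum, map_sum]
    refine Finset.sum_congr rfl fun Q _ => ?_
    rw [if_congr (isMinPre_prod P.2 Q.2) rfl rfl]
    by_cases h1 : IsMinPre x P.1
    · by_cases h2 : IsMinPre y Q.1
      · rw [if_pos ⟨h1, h2⟩, if_pos h1, if_pos h2, cone_sumPre,
          N.mul_b (isModular_cone P.2.toCompatible) (isModular_cone Q.2.toCompatible)]
      · rw [if_neg fun h => h2 h.2, if_neg h2, TensorProduct.tmul_zero, map_zero]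
    · rw [if_neg fun h => h1 h.1, if_neg h1, TensorProduct.zero_tmul, map_zero]

theorem phi_comul (L : IsBased H p b) (N : IsBased K IsModular c) (hφ : IsPhi φ p b c)
    (S T : Type u) [Finite S] [Finite T] :
    K.comul S T ∘ₗ φ (S ⊕ T) = TensorProduct.map (φ S) (φ T) ∘ₗ H.comul S T :=
  L.hom_ext fun z hz => by
    by_cases h : z (left S T) = ⊤
    · simp only [LinearMap.comp_apply]
      rw [L.comul_b_of_eq_top hz h, hφ hz, map_zero, map_sum]
      refine Finset.sum_eq_zero fun P _ => ?_
      split_ifs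
      · rw [comul_cone_eq_zero N P.2.toCompatible (not_refines_ordPre P.2.toCompatible h)]
      · rw [map_zero]
    · have hQ := compatible_ordPre h
      -- The same replacement of `z` by its face at `ordPre`, with minimality transported by
      -- `isMinPre_rest`.
      have key : K.comul S T (φ (S ⊕ T) (b z)) =
          K.comul S T (φ (S ⊕ T) (b (face z (ordPre S T) hQ))) := by
        rw [hφ hz, hφ (L.p_face hQ hz), map_sum, map_sum, sum_conforming_face hQ]
        refine Finset.sum_congr rfl fun P _ => ?_
        by_cases hP : Refines P.1 (ordPre S T)
        · rw [dif_pos hP, if_congr (isMinPre_rest P.2 hP hQ) rfl rfl]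
          split_ifs
          · rw [cone_rest hP,
              comul_face_ordPre N (isModular_cone P.2.toCompatible) (cone_left_ne_top h hP)]
          · rfl
        · rw [dif_neg hP]
          split_ifs
          · exact comul_cone_eq_zero N P.2.toCompatible hP
          · rw [map_zero]
      have hmul := LinearMap.congr_fun (phi_mul L N hφ S T)
        (b (z.restrict h) ⊗ₜ b (z.corestrict h))
      simp only [LinearMap.comp_apply] at hmul ⊢
      rw [key, L.comul_b hz h, face_ordPre h,
        ← L.mul_b (L.p_restrict h hz) (L.p_corestrict h hz), hmul]
      exact LinearMap.congr_fun (comul_comp_mul N S T) _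

theorem phi_of_isEmpty (hφ : IsPhi φ p b c) {I : Type u} [Finite I] [IsEmpty I]
    {z : SubmodFun I} (hz : p z) : φ I (b z) = c z := by
  rw [hφ hz, sum_conforming_of_isEmpty, if_pos]
  · congr 1
    exact Subsingleton.elim _ _
  · exact fun Q _ _ x => isEmptyElim x

theorem phi_isBimonoidMorphism (L : IsBased H p b) (N : IsBased K IsModular c)
    (hφ : IsPhi φ p b c) : IsBimonoidMorphism H K φ where
  isMorphism := phi_natural L N hφ
  map_mul := phi_mul L N hφ
  map_one := by rw [L.one_eq, N.one_eq, phi_of_isEmpty hφ L.p_zero]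
  map_comul := phi_comul L N hφ
  map_counit := L.form_ext fun z hz => by
    obtain rfl := eq_zero z
    rw [LinearMap.comp_apply, phi_of_isEmpty hφ hz, N.counit_b isModular_zero, L.counit_b hz]

/-- There is only one submodular function on the empty set. -/
theorem IsBased.isConnected (L : IsBased H p b) : IsConnected H := fun x => by
  have : H.counit.smulRight H.one = LinearMap.id := L.hom_ext fun z hz => by
    obtain rfl := eq_zero z
    rw [LinearMap.smulRight_apply, L.counit_b hz, one_smul, L.one_eq, LinearMap.id_apply]
  exact LinearMap.congr_fun this x

/-- Both sides become the sum of `(z^P)_Q ⊗ z^Q` over conforming `P ≼ Q` with `P` minimal for `z`;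
on the right, minimality for `z_Q` is translated by `isMinPre_rest`. -/
theorem phi_isComoduleMorphism (L : IsBased H p b) (N : IsBased K IsModular c)
    (hρ : IsDelta ρ p b c) (hδ : IsDelta δ IsModular c c) (hφ : IsPhi φ p b c) :
    IsComoduleMorphism ρ δ φ where
  isMorphism := phi_natural L N hφ
  map_coaction I _ := L.hom_ext fun z hz => by
    simp only [LinearMap.comp_apply]
    rw [hφ hz, hρ hz, map_sum, map_sum]
    have h1 : ∀ P : ConformingPre z, δ I (if IsMinPre z P.1 then c (cone z P.1) else 0) =
        ∑ Q : ConformingPre z, if h : Refines P.1 Q.1 then if IsMinPre z P.1 then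
          c (face (cone z P.1) Q.1 (compatible_cone h Q.2.toCompatible)) ⊗ₜ[ℝ] c (cone z Q.1)
          else 0 else 0 := fun P => by
      by_cases hP : IsMinPre z P.1
      · simp only [if_pos hP]
        rw [hδ (isModular_cone P.2.toCompatible), sum_conforming_cone P.2]
        refine Finset.sum_congr rfl fun Q _ => ?_
        split_ifs with h
        · rw [cone_cone h]
        · rfl
      · simp only [if_neg hP, map_zero, dite_eq_ite, ite_self, Finset.sum_const_zero]
    have h2 : ∀ Q : ConformingPre z, (φ I).rTensor (C.obj I)
        (b (face z Q.1 Q.2.toCompatible) ⊗ₜ[ℝ] c (cone z Q.1)) =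
        ∑ P : ConformingPre z, if h : Refines P.1 Q.1 then if IsMinPre z P.1 then
          c (face (cone z P.1) Q.1 (compatible_cone h Q.2.toCompatible)) ⊗ₜ[ℝ] c (cone z Q.1)
          else 0 else 0 := fun Q => by
      rw [LinearMap.rTensor_tmul, hφ (L.p_face Q.2.toCompatible hz), TensorProduct.sum_tmul,
        sum_conforming_face Q.2.toCompatible]
      refine Finset.sum_congr rfl fun P _ => ?_
      by_cases h : Refines P.1 Q.1
      · rw [dif_pos h, dif_pos h, if_congr (isMinPre_rest P.2 h _) rfl rfl]
        split_ifs
        · rw [cone_rest h]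
        · rw [TensorProduct.zero_tmul]
      · rw [dif_neg h, dif_neg h]
    rw [Finset.sum_congr rfl fun P _ => h1 P, Finset.sum_congr rfl fun Q _ => h2 Q,
      Finset.sum_comm]

theorem phi_of_isModular (hφ : IsPhi φ p b c) {I : Type u} [Finite I] {z : SubmodFun I}
    (hz : z.IsModular) (hz' : p z) : φ I (b z) = c z := by
  rw [hφ hz', sum_conforming_eq ⟨pre z, conforms_pre hz⟩]
  · rw [if_pos ((isMinPre_of_isModular hz (conforms_pre hz)).2 rfl), cone_pre]
  · intro Q hQ
    rw [if_neg fun h => hQ ((isMinPre_of_isModular hz Q.2).1 h)]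

/-- All points are equivalent in `pre (lowCoarse I)`, and every conforming preorder is coarser, so
the sum has one term. -/
theorem delta_lowCoarse (hδ : IsDelta δ IsModular c c) (I : Type u) [Finite I] :
    δ I (c (lowCoarse I)) = c (lowCoarse I) ⊗ₜ[ℝ] c (lowCoarse I) := by
  have h := conforms_pre (isModular_lowCoarse (I := I))
  rw [hδ isModular_lowCoarse, sum_conforming_eq ⟨_, h⟩ fun Q hQ => (hQ (eq_pre_lowCoarse Q.2)).elim,
    cone_pre, face_eq_self isTotallyDisconnected_pre_lowCoarse]

end Coactions

/-! ### The concrete maps `deltaSM`, `deltaMOD`, `epsMOD`, `phi`, `incl` and `etaMOD`. -/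

open SubmodFun

theorem isDelta_deltaSM : IsDelta deltaSM.{u} (fun _ => True) smBasis modBasis := fun _ => by
  simp only [deltaSM, smBasis, Finsupp.linearCombination_single, one_smul]
  exact Finset.sum_congr rfl fun P _ => by rw [modBasis_eq (isModular_cone P.2.toCompatible)]

theorem isDelta_deltaMOD : IsDelta deltaMOD.{u} IsModular modBasis modBasis := fun hz => by
  beta_reduce
  rw [modBasis_eq hz]
  simp only [deltaMOD, Finsupp.linearCombination_single, one_smul]
  exact Finset.sum_congr rfl fun P _ => by
    rw [modBasis_eq (isModular_cone P.2.toCompatible),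
      modBasis_eq (isModular_face hz P.1 P.2.toCompatible)]

theorem isEps_epsMOD : IsEps epsMOD.{u} modBasis := fun hz => by
  beta_reduce
  rw [modBasis_eq hz]
  simp only [epsMOD, Finsupp.linearCombination_single, one_smul]

theorem isPhi_phi : IsPhi phi.{u} (fun _ => True) smBasis modBasis := fun {I _ z} _ => by
  rw [← sum_minConforming z fun P => (modBasis (cone z P) : MOD.obj I)]
  simp only [phi, smBasis, Finsupp.linearCombination_single, one_smul]
  exact Finset.sum_congr rfl fun P _ => by rw [modBasis_eq (isModular_cone P.2.1.toCompatible)]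

theorem incl_modBasis {I : Type u} [Finite I] {z : SubmodFun I} (hz : z.IsModular) :
    incl I (modBasis z) = smBasis z := by
  simp [modBasis_eq hz, incl, smBasis]

theorem incl_isSpeciesMorphism : IsSpeciesMorphism incl.{u} := fun I J _ _ e =>
  MOD_isBased.hom_ext fun z hz => by
    rw [LinearMap.comp_apply, LinearMap.comp_apply, MOD_isBased.map_b e hz,
      incl_modBasis (hz.map e), incl_modBasis hz, SM_isBased.map_b e trivial]

theorem incl_isBimonoidMorphism : IsBimonoidMorphism MOD.ops.{u} SM.ops.{u} incl.{u} where
  isMorphism := incl_isSpeciesMorphism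
  map_mul S T _ _ := MOD_isBased.tensor_ext fun x y hx hy => by
    rw [LinearMap.comp_apply, LinearMap.comp_apply, TensorProduct.map_tmul,
      MOD_isBased.mul_b hx hy, incl_modBasis (hx.prod hy), incl_modBasis hx, incl_modBasis hy,
      SM_isBased.mul_b trivial trivial]
  map_one := by
    rw [SM_isBased.one_eq, MOD_isBased.one_eq, incl_modBasis isModular_zero]
  map_comul S T _ _ := MOD_isBased.hom_ext fun z hz => by
    rw [LinearMap.comp_apply, LinearMap.comp_apply, incl_modBasis hz]
    by_cases h : z (left S T) = ⊤
    · rw [SM_isBased.comul_b_of_eq_top trivial h, MOD_isBased.comul_b_of_eq_top hz h, map_zero]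
    · rw [SM_isBased.comul_b trivial h, MOD_isBased.comul_b hz h, TensorProduct.map_tmul,
        incl_modBasis (hz.restrict h), incl_modBasis (hz.corestrict h)]
  map_counit := MOD_isBased.form_ext fun z hz => by
    rw [LinearMap.comp_apply, incl_modBasis hz, SM_isBased.counit_b trivial,
      MOD_isBased.counit_b hz]

theorem incl_isComoduleMorphism : IsComoduleMorphism deltaMOD.{u} deltaSM.{u} incl.{u} where
  isMorphism := incl_isSpeciesMorphism
  map_coaction I _ := MOD_isBased.hom_ext fun z hz => by
    rw [LinearMap.comp_apply, LinearMap.comp_apply, incl_modBasis hz, isDelta_deltaSM trivial,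
      isDelta_deltaMOD hz, map_sum]
    exact Finset.sum_congr rfl fun P _ => by
      rw [LinearMap.rTensor_tmul, incl_modBasis (isModular_face hz P.1 P.2.toCompatible)]

/-- `φ` is a retraction of the inclusion. -/
theorem phi_comp_incl (I : Type u) [Finite I] : phi I ∘ₗ incl I = LinearMap.id :=
  MOD_isBased.hom_ext fun z hz => by
    rw [LinearMap.comp_apply, incl_modBasis hz, phi_of_isModular isPhi_phi hz trivial,
      LinearMap.id_apply]

theorem etaMOD_eq (I : Type u) [Finite I] : etaMOD I = modBasis (lowCoarse I) :=
  (modBasis_eq isModular_lowCoarse).symm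

theorem map_lowCoarse {I J : Type u} (e : I ≃ J) : (lowCoarse I).map e = lowCoarse J :=
  ext_apply fun A => by
    have h : e ⁻¹' A = ∅ ∨ e ⁻¹' A = Set.univ ↔ A = ∅ ∨ A = Set.univ := by
      rw [Set.preimage_eq_empty_iff, Set.preimage_eq_univ_iff]
      simp
    rw [map_apply]
    exact if_congr h rfl rfl

theorem map_etaMOD {I J : Type u} [Finite I] [Finite J] (e : I ≃ J) :
    MOD.map e (etaMOD I) = etaMOD J := by
  rw [etaMOD_eq, etaMOD_eq, MOD_isBased.map_b e isModular_lowCoarse, map_lowCoarse]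

theorem epsMOD_etaMOD (I : Type u) [Finite I] : epsMOD I (etaMOD I) = 1 := by
  rw [etaMOD_eq, isEps_epsMOD isModular_lowCoarse, if_pos isTotallyDisconnected_pre_lowCoarse]

theorem deltaMOD_etaMOD (I : Type u) [Finite I] :
    deltaMOD I (etaMOD I) = etaMOD I ⊗ₜ[ℝ] etaMOD I := by
  rw [etaMOD_eq, delta_lowCoarse isDelta_deltaMOD]

theorem etaMOD_pempty : etaMOD PEmpty.{u + 1} = MOD.ops.one := by
  rw [etaMOD_eq, MOD_isBased.one_eq, eq_zero (lowCoarse _)]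

theorem phi_isHopfMorphism : IsHopfMorphism SM.ops.{u} MOD.ops.{u} phi.{u} :=
  (phi_isBimonoidMorphism SM_isBased MOD_isBased isPhi_phi).isHopfMorphism SM_isBased.isBimonoid
    MOD_isBased.isBimonoid SM_isBased.isConnected MOD_isBased.isConnected

theorem phi_isComoduleMorphism_SM : IsComoduleMorphism deltaSM.{u} deltaMOD.{u} phi.{u} :=
  phi_isComoduleMorphism SM_isBased MOD_isBased isDelta_deltaSM isDelta_deltaMOD isPhi_phi

end

end Cointeraction

theorem mainTheorem10 :
    -- `SM` and `MOD` are Hopf monoids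
    IsHopfMonoid SM.ops.{u} ∧
    IsHopfMonoid MOD.ops.{u} ∧
    -- the product, the coproduct and `δ` of `MOD` are restrictions of those of `SM`
    IsBimonoidMorphism MOD.ops.{u} SM.ops.{u}
      incl.{u} ∧
    IsComoduleMorphism deltaMOD.{u} deltaSM.{u}
      incl.{u} ∧
    -- `δ_MOD` is coassociative and counital, and makes `MOD` an internal bimonoid
    IsInternalBimonoid MOD.ops.{u} deltaMOD.{u}
      epsMOD.{u} ∧
    -- the internal unit of `MOD`
    (∀ (I J : Type u) [Finite I] [Finite J] (e : I ≃ J),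
      MOD.map e (etaMOD I) = etaMOD J) ∧
    (∀ (I : Type u) [Finite I],
      deltaMOD I (etaMOD I) =
          etaMOD I ⊗ₜ[ℝ] etaMOD I ∧
        epsMOD I (etaMOD I) = 1) ∧
    etaMOD PEmpty.{u + 1} = MOD.ops.one ∧
    -- `SM` is a comodule bimonoid over `MOD`, and so is `MOD`
    IsComoduleBimonoid SM.ops.{u} MOD.ops.{u}
      deltaSM.{u} deltaMOD.{u} epsMOD.{u} ∧
    IsComoduleBimonoid MOD.ops.{u} MOD.ops.{u}
      deltaMOD.{u} deltaMOD.{u} epsMOD.{u} ∧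
    -- `φ` is a morphism of Hopf monoids and of comodules, for `φ ⊗ id` as for `φ ⊗ φ`
    IsHopfMorphism SM.ops.{u} MOD.ops.{u}
      phi.{u} ∧
    IsComoduleMorphism deltaSM.{u} deltaMOD.{u}
      phi.{u} ∧
    (∀ (I : Type u) [Finite I],
      deltaMOD I ∘ₗ phi I =
        TensorProduct.map (phi I) (phi I ∘ₗ incl I) ∘ₗ
          deltaSM I) := by
  refine ⟨SM_isBased.isBimonoid.isHopfMonoid SM_isBased.isConnected,
    MOD_isBased.isBimonoid.isHopfMonoid MOD_isBased.isConnected,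
    incl_isBimonoidMorphism, incl_isComoduleMorphism,
    isInternalBimonoid MOD_isBased isDelta_deltaMOD isEps_epsMOD,
    fun _ _ _ _ e => map_etaMOD e, fun I _ => ⟨deltaMOD_etaMOD I, epsMOD_etaMOD I⟩,
    etaMOD_pempty,
    isComoduleBimonoid SM_isBased MOD_isBased isDelta_deltaSM isDelta_deltaMOD isEps_epsMOD,
    isComoduleBimonoid MOD_isBased MOD_isBased isDelta_deltaMOD isDelta_deltaMOD isEps_epsMOD,
    phi_isHopfMorphism, phi_isComoduleMorphism_SM, fun I _ => ?_⟩
  -- On modular functions `φ` is the identity, so `φ ⊗ φ` reduces to `φ ⊗ id`.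
  rw [phi_comp_incl]
  exact phi_isComoduleMorphism_SM.map_coaction I
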